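/- Let $\mathbb T=\mathbb R^2/\mathbb Z^2$ with its Lebesgue measure $dx$ of total mass $1$, let $\{v_\lambda:\lambda\in\mathbb Z^2\}$ be independent complex random variables on a probability space $(\Omega,\mathscr F,\mathbb P)$ such that, for each $\lambda$, $\mathrm{Re}\,v_\lambda$ and $\mathrm{Im}\,v_\lambda$ are independent standard Gaussian, and let $n\ge 1$ be a sum of two integer squares. Put $E_n=4\pi^2n$, $\Lambda_n=\{\lambda\in\mathbb Z^2:\lambda_1^2+\lambda_2^2=n\}$, $\mathcal N_n=|\Lambda_n|$, $e_\lambda(x)=e^{2\pi i\langle\lambda,x\rangle}$, $$\Theta_n(x)=\frac1{\sqrt{\mathcal N_n}}\sum_{\lambda\in\Lambda_n}v_\lambda e_\lambda(x),\qquad T_n=\mathrm{Re}\,\Theta_n,\qquad \widehat T_n=\mathrm{Im}\,\Theta_n,\qquad \widetilde\partial_j=\sqrt{2/E_n}\,\frac{\partial}{\partial x_j},$$ and let $I_n$ be the number of zeros of $\Theta_n$ in $\mathbb T$. Let $H_k$ be the Hermite polynomials ($H_0=1$, $H_k(t)=tH_{k-1}(t)-H_{k-1}'(t)$), and set $\beta_{2l+1}=0$,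 $\beta_{2l}=H_{2l}(0)/\sqrt{2\pi}$ and $$\alpha_{a,b,c,d}=\mathbb E\big[|XW-YV|\,H_a(X)H_b(Y)H_c(V)H_d(W)\big],$$ with $(X,Y,V,W)$ a standard Gaussian vector in $\mathbb R^4$. Let $a_\lambda=\frac12(v_\lambda+\overline{v_{-\lambda}})$ and $\widehat a_\lambda=\frac1{2i}(v_\lambda-\overline{v_{-\lambda}})$, so that $T_n=\mathcal N_n^{-1/2}\sum_{\lambda\in\Lambda_n}a_\lambda e_\lambda$ and $\widehat T_n=\mathcal N_n^{-1/2}\sum_{\lambda\in\Lambda_n}\widehat a_\lambda e_\lambda$. Let $\mathbf A$ be the closure in $L^2(\mathbb P)$ of the real linear span of the variables $c_1(za_\lambda+\bar z a_{-\lambda})+c_2(u\widehat a_\tau+\bar u\widehat a_{-\tau})$ with $\lambda,\tau\in\mathbb Z^2$, $z,u\in\mathbb C$, $c_1,c_2\in\mathbb R$. The $q$-th Wiener chaos $C_q$ is the closure in $L^2(\mathbb P)$ of the real linear span of the products $\prod_{j=1}^kH_{p_j}(\xi_j)$ with $k\ge1$, $p_1+\dots+p_k=q$ and $(\xi_1,\dots,\xi_k)$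 a standard Gaussian vector with entries in $\mathbf A$. For $F\in L^2(\mathbb P)$ let $F[q]$ be the orthogonal projection of $F$ onto $C_q$. Then, almost surely, $\Theta_n$ has finitely many zeros, $I_n\in L^2(\mathbb P)$, and the following hold. 1. $I_n[2q+1]=0$ for every $q\ge0$. 2. For every $q\ge0$, $$I_n[2q]=\frac{E_n}2\sum_{i_1+i_2+i_3+j_1+j_2+j_3=2q}\frac{\beta_{i_1}\beta_{j_1}}{i_1!\,j_1!}\,\frac{\alpha_{i_2,i_3,j_2,j_3}}{i_2!\,i_3!\,j_2!\,j_3!}\int_{\mathbb T}H_{i_1}(T_n)H_{j_1}(\widehat T_n)H_{i_2}(\widetilde\partial_1T_n)H_{i_3}(\widetilde\partial_2T_n)H_{j_2}(\widetilde\partial_1\widehat T_n)H_{j_3}(\widetilde\partial_2\widehat T_n)\,dx,$$ where the value of the sum over all indices in $\mathbb N^6$ with the given total does not change when it is restricted to those indices for which $i_1,j_1$ are even and $i_2,i_3,j_2,j_3$ all have the same parity. 3. In particular, $I_n[2]=0$. 4. The chaotic expansion of $I_n$ is $$I_n=I_n[0]+\sum_{q\ge2}\frac{E_n}2\sum_{i_1+i_2+i_3+j_1+j_2+j_3=2q}\frac{\beta_{i_1}\beta_{j_1}}{i_1!\,j_1!}\,\frac{\alpha_{i_2,i_3,j_2,j_3}}{i_2!\,i_3!\,j_2!\,j_3!}\int_{\mathbb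 T}H_{i_1}(T_n)H_{j_1}(\widehat T_n)H_{i_2}(\widetilde\partial_1T_n)H_{i_3}(\widetilde\partial_2T_n)H_{j_2}(\widetilde\partial_1\widehat T_n)H_{j_3}(\widetilde\partial_2\widehat T_n)\,dx,$$ where the inner sum runs over the indices with $i_1,j_1$ even and $i_2,i_3,j_2,j_3$ of the same parity, the term of index $q$ of the outer series belongs to $L^2(\mathbb P)$ for each $q$, and the outer series converges to $I_n-I_n[0]$ in $L^2(\mathbb P)$ (unconditionally). -/

import Mathlib

open MeasureTheory ProbabilityTheory
open scoped ENNReal ComplexConjugate Nat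

namespace ArithmeticWave

noncomputable section

/-- The set `S` of natural numbers that are sums of two integer squares. -/
def sumsOfTwoSquares : Set ℕ := {n | ∃ a b : ℤ, a ^ 2 + b ^ 2 = (n : ℤ)}

/-- The frequency set `Λ_n` of the `l ∈ ℤ²` with `l₁² + l₂² = n` (see `mem_freq`). -/
def freq (n : ℕ) : Finset (Fin 2 → ℤ) :=
  (Fintype.piFinset fun _ : Fin 2 => Finset.Icc (-(n : ℤ)) n).filter
    fun l => l 0 ^ 2 + l 1 ^ 2 = (n : ℤ)

theorem mem_freq (n : ℕ) (l : Fin 2 → ℤ) :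
    l ∈ freq n ↔ l 0 ^ 2 + l 1 ^ 2 = (n : ℤ) := by
  have key : ∀ a b m : ℤ, a ^ 2 + b ^ 2 = m → -m ≤ a ∧ a ≤ m := by
    intro a b m h
    constructor <;> nlinarith [sq_nonneg b, Int.le_self_sq a, Int.le_self_sq (-a)]
  simp only [freq, Finset.mem_filter, Fintype.mem_piFinset, Finset.mem_Icc, and_iff_right_iff_imp]
  intro h i
  fin_cases i
  · exact key _ _ _ h
  · exact key _ _ _ ((add_comm _ _).trans h)

/-- The energy `E_n = 4π²n`. -/
def energy (n : ℕ) : ℝ := 4 * Real.pi ^ 2 * n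

variable {Ω : Type*}

/-- The complex wave `Θ_n(x) = |Λ_n|^{-1/2} ∑_{l ∈ Λ_n} v_l e_l(x)` on the torus `(ℝ/ℤ)²`;
`UnitAddTorus.mFourier l` is the exponential `e_l(x) = exp(2πi⟨l, x⟩)`. -/
def wave (v : (Fin 2 → ℤ) → Ω → ℂ) (n : ℕ) (ω : Ω) (x : UnitAddTorus (Fin 2)) : ℂ :=
  (1 / (Real.sqrt (freq n).card : ℂ)) * ∑ l ∈ freq n, v l ω * UnitAddTorus.mFourier l x

/-- `T_n = Re Θ_n`. -/
def waveRe (v : (Fin 2 → ℤ) → Ω → ℂ) (n : ℕ) (ω : Ω) (x : UnitAddTorus (Fin 2)) : ℝ :=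
  (wave v n ω x).re

/-- `T̂_n = Im Θ_n`. -/
def waveIm (v : (Fin 2 → ℤ) → Ω → ℂ) (n : ℕ) (ω : Ω) (x : UnitAddTorus (Fin 2)) : ℝ :=
  (wave v n ω x).im

/-- The random set of zeros of `Θ_n` in the torus. -/
def zeroSet (v : (Fin 2 → ℤ) → Ω → ℂ) (n : ℕ) (ω : Ω) : Set (UnitAddTorus (Fin 2)) :=
  {x | wave v n ω x = 0}

/-- The number of zeros `I_n`. -/
def numZeros (v : (Fin 2 → ℤ) → Ω → ℂ) (n : ℕ) (ω : Ω) : ℝ := ((zeroSet v n ω).ncard : ℝ)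

/-- The partial derivative in direction `j` of a function on the torus. -/
def torusDeriv (j : Fin 2) (f : UnitAddTorus (Fin 2) → ℝ) (x : UnitAddTorus (Fin 2)) : ℝ :=
  deriv (fun t : ℝ => f (x + Pi.single j (t : UnitAddCircle))) 0

/-- The normalised partial derivative `√(2/E_n) ∂_j`. -/
def normDeriv (n : ℕ) (j : Fin 2) (f : UnitAddTorus (Fin 2) → ℝ)
    (x : UnitAddTorus (Fin 2)) : ℝ :=
  Real.sqrt (2 / energy n) * torusDeriv j f x

/-- Lebesgue measure on the torus (of total mass one). -/
def torusMeasure : Measure (UnitAddTorus (Fin 2)) :=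
  Measure.pi fun _ : Fin 2 => (AddCircle.haarAddCircle : Measure UnitAddCircle)

/-- The probabilists' Hermite polynomial `H_k`, with `H_0 = 1`, `H_{k+1} = t H_k - H_k'`. -/
def herm (k : ℕ) (t : ℝ) : ℝ := Polynomial.aeval t (Polynomial.hermite k)

/-- `β_{2l} = H_{2l}(0)/√(2π)` and `β_{2l+1} = 0`. -/
def beta (l : ℕ) : ℝ := if Even l then herm l 0 / Real.sqrt (2 * Real.pi) else 0

/-- `α_{a,b,c,d} = 𝔼[|XW - YV| H_a(X) H_b(Y) H_c(V) H_d(W)]` for a standard Gaussian vector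
`(X, Y, V, W) = (z 0, z 1, z 2, z 3)` in `ℝ⁴`. -/
def alpha (a b c d : ℕ) : ℝ :=
  ∫ z : Fin 4 → ℝ, |z 0 * z 3 - z 1 * z 2| *
      (herm a (z 0) * herm b (z 1) * herm c (z 2) * herm d (z 3))
    ∂(Measure.pi fun _ : Fin 4 => gaussianReal 0 1)

/-- The multi-indices `(i₁, j₁, i₂, i₃, j₂, j₃)` in `ℕ⁶` with sum `m`. -/
def indices (m : ℕ) : Finset (Fin 6 → ℕ) := Finset.piAntidiag Finset.univ m

/-- The multi-indices `(i₁, j₁, i₂, i₃, j₂, j₃)` with sum `m` such that `i₁, j₁` are even and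
`i₂, i₃, j₂, j₃` all have the same parity. -/
def parityIndices (m : ℕ) : Finset (Fin 6 → ℕ) :=
  (indices m).filter fun k => Even (k 0) ∧ Even (k 1) ∧
    (k 2 % 2 = k 3 % 2 ∧ k 3 % 2 = k 4 % 2 ∧ k 4 % 2 = k 5 % 2)

/-- The coefficient `β_{i₁} β_{j₁} / (i₁! j₁!) * α_{i₂ i₃ j₂ j₃} / (i₂! i₃! j₂! j₃!)` attached to
`k = (i₁, j₁, i₂, i₃, j₂, j₃)`. -/
def chaosCoeff (k : Fin 6 → ℕ) : ℝ :=
  beta (k 0) * beta (k 1) / ((k 0)! * (k 1)!) *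
    (alpha (k 2) (k 3) (k 4) (k 5) / ((k 2)! * (k 3)! * (k 4)! * (k 5)!))

/-- The integral over the torus of
`H_{i₁}(T_n) H_{j₁}(T̂_n) H_{i₂}(∂̃₁ T_n) H_{i₃}(∂̃₂ T_n) H_{j₂}(∂̃₁ T̂_n) H_{j₃}(∂̃₂ T̂_n)`. -/
def chaosIntegral (v : (Fin 2 → ℤ) → Ω → ℂ) (n : ℕ) (k : Fin 6 → ℕ) (ω : Ω) : ℝ :=
  ∫ x, herm (k 0) (waveRe v n ω x) * herm (k 1) (waveIm v n ω x) *
      herm (k 2) (normDeriv n 0 (waveRe v n ω) x) * herm (k 3) (normDeriv n 1 (waveRe v n ω) x) *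
      herm (k 4) (normDeriv n 0 (waveIm v n ω) x) * herm (k 5) (normDeriv n 1 (waveIm v n ω) x)
    ∂torusMeasure

/-- `(E_n / 2) ∑_{k ∈ K} chaosCoeff k * chaosIntegral k`, as a random variable. -/
def chaosSum (v : (Fin 2 → ℤ) → Ω → ℂ) (n : ℕ) (K : Finset (Fin 6 → ℕ)) (ω : Ω) : ℝ :=
  energy n / 2 * ∑ k ∈ K, chaosCoeff k * chaosIntegral v n k ω

/-- The Fourier coefficient `a_l` of `T_n = |Λ_n|^{-1/2} ∑_{l ∈ Λ_n} a_l e_l`. -/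
def coeffRe (v : (Fin 2 → ℤ) → Ω → ℂ) (l : Fin 2 → ℤ) (ω : Ω) : ℂ :=
  (v l ω + conj (v (-l) ω)) / 2

/-- The Fourier coefficient `â_l` of `T̂_n = |Λ_n|^{-1/2} ∑_{l ∈ Λ_n} â_l e_l`. -/
def coeffIm (v : (Fin 2 → ℤ) → Ω → ℂ) (l : Fin 2 → ℤ) (ω : Ω) : ℂ :=
  (v l ω - conj (v (-l) ω)) / (2 * Complex.I)

variable [MeasurableSpace Ω]

/-- The Gaussian space `𝐀`: the closure in `L²(P)` of the real linear span of the variables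
`c₁ (z a_l + z̄ a_{-l}) + c₂ (u â_m + ū â_{-m})`. -/
def gaussianSpace (v : (Fin 2 → ℤ) → Ω → ℂ) (P : Measure Ω) : Submodule ℝ (Lp ℝ 2 P) :=
  (Submodule.span ℝ {f : Lp ℝ 2 P | ∃ (l m : Fin 2 → ℤ) (z u : ℂ) (c₁ c₂ : ℝ), ∀ᵐ ω ∂P,
    ((f ω : ℝ) : ℂ) =
      c₁ * (z * coeffRe v l ω + conj z * coeffRe v (-l) ω) +
      c₂ * (u * coeffIm v m ω + conj u * coeffIm v (-m) ω)}).topologicalClosure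

/-- The `q`-th Wiener chaos `C_q`: the closure in `L²(P)` of the real linear span of the products
`∏_j H_{p_j}(ξ_j)` with `p_1 + ⋯ + p_k = q` and `(ξ_1, …, ξ_k)` a standard Gaussian vector with
entries in `𝐀`. -/
def chaos (v : (Fin 2 → ℤ) → Ω → ℂ) (P : Measure Ω) (q : ℕ) : Submodule ℝ (Lp ℝ 2 P) :=
  (Submodule.span ℝ {f : Lp ℝ 2 P | ∃ (k : ℕ) (p : Fin k → ℕ) (ξ : Fin k → Lp ℝ 2 P),
    1 ≤ k ∧ ∑ j, p j = q ∧ (∀ j, ξ j ∈ gaussianSpace v P) ∧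
    HasLaw (fun ω j => ξ j ω) (Measure.pi fun _ : Fin k => gaussianReal 0 1) P ∧
    ∀ᵐ ω ∂P, f ω = ∏ j, herm (p j) (ξ j ω)}).topologicalClosure

/-- The orthogonal projection `F ↦ F[q]` of `L²(P)` onto the `q`-th Wiener chaos. -/
def chaosProj (v : (Fin 2 → ℤ) → Ω → ℂ) (P : Measure Ω) (q : ℕ) : Lp ℝ 2 P →L[ℝ] Lp ℝ 2 P :=
  haveI : CompleteSpace (chaos v P q) :=
    (Submodule.isClosed_topologicalClosure _).completeSpace_coe
  (chaos v P q).starProjection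

end

end ArithmeticWave

open ArithmeticWave

/-!
The zeros of `Θ_n` are counted by the Kac-Rice approximation
`∫ (2ε)⁻² 1{|T| ≤ ε, |T̂| ≤ ε} |Jac (T, T̂)| dx`, the average over a small square of the number of
preimages under `Θ_n` (`lintegral_abs_det_eq_lintegral_count`, the area formula). The argument rests
on three facts.

* *The approximation is bounded and eventually exact.* Almost every value of a trigonometric
  polynomial with frequencies in a fixed box is attained a bounded number of times
  (`ae_encard_fibre_le`): the exponentials of degree one satisfy a polynomial equation with
  coefficients in `Re`, `Im` of the value, by counting dimensions of spaces of trigonometric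
  polynomials. Almost surely all zeros of `Θ_n` are nondegenerate (`ae_nondegenerate`), as the law of
  one coefficient given the others is absolutely continuous; so the number of preimages of `y` is
  locally constant at `y = 0` and the approximation equals `I_n` for all small `ε`
  (`exists_approxCount_eq_ncard`). Hence `I_n` is bounded and the approximations converge to it in
  `L²` (`GaussianCoeffs.tendsto_toLp_smoothCount`).

* *The approximation has an explicit chaos expansion.* At each point of the torus, the wave and its
  normalised derivatives form a standard Gaussian vector in `ℝ⁶` with entries in the Gaussian space
  (`GaussianCoeffs.measurePreserving_field_apply`), so that the Hermite expansion in `L²` of the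
  standard Gaussian law of `ℝ⁶` (`hasSum_hermLp`) is an expansion into chaoses. Chaoses of different
  orders are orthogonal (`GaussianCoeffs.chaos_isOrtho`), by the Mehler formula and the rotation
  invariance of pairs of independent copies of a centred Gaussian vector. Closed subspaces are stable
  under integration over the torus (`integral_mem_of_forall_mem`), which gives the projections of
  the approximations (`GaussianCoeffs.chaosProj_integral_field`). Their coefficients tend to
  `chaosCoeff` (`tendsto_hermCoeff_approxKernel`), and those of `I_n` follow by continuity of the
  projections.

* *Symmetries of the coefficients.* Sign changes that preserve `|XW - YV|` kill the coefficients of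
  mixed parity (`alpha_eq_zero`). In order two, `β₂ = -β₀`, and each second order coefficient of
  `|XW - YV|` is half of its mean, as this function is homogeneous of degree one in `(X, Y)` and in
  `(V, W)` (`alpha_two_zero`); the contributions of the wave and of its gradient then cancel because
  `Θ_n` is an eigenfunction of the Laplacian (`integral_sum_sq_deriv`).
-/

open MeasureTheory ProbabilityTheory
open scoped ENNReal ComplexConjugate Nat

namespace ArithmeticWave

noncomputable section

/-! ### The area formula and fibres over a regular value -/

section AreaFormula

open Topology Filter

variable {E : Type*} [NormedAddCommGroup E] [NormedSpace ℝ E] [FiniteDimensional ℝ E]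

theorem exists_mem_nhds_injOn {f : E → E} {f' : E →L[ℝ] E} {x : E}
    (hf : HasStrictFDerivAt f f' x) (h : f'.det ≠ 0) : ∃ V ∈ 𝓝 x, Set.InjOn f V := by
  have : CompleteSpace E := FiniteDimensional.complete ℝ E
  have h' : HasStrictFDerivAt f
      ((f'.toContinuousLinearEquivOfDetNeZero h : E ≃L[ℝ] E) : E →L[ℝ] E) x := by
    simpa using hf
  exact ⟨_, (h'.toOpenPartialHomeomorph f).open_source.mem_nhds
    h'.mem_toOpenPartialHomeomorph_source, (h'.toOpenPartialHomeomorph f).injOn⟩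

theorem map_nhds_eq_of_det_ne_zero {f : E → E} {f' : E →L[ℝ] E} {x : E}
    (hf : HasStrictFDerivAt f f' x) (h : f'.det ≠ 0) : map f (𝓝 x) = 𝓝 (f x) := by
  have : CompleteSpace E := FiniteDimensional.complete ℝ E
  have h' : HasStrictFDerivAt f
      ((f'.toContinuousLinearEquivOfDetNeZero h : E ≃L[ℝ] E) : E →L[ℝ] E) x := by
    simpa using hf
  exact h'.map_nhds_eq_of_equiv

theorem exists_seq_isOpen_injOn {X Y : Type*} [TopologicalSpace X] [SecondCountableTopology X]
    {f : X → Y} {R : Set X} (h : ∀ x ∈ R, ∃ V ∈ 𝓝 x, Set.InjOn f V) :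
    ∃ U : ℕ → Set X, (∀ i, IsOpen (U i) ∧ Set.InjOn f (U i)) ∧ R ⊆ ⋃ i, U i := by
  choose! V hV hinj using h
  obtain ⟨t, htR, htc, hcov⟩ := TopologicalSpace.countable_cover_nhdsWithin
    (f := fun x => interior (V x)) (s := R)
    (fun x hx => mem_nhdsWithin_of_mem_nhds (interior_mem_nhds.2 (hV x hx)))
  rcases t.eq_empty_or_nonempty with rfl | hne
  · refine ⟨fun _ => ∅, fun i => ⟨isOpen_empty, Set.injOn_empty _⟩, ?_⟩
    simpa using hcov
  · obtain ⟨g, rfl⟩ := htc.exists_eq_range hne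
    refine ⟨fun i => interior (V (g i)), fun i => ⟨isOpen_interior, ?_⟩, ?_⟩
    · exact (hinj _ (htR ⟨i, rfl⟩)).mono interior_subset
    · simpa using hcov

theorem count_inter_preimage_singleton {X Y : Type*} [MeasurableSpace X]
    [MeasurableSingletonClass X] {f : X → Y} {A : Set X} (hA : Set.InjOn f A) (y : Y) :
    Measure.count (A ∩ f ⁻¹' {y}) = (f '' A).indicator (fun _ => (1 : ℝ≥0∞)) y := by
  classical
  by_cases hy : y ∈ f '' A
  · obtain ⟨x, hx, rfl⟩ := hy
    have : A ∩ f ⁻¹' {f x} = {x} := by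
      ext z
      constructor
      · rintro ⟨hz, hzx⟩
        exact hA hz hx hzx
      · rintro rfl
        exact ⟨hx, rfl⟩
    rw [this, Measure.count_singleton, Set.indicator_of_mem (Set.mem_image_of_mem f hx)]
  · have : A ∩ f ⁻¹' {y} = ∅ := by
      ext z
      simp only [Set.mem_inter_iff, Set.mem_preimage, Set.mem_singleton_iff, Set.mem_empty_iff_false,
        iff_false, not_and]
      rintro hz rfl
      exact hy ⟨z, hz, rfl⟩
    rw [this, measure_empty, Set.indicator_of_notMem hy]

variable [MeasurableSpace E] [BorelSpace E]

/-- The area formula for an everywhere strictly differentiable map between spaces of equal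
dimension. The critical points contribute nothing to the right side by Sard's theorem, and the
regular points form a countable union of pieces on which the map is injective. -/
theorem lintegral_abs_det_eq_lintegral_count {μ : Measure E} [μ.IsAddHaarMeasure] {f : E → E}
    {f' : E → E →L[ℝ] E} (hf : ∀ x, HasStrictFDerivAt f (f' x) x) {s : Set E}
    (hs : MeasurableSet s) :
    ∫⁻ x in s, ENNReal.ofReal |(f' x).det| ∂μ = ∫⁻ y, Measure.count (s ∩ f ⁻¹' {y}) ∂μ := by
  have : CompleteSpace E := FiniteDimensional.complete ℝ E
  have hcont : Continuous f :=
    continuous_iff_continuousAt.2 fun x => (hf x).hasFDerivAt.continuousAt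
  have hf'eq : f' = fderiv ℝ f := funext fun x => (hf x).hasFDerivAt.fderiv.symm
  have hdet : Measurable fun x => (f' x).det := by
    rw [hf'eq]
    exact ContinuousLinearMap.continuous_det.measurable.comp (measurable_fderiv ℝ f)
  set R : Set E := {x | (f' x).det ≠ 0} with hR
  have hRm : MeasurableSet R := (hdet (measurableSet_singleton 0)).compl
  obtain ⟨U, hU, hRU⟩ := exists_seq_isOpen_injOn (f := f) (R := R)
    fun x hx => exists_mem_nhds_injOn (hf x) hx
  set A : ℕ → Set E := fun i => disjointed U i ∩ (s ∩ R) with hA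
  have hAm : ∀ i, MeasurableSet (A i) := fun i =>
    (MeasurableSet.disjointed (fun i => (hU i).1.measurableSet) i).inter (hs.inter hRm)
  have hAd : Pairwise (Function.onFun Disjoint A) := fun i j hij =>
    ((disjoint_disjointed U) hij).mono Set.inter_subset_left Set.inter_subset_left
  have hAU : ⋃ i, A i = s ∩ R := by
    rw [← Set.iUnion_inter, iUnion_disjointed]
    exact Set.inter_eq_right.2 (Set.inter_subset_right.trans hRU)
  have hAi : ∀ i, Set.InjOn f (A i) := fun i =>
    (hU i).2.mono (Set.inter_subset_left.trans (disjointed_subset U i))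
  have hd : ∀ i, ∀ x ∈ A i, HasFDerivWithinAt f (f' x) (A i) x := fun i x _ =>
    (hf x).hasFDerivAt.hasFDerivWithinAt
  have himm : ∀ i, MeasurableSet (f '' A i) := fun i =>
    measurable_image_of_fderivWithin (hAm i) (hd i) (hAi i)
  have hleft : ∫⁻ x in s, ENNReal.ofReal |(f' x).det| ∂μ
      = ∑' i, μ (f '' A i) := by
    have h1 : ∫⁻ x in s, ENNReal.ofReal |(f' x).det| ∂μ
        = ∫⁻ x in s ∩ R, ENNReal.ofReal |(f' x).det| ∂μ := by
      rw [← lintegral_inter_add_sdiff (μ := μ) _ s hRm]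
      have : ∫⁻ x in s \ R, ENNReal.ofReal |(f' x).det| ∂μ = 0 := by
        rw [setLIntegral_congr_fun (g := fun _ => 0) (hs.diff hRm)]
        · simp
        · intro x hx
          have : (f' x).det = 0 := by simpa [hR] using hx.2
          simp [this]
      rw [this, add_zero]
    rw [h1, ← hAU, lintegral_iUnion hAm hAd]
    exact tsum_congr fun i => lintegral_abs_det_fderiv_eq_addHaar_image μ (hAm i) (hd i) (hAi i)
  have hcrit : μ (f '' (Rᶜ)) = 0 :=
    addHaar_image_eq_zero_of_det_fderivWithin_eq_zero μ
      (fun x _ => (hf x).hasFDerivAt.hasFDerivWithinAt) (fun x hx => by simpa [hR] using hx)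
  have hright : ∫⁻ y, Measure.count (s ∩ f ⁻¹' {y}) ∂μ
      = ∫⁻ y, ∑' i, (f '' A i).indicator (fun _ => (1 : ℝ≥0∞)) y ∂μ := by
    refine lintegral_congr_ae ?_
    have : ∀ᵐ y ∂μ, y ∉ f '' Rᶜ := measure_eq_zero_iff_ae_notMem.1 hcrit
    filter_upwards [this] with y hy
    have h1 : s ∩ f ⁻¹' {y} = ⋃ i, A i ∩ f ⁻¹' {y} := by
      rw [← Set.iUnion_inter, hAU]
      ext x
      simp only [Set.mem_inter_iff, Set.mem_preimage, Set.mem_singleton_iff]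
      constructor
      · rintro ⟨hx, rfl⟩
        refine ⟨⟨hx, ?_⟩, rfl⟩
        by_contra hxR
        exact hy ⟨x, hxR, rfl⟩
      · rintro ⟨⟨hx, -⟩, h⟩
        exact ⟨hx, h⟩
    rw [h1, measure_iUnion]
    · exact tsum_congr fun i => count_inter_preimage_singleton (hAi i) y
    · exact fun i j hij => (hAd hij).mono Set.inter_subset_left Set.inter_subset_left
    · exact fun i => (hAm i).inter (hcont.measurable (measurableSet_singleton y))
  rw [hleft, hright, lintegral_tsum fun i => (measurable_const.indicator (himm i)).aemeasurable]
  exact tsum_congr fun i => by rw [lintegral_indicator_const (himm i), one_mul]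

/-- A continuous map on a compact space that is locally injective and open at each point of the
fibre over `y₀` has, over all points near `y₀`, a finite fibre of the same cardinality. -/
theorem eventually_encard_fibre_eq {X Y : Type*} [TopologicalSpace X] [CompactSpace X] [T2Space X]
    [TopologicalSpace Y] [T2Space Y] {f : X → Y} (hf : Continuous f) {y₀ : Y}
    (hinj : ∀ x, f x = y₀ → ∃ V ∈ 𝓝 x, Set.InjOn f V)
    (hopen : ∀ x, f x = y₀ → map f (𝓝 x) = 𝓝 y₀) :
    (f ⁻¹' {y₀}).Finite ∧ ∀ᶠ y in 𝓝 y₀, (f ⁻¹' {y}).encard = (f ⁻¹' {y₀}).encard := by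
  have hfin : (f ⁻¹' {y₀}).Finite := by
    have hcl : IsClosed (f ⁻¹' {y₀}) := isClosed_singleton.preimage hf
    refine hcl.isCompact.finite (isDiscrete_iff_forall_mem_exists_isOpen.2 ?_)
    intro x hx
    obtain ⟨V, hV, hVi⟩ := hinj x hx
    refine ⟨interior V, isOpen_interior, ?_⟩
    ext z
    constructor
    · rintro ⟨hz, hzf⟩
      exact hVi (interior_subset hz) (interior_subset (mem_interior_iff_mem_nhds.2 hV))
        (hzf.trans (Eq.symm hx))
    · rintro rfl
      exact ⟨mem_interior_iff_mem_nhds.2 hV, hx⟩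
  refine ⟨hfin, ?_⟩
  obtain ⟨D, hD, hDd⟩ := hfin.t2_separation
  choose! V hV hVi using hinj
  set W : X → Set X := fun x => interior (V x) ∩ D x with hW
  have hWo : ∀ x, IsOpen (W x) := fun x => isOpen_interior.inter (hD x).2
  have hxW : ∀ x, f x = y₀ → x ∈ W x := fun x hx =>
    ⟨mem_interior_iff_mem_nhds.2 (hV x hx), (hD x).1⟩
  have hWi : ∀ x, f x = y₀ → Set.InjOn f (W x) := fun x hx =>
    (hVi x hx).mono (Set.inter_subset_left.trans interior_subset)
  have hfar : ∀ᶠ y in 𝓝 y₀, ∀ z, f z = y → ∃ x ∈ f ⁻¹' {y₀}, z ∈ W x := by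
    have hK : IsCompact (⋃ x ∈ f ⁻¹' {y₀}, W x)ᶜ :=
      (isOpen_biUnion fun x _ => hWo x).isClosed_compl.isCompact
    have hKc : IsClosed (f '' (⋃ x ∈ f ⁻¹' {y₀}, W x)ᶜ) := (hK.image hf).isClosed
    have : y₀ ∉ f '' (⋃ x ∈ f ⁻¹' {y₀}, W x)ᶜ := by
      rintro ⟨z, hz, hzy⟩
      exact hz (Set.mem_biUnion (show z ∈ f ⁻¹' {y₀} from hzy) (hxW z hzy))
    filter_upwards [hKc.isOpen_compl.mem_nhds this] with y hy z hz
    by_contra hcon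
    push Not at hcon
    exact hy ⟨z, by simpa using hcon, hz⟩
  have hnear : ∀ᶠ y in 𝓝 y₀, ∀ x ∈ f ⁻¹' {y₀}, y ∈ f '' W x := by
    refine (Set.Finite.eventually_all hfin).2 fun x hx => ?_
    rw [← hopen x hx]
    exact image_mem_map ((hWo x).mem_nhds (hxW x hx))
  filter_upwards [hfar, hnear] with y h1 h2
  choose! g hg hgy using h2
  have himage : f ⁻¹' {y} = g '' (f ⁻¹' {y₀}) := by
    ext z
    constructor
    · intro hz
      obtain ⟨x, hx, hzx⟩ := h1 z hz
      exact ⟨x, hx, hWi x hx (hg x hx) hzx ((hgy x hx).trans (Eq.symm hz))⟩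
    · rintro ⟨x, hx, rfl⟩
      exact hgy x hx
  rw [himage, Set.InjOn.encard_image]
  intro x hx x' hx' hxx
  by_contra hne
  exact Set.disjoint_left.1 (hDd hx hx' hne) (hg x hx).2 (hxx ▸ (hg x' hx').2)

end AreaFormula

/-! ### Trigonometric polynomials on the torus -/

section Trig

open Topology Filter UnitAddTorus

/-- The trigonometric polynomial `∑_{l ∈ S} c_l e_l` on the torus. -/
def trigPoly (S : Finset (Fin 2 → ℤ)) (c : (Fin 2 → ℤ) → ℂ) (x : UnitAddTorus (Fin 2)) : ℂ :=
  ∑ l ∈ S, c l * mFourier l x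

/-- The Fourier coefficients of the partial derivative `∂_j` of a function with coefficients `c`. -/
def derivCoeff (j : Fin 2) (c : (Fin 2 → ℤ) → ℂ) (l : Fin 2 → ℤ) : ℂ :=
  2 * Real.pi * Complex.I * l j * c l

/-- The Jacobian determinant of a map from the plane to `ℂ` with partial derivatives `p` and `q`. -/
def jac (p q : ℂ) : ℝ := p.re * q.im - q.re * p.im

/-- The real linear map `w ↦ (Re w) p + (Im w) q` of the plane. -/
def gradMap (p q : ℂ) : ℂ →L[ℝ] ℂ :=
  Complex.reCLM.smulRight p + Complex.imCLM.smulRight q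

/-- The covering of the torus by the plane, the latter being identified with `ℂ`. -/
def torusPt (z : ℂ) : UnitAddTorus (Fin 2) :=
  fun j => ((Complex.measurableEquivPi z j : ℝ) : UnitAddCircle)

/-- A fundamental domain for `torusPt`. -/
def cell : Set ℂ :=
  Complex.measurableEquivPi ⁻¹' {x : Fin 2 → ℝ | ∀ i, x i ∈ Set.Ioc (0 : ℝ) (0 + 1)}

theorem measurableSet_cell : MeasurableSet cell :=
  Complex.measurableEquivPi.measurable (MeasurableSet.univ_pi' fun _ => measurableSet_Ioc)

theorem continuous_trigPoly (S : Finset (Fin 2 → ℤ)) (c : (Fin 2 → ℤ) → ℂ) :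
    Continuous (trigPoly S c) := by
  unfold trigPoly
  fun_prop

theorem mFourier_torusPt (l : Fin 2 → ℤ) (z : ℂ) : mFourier l (torusPt z) =
    Complex.exp (2 * Real.pi * Complex.I * (l 0 * z.re + l 1 * z.im)) := by
  simp only [mFourier, torusPt, ContinuousMap.coe_mk, Fin.prod_univ_two,
    Complex.measurableEquivPi_apply, Matrix.cons_val_zero, Matrix.cons_val_one, fourier_coe_apply]
  rw [← Complex.exp_add]
  congr 1
  push_cast
  ring

theorem hasStrictFDerivAt_trigPoly (S : Finset (Fin 2 → ℤ)) (c : (Fin 2 → ℤ) → ℂ) (z : ℂ) :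
    HasStrictFDerivAt (fun z => trigPoly S c (torusPt z))
      (gradMap (trigPoly S (derivCoeff 0 c) (torusPt z))
        (trigPoly S (derivCoeff 1 c) (torusPt z))) z := by
  have h1 : ∀ l : Fin 2 → ℤ, HasStrictFDerivAt (fun z : ℂ => c l * mFourier l (torusPt z))
      (gradMap (derivCoeff 0 c l * mFourier l (torusPt z))
        (derivCoeff 1 c l * mFourier l (torusPt z))) z := by
    intro l
    have hlin : HasStrictFDerivAt (fun z : ℂ => 2 * Real.pi * Complex.I * (l 0 * z.re + l 1 * z.im))
        (gradMap (2 * Real.pi * Complex.I * l 0) (2 * Real.pi * Complex.I * l 1)) z := by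
      have := (gradMap (2 * Real.pi * Complex.I * l 0)
        (2 * Real.pi * Complex.I * l 1)).hasStrictFDerivAt (x := z)
      refine this.congr_of_eventuallyEq (Eventually.of_forall fun w => ?_)
      simp [gradMap]
      ring
    have h2 := (hlin.cexp).const_mul (c l)
    simp_rw [mFourier_torusPt]
    refine h2.congr_fderiv ?_
    ext
    simp [gradMap, derivCoeff]
    ring
  have h3 := HasStrictFDerivAt.fun_sum (u := S) (fun l _ => h1 l)
  refine h3.congr_fderiv ?_
  ext
  simp [gradMap, trigPoly, Finset.sum_add_distrib, Finset.mul_sum]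

theorem det_gradMap (p q : ℂ) : (gradMap p q).det = jac p q := by
  rw [ContinuousLinearMap.det, ← LinearMap.det_toMatrix Complex.basisOneI, Matrix.det_fin_two]
  simp [LinearMap.toMatrix_apply, gradMap, jac]

theorem continuous_torusPt : Continuous torusPt := by
  refine continuous_pi fun j => ?_
  have h : Continuous Complex.measurableEquivPi :=
    Complex.basisOneI.equivFun.toContinuousLinearEquiv.continuous
  exact (AddCircle.continuous_mk' 1).comp ((continuous_apply j).comp h)

theorem isOpenMap_torusPt : IsOpenMap torusPt := by
  have h : IsOpenMap Complex.measurableEquivPi :=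
    Complex.basisOneI.equivFun.toContinuousLinearEquiv.toHomeomorph.isOpenMap
  have h2 : IsOpenMap (Pi.map fun (_ : Fin 2) (t : ℝ) => (t : UnitAddCircle)) :=
    IsOpenMap.piMap (fun _ => QuotientAddGroup.isOpenMap_coe) (by simp)
  exact h2.comp h

theorem bijOn_torusPt_cell : Set.BijOn torusPt cell Set.univ := by
  set e := UnitAddTorus.measurableEquivPiIoc (ι := Fin 2) (fun _ => (0 : ℝ)) with he
  have key : ∀ z (hz : z ∈ cell), torusPt z = e.symm ⟨Complex.measurableEquivPi z, hz⟩ :=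
    fun z hz => rfl
  refine ⟨fun _ _ => trivial, ?_, ?_⟩
  · intro z hz w hw h
    rw [key z hz, key w hw] at h
    have := e.symm.injective h
    exact Complex.measurableEquivPi.injective (congrArg Subtype.val this)
  · intro x _
    have hz : Complex.measurableEquivPi.symm (e x).1 ∈ cell := by
      simp only [cell, Set.mem_preimage, MeasurableEquiv.apply_symm_apply]
      exact (e x).2
    refine ⟨_, hz, ?_⟩
    rw [key _ hz]
    simp only [MeasurableEquiv.apply_symm_apply, Subtype.coe_eta, MeasurableEquiv.symm_apply_apply]

theorem exists_torusPt_eq (x : UnitAddTorus (Fin 2)) : ∃ z, torusPt z = x := by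
  obtain ⟨z, -, hz⟩ := bijOn_torusPt_cell.surjOn (Set.mem_univ x)
  exact ⟨z, hz⟩

theorem map_torusPt_nhds (z : ℂ) : map torusPt (𝓝 z) = 𝓝 (torusPt z) :=
  isOpenMap_torusPt.map_nhds_eq continuous_torusPt.continuousAt

theorem lintegral_torus_eq_cell (f : UnitAddTorus (Fin 2) → ℝ≥0∞) :
    ∫⁻ x, f x ∂torusMeasure = ∫⁻ z in cell, f (torusPt z) := by
  have h1 : ∫⁻ x, f x ∂torusMeasure
      = ∫⁻ x in {x : Fin 2 → ℝ | ∀ i, x i ∈ Set.Ioc (0 : ℝ) (0 + 1)}, f (fun i => x i) :=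
    UnitAddTorus.lintegral_preimage f (fun _ => 0)
  rw [h1, ← Complex.volume_preserving_equiv_pi.setLIntegral_comp_preimage_emb
    Complex.measurableEquivPi.measurableEmbedding]
  rfl

instance : IsProbabilityMeasure torusMeasure := by
  unfold torusMeasure
  infer_instance

/-- The area formula on the torus, for a trigonometric polynomial. -/
theorem lintegral_torus_indicator_jac (S : Finset (Fin 2 → ℤ)) (c : (Fin 2 → ℤ) → ℂ) {B : Set ℂ}
    (hB : MeasurableSet B) :
    ∫⁻ x, (trigPoly S c ⁻¹' B).indicator (fun x => ENNReal.ofReal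
        |jac (trigPoly S (derivCoeff 0 c) x) (trigPoly S (derivCoeff 1 c) x)|) x ∂torusMeasure
      = ∫⁻ y in B, ((trigPoly S c ⁻¹' {y}).encard : ℝ≥0∞) := by
  set F : ℂ → ℂ := fun z => trigPoly S c (torusPt z) with hF
  have hFc : Continuous F := (continuous_trigPoly S c).comp continuous_torusPt
  have hm : MeasurableSet (cell ∩ F ⁻¹' B) := measurableSet_cell.inter (hFc.measurable hB)
  have h1 := lintegral_abs_det_eq_lintegral_count (μ := (volume : Measure ℂ))
    (hasStrictFDerivAt_trigPoly S c) hm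
  simp only [det_gradMap] at h1
  rw [lintegral_torus_eq_cell]
  have h2 : ∀ z, (trigPoly S c ⁻¹' B).indicator (fun x => ENNReal.ofReal
        |jac (trigPoly S (derivCoeff 0 c) x) (trigPoly S (derivCoeff 1 c) x)|) (torusPt z)
      = (F ⁻¹' B).indicator (fun z => ENNReal.ofReal |jac (trigPoly S (derivCoeff 0 c) (torusPt z))
          (trigPoly S (derivCoeff 1 c) (torusPt z))|) z := fun z => rfl
  simp only [h2]
  rw [setLIntegral_indicator (hFc.measurable hB), Set.inter_comm, h1,
    ← lintegral_indicator hB]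
  refine lintegral_congr fun y => ?_
  by_cases hy : y ∈ B
  · rw [Set.indicator_of_mem hy]
    have h3 : cell ∩ F ⁻¹' B ∩ F ⁻¹' {y} = cell ∩ torusPt ⁻¹' (trigPoly S c ⁻¹' {y}) := by
      ext z
      simp only [Set.mem_inter_iff, Set.mem_preimage, Set.mem_singleton_iff, hF]
      constructor
      · rintro ⟨⟨h, -⟩, h'⟩
        exact ⟨h, h'⟩
      · rintro ⟨h, h'⟩
        exact ⟨⟨h, h' ▸ hy⟩, h'⟩
    have h4 : torusPt '' (cell ∩ torusPt ⁻¹' (trigPoly S c ⁻¹' {y})) = trigPoly S c ⁻¹' {y} := by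
      rw [Set.image_inter_preimage, bijOn_torusPt_cell.image_eq, Set.univ_inter]
    rw [h3, Measure.count_apply,
      ← Set.InjOn.encard_image (bijOn_torusPt_cell.injOn.mono Set.inter_subset_left), h4]
    exact measurableSet_cell.inter (continuous_torusPt.measurable
      ((continuous_trigPoly S c).measurable (measurableSet_singleton y)))
  · rw [Set.indicator_of_notMem hy]
    have : cell ∩ F ⁻¹' B ∩ F ⁻¹' {y} = ∅ := by
      ext z
      simp only [Set.mem_inter_iff, Set.mem_preimage, Set.mem_singleton_iff,
        Set.mem_empty_iff_false, iff_false, not_and, and_imp]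
      rintro - h rfl
      exact hy h
    rw [this, measure_empty]

/-- Over a regular value, a trigonometric polynomial has a finite fibre, and the number of its
elements is locally constant. -/
theorem eventually_encard_trigPoly_fibre_eq (S : Finset (Fin 2 → ℤ)) (c : (Fin 2 → ℤ) → ℂ) {y₀ : ℂ}
    (hreg : ∀ x, trigPoly S c x = y₀ →
      jac (trigPoly S (derivCoeff 0 c) x) (trigPoly S (derivCoeff 1 c) x) ≠ 0) :
    (trigPoly S c ⁻¹' {y₀}).Finite ∧
      ∀ᶠ y in 𝓝 y₀, (trigPoly S c ⁻¹' {y}).encard = (trigPoly S c ⁻¹' {y₀}).encard := by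
  refine eventually_encard_fibre_eq (continuous_trigPoly S c) ?_ ?_
  · intro x hx
    obtain ⟨z, rfl⟩ := exists_torusPt_eq x
    obtain ⟨V, hV, hVi⟩ := exists_mem_nhds_injOn (hasStrictFDerivAt_trigPoly S c z)
      (by rw [det_gradMap]; exact hreg _ hx)
    refine ⟨torusPt '' V, ?_, ?_⟩
    · rw [← map_torusPt_nhds]
      exact image_mem_map hV
    · rintro _ ⟨a, ha, rfl⟩ _ ⟨b, hb, rfl⟩ hab
      rw [hVi ha hb hab]
  · intro x hx
    obtain ⟨z, rfl⟩ := exists_torusPt_eq x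
    rw [← map_torusPt_nhds, Filter.map_map, ← hx]
    exact map_nhds_eq_of_det_ne_zero (hasStrictFDerivAt_trigPoly S c z)
      (by rw [det_gradMap]; exact hreg _ hx)

end Trig

/-! ### A uniform bound for almost every fibre -/

section FibreBound

open UnitAddTorus

theorem encard_zeros_le {K : ℕ} (g : Fin (K + 1) → ℂ) (hg : ∃ k, g k ≠ 0) :
    {w : ℂ | ∑ k, g k * w ^ (k : ℕ) = 0}.encard ≤ K := by
  classical
  set p : Polynomial ℂ := ∑ k : Fin (K + 1), Polynomial.C (g k) * Polynomial.X ^ (k : ℕ) with hp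
  have hcoeff : ∀ k : Fin (K + 1), p.coeff k = g k := by
    intro k
    rw [hp, Polynomial.finsetSum_coeff, Finset.sum_eq_single k]
    · simp
    · intro b _ hb
      have : (k : ℕ) ≠ b := fun h => hb (Fin.ext h.symm)
      simp [Polynomial.coeff_X_pow, this]
    · simp
  have hp0 : p ≠ 0 := by
    obtain ⟨k, hk⟩ := hg
    intro h
    apply hk
    rw [← hcoeff k, h, Polynomial.coeff_zero]
  have hdeg : p.natDegree ≤ K := by
    have := Polynomial.degree_sum_fin_lt g
    exact Nat.lt_succ_iff.1 ((Polynomial.natDegree_lt_iff_degree_lt hp0).2 this)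
  have hset : {w : ℂ | ∑ k, g k * w ^ (k : ℕ) = 0} = (p.roots.toFinset : Set ℂ) := by
    ext w
    have h : p.eval w = ∑ k, g k * w ^ (k : ℕ) := by simp [hp, Polynomial.eval_finsetSum]
    simp [hp0, Polynomial.IsRoot, h]
  rw [hset, Set.encard_coe_eq_coe_finsetCard]
  exact_mod_cast (Multiset.toFinset_card_le _).trans ((Polynomial.card_roots' p).trans hdeg)

theorem ae_sum_pow_ne_zero {K : ℕ} (g : Fin (K + 1) → ℂ) (hg : ∃ k, g k ≠ 0) :
    ∀ᵐ u : ℝ, ∑ k, g k * (u : ℂ) ^ (k : ℕ) ≠ 0 := by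
  have h1 : {w : ℂ | ∑ k, g k * w ^ (k : ℕ) = 0}.Finite :=
    Set.finite_of_encard_le_coe (encard_zeros_le g hg)
  have h2 : {u : ℝ | ∑ k, g k * (u : ℂ) ^ (k : ℕ) = 0}.Finite :=
    h1.preimage (f := fun u : ℝ => (u : ℂ)) Complex.ofReal_injective.injOn
  exact measure_eq_zero_iff_ae_notMem.1 (h2.measure_zero volume)

/-- A nonzero polynomial in the real and imaginary parts vanishes only on a null set. -/
theorem ae_sum_re_im_pow_ne_zero {K : ℕ} (g : Fin (K + 1) → Fin (K + 1) → ℂ)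
    (hg : ∃ i j, g i j ≠ 0) :
    ∀ᵐ y : ℂ, ∑ i, ∑ j, g i j * (y.re : ℂ) ^ (i : ℕ) * (y.im : ℂ) ^ (j : ℕ) ≠ 0 := by
  have hprod : ∀ᵐ p : ℝ × ℝ, ∑ i, ∑ j, g i j * (p.1 : ℂ) ^ (i : ℕ) * (p.2 : ℂ) ^ (j : ℕ) ≠ 0 := by
    have hm : MeasurableSet
        {p : ℝ × ℝ | ∑ i, ∑ j, g i j * (p.1 : ℂ) ^ (i : ℕ) * (p.2 : ℂ) ^ (j : ℕ) = 0} := by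
      have : Continuous fun p : ℝ × ℝ =>
          ∑ i, ∑ j, g i j * (p.1 : ℂ) ^ (i : ℕ) * (p.2 : ℂ) ^ (j : ℕ) := by fun_prop
      exact this.measurable (measurableSet_singleton 0)
    obtain ⟨i, j, hij⟩ := hg
    have h0 : (volume : Measure (ℝ × ℝ))
        {p : ℝ × ℝ | ∑ i, ∑ j, g i j * (p.1 : ℂ) ^ (i : ℕ) * (p.2 : ℂ) ^ (j : ℕ) = 0} = 0 := by
      rw [Measure.volume_eq_prod, Measure.measure_prod_null hm]
      filter_upwards [ae_sum_pow_ne_zero (fun i => g i j) ⟨i, hij⟩] with u hu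
      have := ae_sum_pow_ne_zero (fun j => ∑ i, g i j * (u : ℂ) ^ (i : ℕ)) ⟨j, hu⟩
      refine measure_eq_zero_iff_ae_notMem.2 ?_
      filter_upwards [this] with v hv
      simp only [Set.mem_preimage, Set.mem_ofPred_eq]
      rw [Finset.sum_comm]
      simpa only [Finset.sum_mul] using hv
    exact measure_eq_zero_iff_ae_notMem.1 h0
  exact Complex.volume_preserving_equiv_real_prod.quasiMeasurePreserving.ae hprod

/-- The frequencies in `[-M, M]²`. -/
def box (M : ℕ) : Finset (Fin 2 → ℤ) := Fintype.piFinset fun _ => Finset.Icc (-(M : ℤ)) M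

theorem mem_box {M : ℕ} {l : Fin 2 → ℤ} : l ∈ box M ↔ ∀ i, |l i| ≤ M := by
  simp [box, Fintype.mem_piFinset, abs_le]

theorem card_box (M : ℕ) : (box M).card = (2 * M + 1) ^ 2 := by
  simp [box, Fintype.card_piFinset]
  omega

theorem freq_subset_box (n : ℕ) : freq n ⊆ box n := Finset.filter_subset _ _

/-- The space of trigonometric polynomials with frequencies in `[-M, M]²`. -/
def trigSpace (M : ℕ) : Submodule ℂ C(UnitAddTorus (Fin 2), ℂ) :=
  Submodule.span ℂ (mFourier (d := Fin 2) '' (box M))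

theorem mFourier_mem_trigSpace {M : ℕ} {l : Fin 2 → ℤ} (hl : l ∈ box M) :
    mFourier l ∈ trigSpace M :=
  Submodule.subset_span ⟨l, hl, rfl⟩

theorem trigSpace_mono {M M' : ℕ} (h : M ≤ M') : trigSpace M ≤ trigSpace M' := by
  refine Submodule.span_mono ?_
  refine Set.image_mono fun l hl => ?_
  rw [Finset.mem_coe, mem_box] at hl ⊢
  exact fun i => (hl i).trans (by exact_mod_cast h)

theorem mul_mem_trigSpace {M M' : ℕ} {f g : C(UnitAddTorus (Fin 2), ℂ)} (hf : f ∈ trigSpace M)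
    (hg : g ∈ trigSpace M') : f * g ∈ trigSpace (M + M') := by
  have h : trigSpace M * trigSpace M' ≤ trigSpace (M + M') := by
    rw [trigSpace, trigSpace, Submodule.span_mul_span]
    refine Submodule.span_le.2 ?_
    rintro _ ⟨_, ⟨l, hl, rfl⟩, _, ⟨m, hm, rfl⟩, rfl⟩
    have : mFourier l * mFourier m = mFourier (l + m) := by
      ext x
      rw [ContinuousMap.mul_apply, mFourier_add]
    simp only [this]
    refine mFourier_mem_trigSpace ?_
    rw [Finset.mem_coe, mem_box] at hl hm
    rw [mem_box]
    intro i
    push_cast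
    exact (abs_add_le _ _).trans (add_le_add (hl i) (hm i))
  exact h (Submodule.mul_mem_mul hf hg)

theorem pow_mem_trigSpace {M : ℕ} {f : C(UnitAddTorus (Fin 2), ℂ)} (hf : f ∈ trigSpace M) (k : ℕ) :
    f ^ k ∈ trigSpace (k * M) := by
  induction k with
  | zero =>
    rw [pow_zero, ← mFourier_zero (d := Fin 2)]
    exact mFourier_mem_trigSpace (by simp [mem_box])
  | succ k ih =>
    rw [pow_succ, Nat.succ_mul]
    exact mul_mem_trigSpace ih hf

/-- Too many functions in `trigSpace M` satisfy a nontrivial linear relation. -/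
theorem exists_relation_of_mem_trigSpace {M : ℕ} {ι : Type*} [Fintype ι]
    (f : ι → C(UnitAddTorus (Fin 2), ℂ)) (hf : ∀ i, f i ∈ trigSpace M)
    (hcard : (2 * M + 1) ^ 2 < Fintype.card ι) :
    ∃ g : ι → ℂ, ∑ i, g i • f i = 0 ∧ ∃ i, g i ≠ 0 := by
  classical
  refine Fintype.not_linearIndependent_iff.1 fun hli => ?_
  have hT : trigSpace M = Submodule.span ℂ ((box M).image (mFourier (d := Fin 2)) : Finset _) := by
    rw [Finset.coe_image, trigSpace]
  have hfin : Module.Finite ℂ (trigSpace M) :=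
    FiniteDimensional.span_of_finite ℂ ((box M).finite_toSet.image _)
  have hli' : LinearIndependent ℂ fun i => (⟨f i, hf i⟩ : trigSpace M) :=
    LinearIndependent.of_comp (trigSpace M).subtype hli
  have h1 := hli'.fintype_card_le_finrank
  have h2 := finrank_span_finset_le_card (R := ℂ) ((box M).image (mFourier (d := Fin 2)))
  rw [Set.finrank, ← hT] at h2
  have h3 := Finset.card_image_le (s := box M) (f := mFourier (d := Fin 2))
  rw [card_box] at h3
  omega

theorem exists_trigPoly_re_im {S : Finset (Fin 2 → ℤ)} {d : ℕ} (hS : S ⊆ box d)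
    (c : (Fin 2 → ℤ) → ℂ) : ∃ T T' : C(UnitAddTorus (Fin 2), ℂ), T ∈ trigSpace d ∧
      T' ∈ trigSpace d ∧ (∀ x, T x = (trigPoly S c x).re) ∧ ∀ x, T' x = (trigPoly S c x).im := by
  set G : C(UnitAddTorus (Fin 2), ℂ) := ∑ l ∈ S, c l • mFourier l with hG
  set G' : C(UnitAddTorus (Fin 2), ℂ) := ∑ l ∈ S, conj (c l) • mFourier (-l) with hG'
  have hGx : ∀ x, G x = trigPoly S c x := by
    intro x
    simp [hG, trigPoly]
  have hGx' : ∀ x, G' x = conj (trigPoly S c x) := by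
    intro x
    simp [hG', trigPoly, mFourier_neg]
  have hGm : G ∈ trigSpace d := Submodule.sum_mem _ fun l hl =>
    Submodule.smul_mem _ _ (mFourier_mem_trigSpace (hS hl))
  have hGm' : G' ∈ trigSpace d := Submodule.sum_mem _ fun l hl =>
    Submodule.smul_mem _ _ (mFourier_mem_trigSpace (by
      have := mem_box.1 (hS hl)
      exact mem_box.2 (by simpa using this)))
  refine ⟨(1 / 2 : ℂ) • (G + G'), (1 / (2 * Complex.I) : ℂ) • (G - G'),
    Submodule.smul_mem _ _ (Submodule.add_mem _ hGm hGm'),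
    Submodule.smul_mem _ _ (Submodule.sub_mem _ hGm hGm'), fun x => ?_, fun x => ?_⟩
  · simp only [ContinuousMap.smul_apply, ContinuousMap.add_apply, hGx, hGx', smul_eq_mul,
      Complex.re_eq_add_conj]
    ring
  · simp only [ContinuousMap.smul_apply, ContinuousMap.sub_apply, hGx, hGx', smul_eq_mul,
      Complex.im_eq_sub_conj]
    ring

/-- On almost every fibre of a trigonometric polynomial of degree at most `d`, a given exponential
of degree one takes at most `(4d + 3)²` values. With `K = (4d + 3)²`, there are more monomials
`Tⁱ T'ʲ eᵏ` with `i, j, k ≤ K` in the real part `T`, the imaginary part `T'` and the exponential `e`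
than exponentials of the degrees involved, so these monomials satisfy a linear relation; over a
point of a fibre it is a polynomial equation for the value of `e`. -/
theorem ae_encard_image_fibre_le {S : Finset (Fin 2 → ℤ)} {d : ℕ} (hS : S ⊆ box d)
    (c : (Fin 2 → ℤ) → ℂ) {l : Fin 2 → ℤ} (hl : l ∈ box 1) :
    ∀ᵐ y : ℂ, (mFourier l '' (trigPoly S c ⁻¹' {y})).encard ≤ ((4 * d + 3) ^ 2 : ℕ) := by
  set K := (4 * d + 3) ^ 2 with hK
  obtain ⟨T, T', hT, hT', hTx, hTx'⟩ := exists_trigPoly_re_im hS c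
  have hmem : ∀ i : Fin (K + 1) × Fin (K + 1) × Fin (K + 1),
      T ^ (i.1 : ℕ) * T' ^ (i.2.1 : ℕ) * mFourier l ^ (i.2.2 : ℕ)
        ∈ trigSpace (K * d + K * d + K * 1) := by
    intro i
    have hle : ∀ a : Fin (K + 1), (a : ℕ) ≤ K := fun a => Nat.lt_succ_iff.1 a.2
    exact mul_mem_trigSpace (mul_mem_trigSpace
      (trigSpace_mono (Nat.mul_le_mul_right _ (hle _)) (pow_mem_trigSpace hT _))
      (trigSpace_mono (Nat.mul_le_mul_right _ (hle _)) (pow_mem_trigSpace hT' _)))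
      (trigSpace_mono (Nat.mul_le_mul_right _ (hle _))
        (pow_mem_trigSpace (mFourier_mem_trigSpace hl) _))
  obtain ⟨g, hg, ⟨i₀, j₀, k₀⟩, hg0⟩ := exists_relation_of_mem_trigSpace _ hmem (by
    simp only [Fintype.card_prod, Fintype.card_fin]
    have h1 : 1 ≤ K := Nat.one_le_pow _ _ (by omega)
    have h2 : 2 * (K * d + K * d + K * 1) + 1 ≤ K * (4 * d + 3) := by nlinarith
    calc (2 * (K * d + K * d + K * 1) + 1) ^ 2 ≤ (K * (4 * d + 3)) ^ 2 := Nat.pow_le_pow_left h2 2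
      _ = K * K * K := by rw [mul_pow, ← hK]; ring
      _ < (K + 1) * ((K + 1) * (K + 1)) := by nlinarith)
  filter_upwards [ae_sum_re_im_pow_ne_zero (fun i j => g (i, j, k₀)) ⟨i₀, j₀, hg0⟩] with y hy
  refine (Set.encard_le_encard ?_).trans (encard_zeros_le (fun k => ∑ i, ∑ j,
    g (i, j, k) * (y.re : ℂ) ^ (i : ℕ) * (y.im : ℂ) ^ (j : ℕ)) ⟨k₀, hy⟩)
  rintro _ ⟨x, hx, rfl⟩
  have hx' : trigPoly S c x = y := hx
  have h1 := congrArg (fun f : C(UnitAddTorus (Fin 2), ℂ) => f x) hg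
  simp only [ContinuousMap.coe_sum, Finset.sum_apply, ContinuousMap.smul_apply,
    ContinuousMap.mul_apply, ContinuousMap.pow_apply, hTx, hTx', hx', smul_eq_mul,
    ContinuousMap.zero_apply] at h1
  simp only [Fintype.sum_prod_type] at h1
  rw [Set.mem_ofPred_eq, ← h1]
  simp only [Finset.sum_mul]
  rw [Finset.sum_comm]
  refine Finset.sum_congr rfl fun i _ => ?_
  rw [Finset.sum_comm]
  refine Finset.sum_congr rfl fun j _ => Finset.sum_congr rfl fun k _ => ?_
  ring

/-- Almost every fibre of a trigonometric polynomial of degree at most `d` has at most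
`(4d + 3)⁴` points, whatever its coefficients. -/
theorem ae_encard_fibre_le {S : Finset (Fin 2 → ℤ)} {d : ℕ} (hS : S ⊆ box d)
    (c : (Fin 2 → ℤ) → ℂ) :
    ∀ᵐ y : ℂ, (trigPoly S c ⁻¹' {y}).encard ≤ ((4 * d + 3) ^ 4 : ℕ) := by
  have hbox : ∀ j : Fin 2, (Pi.single j 1 : Fin 2 → ℤ) ∈ box 1 := by
    intro j
    rw [mem_box]
    intro i
    by_cases h : i = j
    · subst h; simp
    · simp [h]
  filter_upwards [ae_encard_image_fibre_le hS c (hbox 0), ae_encard_image_fibre_le hS c (hbox 1)]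
    with y h0 h1
  have hinj : Set.InjOn (fun x : UnitAddTorus (Fin 2) =>
      ((mFourier (Pi.single 0 1) x : ℂ), (mFourier (Pi.single 1 1) x : ℂ)))
      (trigPoly S c ⁻¹' {y}) := by
    intro x _ x' _ h
    rw [Prod.mk.injEq] at h
    have key : ∀ j, mFourier (Pi.single j 1) x = mFourier (Pi.single j 1) x' → x j = x' j := by
      intro j hj
      rw [mFourier_single, mFourier_single, fourier_one, fourier_one] at hj
      exact AddCircle.injective_toCircle one_ne_zero (Subtype.ext hj)
    funext j
    fin_cases j
    · exact key 0 h.1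
    · exact key 1 h.2
  rw [← hinj.encard_image]
  calc _ ≤ ((mFourier (Pi.single 0 1) '' (trigPoly S c ⁻¹' {y})) ×ˢ
        (mFourier (Pi.single 1 1) '' (trigPoly S c ⁻¹' {y}))).encard := by
        refine Set.encard_le_encard ?_
        rintro _ ⟨x, hx, rfl⟩
        exact ⟨⟨x, hx, rfl⟩, ⟨x, hx, rfl⟩⟩
    _ ≤ (((4 * d + 3) ^ 2 : ℕ) : ℕ∞) * ((4 * d + 3) ^ 2 : ℕ) := by
        rw [Set.encard_prod]
        exact mul_le_mul' h0 h1
    _ = ((4 * d + 3) ^ 4 : ℕ) := by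
        rw [← Nat.cast_mul, ← pow_add]

end FibreBound

/-! ### Smoothed counts of zeros -/

section SmoothedCount

open UnitAddTorus Topology Filter

/-- The closed square of side `2ε` around the origin. -/
def square (ε : ℝ) : Set ℂ := {y | |y.re| ≤ ε ∧ |y.im| ≤ ε}

theorem measurableSet_square (ε : ℝ) : MeasurableSet (square ε) := by
  refine IsClosed.measurableSet (IsClosed.inter ?_ ?_)
  · exact isClosed_le Complex.continuous_re.abs continuous_const
  · exact isClosed_le Complex.continuous_im.abs continuous_const

theorem volume_square {ε : ℝ} (hε : 0 ≤ ε) : volume (square ε) = ENNReal.ofReal (4 * ε ^ 2) := by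
  have h1 : square ε = Complex.measurableEquivRealProd ⁻¹'
      (Set.Icc (-ε) ε ×ˢ Set.Icc (-ε) ε) := by
    ext y
    simp [square, abs_le]
    tauto
  rw [h1, Complex.volume_preserving_equiv_real_prod.measure_preimage
    (measurableSet_Icc.prod measurableSet_Icc).nullMeasurableSet, Measure.volume_eq_prod,
    Measure.prod_prod, Real.volume_Icc, ← ENNReal.ofReal_mul (by linarith)]
  congr 1
  ring

theorem exists_square_subset {U : Set ℂ} (hU : U ∈ 𝓝 (0 : ℂ)) :
    ∃ ε₀ > 0, ∀ ε < ε₀, square ε ⊆ U := by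
  obtain ⟨r, hr, hrU⟩ := Metric.mem_nhds_iff.1 hU
  refine ⟨r / 2, by positivity, fun ε hε y hy => hrU ?_⟩
  rw [mem_ball_zero_iff]
  calc ‖y‖ ≤ |y.re| + |y.im| := Complex.norm_le_abs_re_add_abs_im y
    _ < r := by linarith [hy.1, hy.2]

/-- The integral that counts the zeros of a trigonometric polynomial as `ε → 0`: the average over
the square of side `2ε` of the number of points in the fibre, expressed through the area formula. -/
def approxCount (S : Finset (Fin 2 → ℤ)) (c : (Fin 2 → ℤ) → ℂ) (ε : ℝ) : ℝ :=
  ∫ x, (4 * ε ^ 2)⁻¹ * (trigPoly S c ⁻¹' square ε).indicator (fun x =>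
    |jac (trigPoly S (derivCoeff 0 c) x) (trigPoly S (derivCoeff 1 c) x)|) x ∂torusMeasure

theorem continuous_jac_trigPoly (S : Finset (Fin 2 → ℤ)) (c : (Fin 2 → ℤ) → ℂ) :
    Continuous fun x => jac (trigPoly S (derivCoeff 0 c) x) (trigPoly S (derivCoeff 1 c) x) := by
  have h0 := continuous_trigPoly S (derivCoeff 0 c)
  have h1 := continuous_trigPoly S (derivCoeff 1 c)
  unfold jac
  fun_prop

theorem approxCount_eq (S : Finset (Fin 2 → ℤ)) (c : (Fin 2 → ℤ) → ℂ) (ε : ℝ) :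
    approxCount S c ε = (4 * ε ^ 2)⁻¹ *
      (∫⁻ y in square ε, ((trigPoly S c ⁻¹' {y}).encard : ℝ≥0∞)).toReal := by
  rw [approxCount, integral_const_mul, ← lintegral_torus_indicator_jac S c (measurableSet_square ε),
    integral_eq_lintegral_of_nonneg_ae]
  · congr 2
    refine lintegral_congr fun x => ?_
    by_cases hx : x ∈ trigPoly S c ⁻¹' square ε
    · simp [Set.indicator_of_mem hx]
    · simp [Set.indicator_of_notMem hx]
  · exact Eventually.of_forall fun x => Set.indicator_nonneg (fun _ _ => abs_nonneg _) x
  · exact ((continuous_jac_trigPoly S c).abs.measurable.indicator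
      ((continuous_trigPoly S c).measurable (measurableSet_square ε))).aestronglyMeasurable

theorem approxCount_nonneg (S : Finset (Fin 2 → ℤ)) (c : (Fin 2 → ℤ) → ℂ) (ε : ℝ) :
    0 ≤ approxCount S c ε := by
  rw [approxCount_eq]
  positivity

/-- The smoothed count is an average of numbers of points in fibres, almost all of which are uniformly
bounded. -/
theorem approxCount_le {S : Finset (Fin 2 → ℤ)} {d : ℕ} (hS : S ⊆ box d) (c : (Fin 2 → ℤ) → ℂ)
    {ε : ℝ} (hε : 0 < ε) : approxCount S c ε ≤ ((4 * d + 3) ^ 4 : ℕ) := by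
  have h1 : ∫⁻ y in square ε, ((trigPoly S c ⁻¹' {y}).encard : ℝ≥0∞)
      ≤ ((4 * d + 3) ^ 4 : ℕ) * ENNReal.ofReal (4 * ε ^ 2) := by
    calc _ ≤ ∫⁻ _ in square ε, (((4 * d + 3) ^ 4 : ℕ) : ℝ≥0∞) := by
          refine lintegral_mono_ae (ae_restrict_of_ae ?_)
          filter_upwards [ae_encard_fibre_le hS c] with y hy
          exact_mod_cast hy
      _ = _ := by rw [setLIntegral_const, volume_square hε.le]
  have h2 := ENNReal.toReal_mono (by finiteness) h1
  rw [ENNReal.toReal_mul, ENNReal.toReal_natCast, ENNReal.toReal_ofReal (by positivity)] at h2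
  rw [approxCount_eq]
  have h3 : 0 < 4 * ε ^ 2 := by positivity
  rw [inv_mul_le_iff₀ h3, mul_comm]
  exact h2

/-- If all zeros are nondegenerate, the smoothed count is exact for all small `ε`. -/
theorem exists_approxCount_eq_ncard (S : Finset (Fin 2 → ℤ)) (c : (Fin 2 → ℤ) → ℂ)
    (hreg : ∀ x, trigPoly S c x = 0 →
      jac (trigPoly S (derivCoeff 0 c) x) (trigPoly S (derivCoeff 1 c) x) ≠ 0) :
    ∃ ε₀ > 0, ∀ ε, 0 < ε → ε < ε₀ → approxCount S c ε = (trigPoly S c ⁻¹' {0}).ncard := by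
  obtain ⟨hfin, hev⟩ := eventually_encard_trigPoly_fibre_eq S c hreg
  obtain ⟨ε₀, hε₀, hsub⟩ := exists_square_subset hev
  refine ⟨ε₀, hε₀, fun ε hε hlt => ?_⟩
  have h1 : ∫⁻ y in square ε, ((trigPoly S c ⁻¹' {y}).encard : ℝ≥0∞)
      = ((trigPoly S c ⁻¹' {0}).ncard : ℝ≥0∞) * ENNReal.ofReal (4 * ε ^ 2) := by
    rw [← volume_square hε.le, ← setLIntegral_const]
    refine setLIntegral_congr_fun (measurableSet_square ε) fun y hy => ?_
    have : (trigPoly S c ⁻¹' {y}).encard = (trigPoly S c ⁻¹' {0}).encard := hsub ε hlt hy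
    simp only [this, ← hfin.cast_ncard_eq]
    simp
  rw [approxCount_eq, h1, ENNReal.toReal_mul, ENNReal.toReal_natCast,
    ENNReal.toReal_ofReal (by positivity)]
  have h3 : 0 < 4 * ε ^ 2 := by positivity
  field_simp

theorem ncard_zeros_le {S : Finset (Fin 2 → ℤ)} {d : ℕ} (hS : S ⊆ box d) (c : (Fin 2 → ℤ) → ℂ)
    (hreg : ∀ x, trigPoly S c x = 0 →
      jac (trigPoly S (derivCoeff 0 c) x) (trigPoly S (derivCoeff 1 c) x) ≠ 0) :
    ((trigPoly S c ⁻¹' {0}).ncard : ℝ) ≤ ((4 * d + 3) ^ 4 : ℕ) := by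
  obtain ⟨ε₀, hε₀, h⟩ := exists_approxCount_eq_ncard S c hreg
  rw [← h (ε₀ / 2) (by positivity) (by linarith)]
  exact approxCount_le hS c (by positivity)

end SmoothedCount

/-! ### Almost surely all zeros are nondegenerate -/

section Nondegenerate

open UnitAddTorus Topology Filter

theorem jac_mul (k p q : ℂ) : jac (k * p) (k * q) = ‖k‖ ^ 2 * jac p q := by
  rw [← Complex.normSq_eq_norm_sq, Complex.normSq_apply]
  simp only [jac, Complex.mul_re, Complex.mul_im]
  ring

/-- For almost every value of a single Fourier coefficient, all zeros are nondegenerate, whatever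
the other coefficients. At a zero, the coefficient `a` equals the value there of the trigonometric
polynomial `g` made of the other terms divided by `-e_{l₀}`; the zero is degenerate exactly when it
is a critical point of `g`, so that `a` is a critical value of `g`, and Sard's theorem applies. -/
theorem ae_update_nondegenerate (S : Finset (Fin 2 → ℤ)) {l₀ : Fin 2 → ℤ} (hl₀ : l₀ ∈ S)
    (c : (Fin 2 → ℤ) → ℂ) :
    ∀ᵐ a : ℂ, ∀ x, trigPoly S (Function.update c l₀ a) x = 0 →
      jac (trigPoly S (derivCoeff 0 (Function.update c l₀ a)) x)
        (trigPoly S (derivCoeff 1 (Function.update c l₀ a)) x) ≠ 0 := by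
  set S' := (S.erase l₀).map (Equiv.subRight l₀).toEmbedding with hS'
  set c' : (Fin 2 → ℤ) → ℂ := fun m => -c (m + l₀) with hc'
  have hg : ∀ x, mFourier l₀ x * trigPoly S' c' x
      = -∑ l ∈ S.erase l₀, c l * mFourier l x := by
    intro x
    rw [trigPoly, hS', Finset.sum_map, Finset.mul_sum, ← Finset.sum_neg_distrib]
    refine Finset.sum_congr rfl fun l _ => ?_
    have h1 : mFourier l x = mFourier (l - l₀) x * mFourier l₀ x := by
      rw [← mFourier_add, sub_add_cancel]
    simp only [hc', Equiv.coe_toEmbedding, Equiv.subRight_apply, sub_add_cancel]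
    rw [h1]
    ring
  have hgj : ∀ j x, mFourier l₀ x * trigPoly S' (derivCoeff j c') x
      = -∑ l ∈ S.erase l₀, 2 * Real.pi * Complex.I * ((l j : ℂ) - l₀ j) * c l * mFourier l x := by
    intro j x
    rw [trigPoly, hS', Finset.sum_map, Finset.mul_sum, ← Finset.sum_neg_distrib]
    refine Finset.sum_congr rfl fun l _ => ?_
    have h1 : mFourier l x = mFourier (l - l₀) x * mFourier l₀ x := by
      rw [← mFourier_add, sub_add_cancel]
    simp only [hc', derivCoeff, Equiv.coe_toEmbedding, Equiv.subRight_apply, sub_add_cancel,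
      Pi.sub_apply, Int.cast_sub]
    rw [h1]
    ring
  set G : ℂ → ℂ := fun z => trigPoly S' c' (torusPt z) with hG
  set crit : Set ℂ := {z | jac (trigPoly S' (derivCoeff 0 c') (torusPt z))
    (trigPoly S' (derivCoeff 1 c') (torusPt z)) = 0} with hcrit
  have hnull : volume (G '' crit) = 0 :=
    addHaar_image_eq_zero_of_det_fderivWithin_eq_zero volume
      (fun z _ => (hasStrictFDerivAt_trigPoly S' c' z).hasFDerivAt.hasFDerivWithinAt)
      (fun z hz => by rw [det_gradMap]; exact hz)
  filter_upwards [measure_eq_zero_iff_ae_notMem.1 hnull] with a ha x hx hjac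
  obtain ⟨z, rfl⟩ := exists_torusPt_eq x
  set x := torusPt z
  have hne : mFourier l₀ x ≠ 0 := by
    intro h
    have := mFourier_add (n := l₀) (m := -l₀) (x := x)
    rw [h, mul_zero, neg_add_cancel, mFourier_zero] at this
    exact one_ne_zero this
  have hupd : ∀ l ∈ S.erase l₀, Function.update c l₀ a l = c l := fun l hl =>
    Function.update_of_ne (Finset.ne_of_mem_erase hl) _ _
  have hsum : a * mFourier l₀ x + ∑ l ∈ S.erase l₀, c l * mFourier l x = 0 := by
    rw [← hx, trigPoly, ← Finset.add_sum_erase S _ hl₀, Function.update_self]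
    congr 1
    exact Finset.sum_congr rfl fun l hl => by rw [hupd l hl]
  have haG : G z = a := by
    refine mul_left_cancel₀ hne ?_
    change mFourier l₀ x * trigPoly S' c' x = _
    rw [hg]
    linear_combination -hsum
  have hd : ∀ j, trigPoly S (derivCoeff j (Function.update c l₀ a)) x
      = -mFourier l₀ x * trigPoly S' (derivCoeff j c') x := by
    intro j
    rw [neg_mul, hgj, neg_neg, trigPoly, ← Finset.add_sum_erase S _ hl₀, derivCoeff,
      Function.update_self]
    have h1 : ∑ l ∈ S.erase l₀, derivCoeff j (Function.update c l₀ a) l * mFourier l x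
        = ∑ l ∈ S.erase l₀, 2 * Real.pi * Complex.I * ((l j : ℂ) - l₀ j) * c l * mFourier l x
          + 2 * Real.pi * Complex.I * l₀ j * ∑ l ∈ S.erase l₀, c l * mFourier l x := by
      rw [Finset.mul_sum, ← Finset.sum_add_distrib]
      refine Finset.sum_congr rfl fun l hl => ?_
      rw [derivCoeff, hupd l hl]
      ring
    rw [h1]
    linear_combination (2 * Real.pi * Complex.I * l₀ j) * hsum
  rw [hd, hd, jac_mul] at hjac
  refine ha ⟨z, ?_, haG⟩
  have h2 : ‖-mFourier l₀ x‖ ^ 2 ≠ 0 := by simpa using hne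
  exact (mul_eq_zero.1 hjac).resolve_left h2

variable {Ω : Type*} [MeasurableSpace Ω] {P : Measure Ω} [IsProbabilityMeasure P]

/-- Only absolute continuity of the law of a single coefficient enters the nondegeneracy of the zeros. -/
theorem map_absolutelyContinuous_of_gaussian {X : Ω → ℂ} (hX : Measurable X)
    (hre : HasLaw (fun ω => (X ω).re) (gaussianReal 0 1) P)
    (him : HasLaw (fun ω => (X ω).im) (gaussianReal 0 1) P)
    (hind : IndepFun (fun ω => (X ω).re) (fun ω => (X ω).im) P) : P.map X ≪ volume := by
  have h1 : P.map (fun ω => ((X ω).re, (X ω).im)) ≪ (volume : Measure (ℝ × ℝ)) := by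
    rw [(indepFun_iff_map_prod_eq_prod_map_map hre.aemeasurable him.aemeasurable).1 hind,
      hre.map_eq, him.map_eq, Measure.volume_eq_prod]
    exact (gaussianReal_absolutelyContinuous 0 one_ne_zero).prod
      (gaussianReal_absolutelyContinuous 0 one_ne_zero)
  have h2 : X = Complex.measurableEquivRealProd.symm ∘ fun ω => ((X ω).re, (X ω).im) := by
    funext ω
    rw [Function.comp_apply, eq_comm, MeasurableEquiv.symm_apply_eq]
    rfl
  have hm : Measurable fun ω => ((X ω).re, (X ω).im) :=
    (Complex.measurable_re.comp hX).prodMk (Complex.measurable_im.comp hX)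
  rw [h2, ← Measure.map_map Complex.measurableEquivRealProd.symm.measurable hm]
  have h3 := h1.map Complex.measurableEquivRealProd.symm.measurable
  rwa [Complex.volume_preserving_equiv_real_prod.symm.map_eq] at h3

/-- A trigonometric polynomial with independent Gaussian coefficients almost surely has no
degenerate zero. -/
theorem ae_nondegenerate {v : (Fin 2 → ℤ) → Ω → ℂ} (hm : ∀ l, Measurable (v l))
    (hv : iIndepFun v P) (S : Finset (Fin 2 → ℤ)) {l₀ : Fin 2 → ℤ} (hl₀ : l₀ ∈ S)
    (hac : P.map (v l₀) ≪ volume) :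
    ∀ᵐ ω ∂P, ∀ x, trigPoly S (fun l => v l ω) x = 0 →
      jac (trigPoly S (derivCoeff 0 (fun l => v l ω)) x)
        (trigPoly S (derivCoeff 1 (fun l => v l ω)) x) ≠ 0 := by
  classical
  set T := S.erase l₀ with hT
  set ext : (T → ℂ) → (Fin 2 → ℤ) → ℂ := fun c l => if h : l ∈ T then c ⟨l, h⟩ else 0 with hext
  set C : ℂ × (T → ℂ) → (Fin 2 → ℤ) → ℂ := fun p => Function.update (ext p.2) l₀ p.1 with hC
  have hCcont : ∀ l, Continuous fun p => C p l := by
    intro l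
    by_cases hl : l = l₀
    · subst hl
      simp only [hC, Function.update_self]
      fun_prop
    · simp only [hC, Function.update_of_ne hl, hext]
      split_ifs
      · fun_prop
      · fun_prop
  have hcont : ∀ F : ((Fin 2 → ℤ) → ℂ) → (Fin 2 → ℤ) → ℂ, (∀ l, Continuous fun p => F (C p) l) →
      Continuous fun q : (ℂ × (T → ℂ)) × UnitAddTorus (Fin 2) => trigPoly S (F (C q.1)) q.2 := by
    intro F hF
    refine continuous_finsetSum _ fun l _ => ?_
    exact ((hF l).comp continuous_fst).mul ((mFourier l).continuous.comp continuous_snd)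
  have h0 := hcont id hCcont
  have hd : ∀ j, Continuous fun q : (ℂ × (T → ℂ)) × UnitAddTorus (Fin 2) =>
      trigPoly S (derivCoeff j (C q.1)) q.2 := fun j => hcont (derivCoeff j) fun l =>
    continuous_const.mul (hCcont l)
  set Z : Set ((ℂ × (T → ℂ)) × UnitAddTorus (Fin 2)) := {q | trigPoly S (C q.1) q.2 = 0 ∧
    jac (trigPoly S (derivCoeff 0 (C q.1)) q.2) (trigPoly S (derivCoeff 1 (C q.1)) q.2) = 0} with hZ
  have hZc : IsClosed Z := by
    refine IsClosed.inter ?_ ?_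
    · exact isClosed_eq h0 continuous_const
    · have e0 := hd 0
      have e1 := hd 1
      refine isClosed_eq ?_ continuous_const
      unfold jac
      fun_prop
  have hBm : MeasurableSet (Prod.fst '' Z) := (isClosedMap_fst_of_compactSpace _ hZc).measurableSet
  have hind : IndepFun (v l₀) (fun ω (l : T) => v l ω) P := by
    have h1 := hv.indepFun_finset {l₀} T (by simp [hT]) hm
    exact h1.comp (measurable_pi_apply (⟨l₀, by simp⟩ : ({l₀} : Finset (Fin 2 → ℤ))))
      measurable_id
  have hmT : Measurable fun ω (l : T) => v l ω := measurable_pi_lambda _ fun l => hm l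
  have hmap := (indepFun_iff_map_prod_eq_prod_map_map (hm l₀).aemeasurable hmT.aemeasurable).1 hind
  have : IsProbabilityMeasure (P.map (fun ω (l : T) => v l ω)) :=
    Measure.isProbabilityMeasure_map hmT.aemeasurable
  have : IsProbabilityMeasure (P.map (v l₀)) :=
    Measure.isProbabilityMeasure_map (hm l₀).aemeasurable
  have hnull : P ((fun ω => (v l₀ ω, fun l : T => v l ω)) ⁻¹' (Prod.fst '' Z)) = 0 := by
    rw [← Measure.map_apply ((hm l₀).prodMk hmT) hBm, hmap, Measure.prod_apply_symm hBm]
    refine (lintegral_congr fun c => ?_).trans lintegral_zero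
    refine hac (measure_eq_zero_iff_ae_notMem.2 ?_)
    filter_upwards [ae_update_nondegenerate S hl₀ (ext c)] with a ha
    rintro ⟨q, ⟨hq0, hqj⟩, hq⟩
    rw [hq] at hq0 hqj
    exact ha q.2 hq0 hqj
  filter_upwards [measure_eq_zero_iff_ae_notMem.1 hnull] with ω hω x hx hj
  refine hω ⟨((v l₀ ω, fun l : T => v l ω), x), ?_, rfl⟩
  have hCv : ∀ l ∈ S, C (v l₀ ω, fun l : T => v l ω) l = v l ω := by
    intro l hl
    by_cases h : l = l₀
    · subst h
      simp [hC]
    · have : l ∈ T := Finset.mem_erase.2 ⟨h, hl⟩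
      simp [hC, Function.update_of_ne h, hext, this]
  have e0 : trigPoly S (C (v l₀ ω, fun l : T => v l ω)) x = trigPoly S (fun l => v l ω) x :=
    Finset.sum_congr rfl fun l hl => by rw [hCv l hl]
  have e1 : ∀ j, trigPoly S (derivCoeff j (C (v l₀ ω, fun l : T => v l ω))) x
      = trigPoly S (derivCoeff j (fun l => v l ω)) x := fun j =>
    Finset.sum_congr rfl fun l hl => by rw [derivCoeff, derivCoeff, hCv l hl]
  exact ⟨by simp only [e0, hx], by simp only [e1, hj]⟩

end Nondegenerate

/-! ### The wave and its normalised gradient -/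

section Wave

open UnitAddTorus

variable {Ω : Type*}

/-- The Fourier coefficients of the wave. -/
def waveCoeff (v : (Fin 2 → ℤ) → Ω → ℂ) (n : ℕ) (ω : Ω) (l : Fin 2 → ℤ) : ℂ :=
  (1 / (Real.sqrt (freq n).card : ℂ)) * v l ω

theorem wave_eq_trigPoly (v : (Fin 2 → ℤ) → Ω → ℂ) (n : ℕ) (ω : Ω) :
    wave v n ω = trigPoly (freq n) (waveCoeff v n ω) := by
  funext x
  simp only [wave, trigPoly, waveCoeff, Finset.mul_sum, mul_assoc]

theorem torusPt_add_real (z : ℂ) (t : ℝ) :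
    torusPt z + Pi.single 0 (t : UnitAddCircle) = torusPt (z + t) := by
  funext j
  fin_cases j <;> simp [torusPt]

theorem torusPt_add_imag (z : ℂ) (t : ℝ) :
    torusPt z + Pi.single 1 (t : UnitAddCircle) = torusPt (z + t * Complex.I) := by
  funext j
  fin_cases j <;> simp [torusPt]

/-- The derivative of a trigonometric polynomial along a coordinate circle. -/
theorem hasDerivAt_trigPoly_single (S : Finset (Fin 2 → ℤ)) (c : (Fin 2 → ℤ) → ℂ) (j : Fin 2)
    (x : UnitAddTorus (Fin 2)) :
    HasDerivAt (fun t : ℝ => trigPoly S c (x + Pi.single j (t : UnitAddCircle)))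
      (trigPoly S (derivCoeff j c) x) 0 := by
  obtain ⟨z, rfl⟩ := exists_torusPt_eq x
  have key : ∀ w : ℂ, HasDerivAt (fun t : ℝ => trigPoly S c (torusPt (z + t * w)))
      (gradMap (trigPoly S (derivCoeff 0 c) (torusPt z))
        (trigPoly S (derivCoeff 1 c) (torusPt z)) w) 0 := by
    intro w
    have h1 : HasDerivAt (fun t : ℝ => z + t * w) w 0 := by
      simpa using (((hasDerivAt_id (0 : ℝ)).ofReal_comp).mul_const w).const_add z
    have h2 := (hasStrictFDerivAt_trigPoly S c z).hasFDerivAt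
    have h3 : z = z + ((0 : ℝ) : ℂ) * w := by simp
    exact HasFDerivAt.comp_hasDerivAt (0 : ℝ)
      (l := fun z => trigPoly S c (torusPt z)) (by rw [← h3]; exact h2) h1
  fin_cases j
  · have := key 1
    simp only [mul_one, ← torusPt_add_real] at this
    simpa [gradMap] using this
  · have := key Complex.I
    simp only [← torusPt_add_imag] at this
    simpa [gradMap] using this

theorem normDeriv_waveRe (v : (Fin 2 → ℤ) → Ω → ℂ) (n : ℕ) (ω : Ω) (j : Fin 2)
    (x : UnitAddTorus (Fin 2)) : normDeriv n j (waveRe v n ω) x = Real.sqrt (2 / energy n) *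
      (trigPoly (freq n) (derivCoeff j (waveCoeff v n ω)) x).re := by
  have h := Complex.reCLM.hasFDerivAt.comp_hasDerivAt (0 : ℝ)
    (hasDerivAt_trigPoly_single (freq n) (waveCoeff v n ω) j x)
  rw [normDeriv, torusDeriv]
  congr 1
  rw [← wave_eq_trigPoly] at h
  exact h.deriv

theorem normDeriv_waveIm (v : (Fin 2 → ℤ) → Ω → ℂ) (n : ℕ) (ω : Ω) (j : Fin 2)
    (x : UnitAddTorus (Fin 2)) : normDeriv n j (waveIm v n ω) x = Real.sqrt (2 / energy n) *
      (trigPoly (freq n) (derivCoeff j (waveCoeff v n ω)) x).im := by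
  have h := Complex.imCLM.hasFDerivAt.comp_hasDerivAt (0 : ℝ)
    (hasDerivAt_trigPoly_single (freq n) (waveCoeff v n ω) j x)
  rw [normDeriv, torusDeriv]
  congr 1
  rw [← wave_eq_trigPoly] at h
  exact h.deriv

/-- The six-dimensional field `(T, T̂, ∂̃₁T, ∂̃₂T, ∂̃₁T̂, ∂̃₂T̂)`. -/
def field (v : (Fin 2 → ℤ) → Ω → ℂ) (n : ℕ) (x : UnitAddTorus (Fin 2)) (ω : Ω) : Fin 6 → ℝ :=
  ![waveRe v n ω x, waveIm v n ω x, normDeriv n 0 (waveRe v n ω) x, normDeriv n 1 (waveRe v n ω) x,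
    normDeriv n 0 (waveIm v n ω) x, normDeriv n 1 (waveIm v n ω) x]

/-- The multipliers by which the components of `field` arise from the terms of the wave. -/
def fieldMult (n : ℕ) (i : Fin 6) (l : Fin 2 → ℤ) : ℂ :=
  ![1, -Complex.I,
    Real.sqrt (2 / energy n) * (2 * Real.pi * Complex.I * l 0),
    Real.sqrt (2 / energy n) * (2 * Real.pi * Complex.I * l 1),
    Real.sqrt (2 / energy n) * (2 * Real.pi * l 0),
    Real.sqrt (2 / energy n) * (2 * Real.pi * l 1)] i

/-- The complex weight of `v_l` in the `i`-th component of `field` at `x`. -/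
def fieldWeight (n : ℕ) (x : UnitAddTorus (Fin 2)) (i : Fin 6) (l : Fin 2 → ℤ) : ℂ :=
  fieldMult n i l * ((1 / (Real.sqrt (freq n).card : ℂ)) * mFourier l x)

theorem field_eq_sum (v : (Fin 2 → ℤ) → Ω → ℂ) (n : ℕ) (x : UnitAddTorus (Fin 2)) (ω : Ω)
    (i : Fin 6) : field v n x ω i = ∑ l ∈ freq n, (fieldWeight n x i l * v l ω).re := by
  have hre : ∀ c : (Fin 2 → ℤ) → ℂ, (trigPoly (freq n) c x).re
      = ∑ l ∈ freq n, (c l * mFourier l x).re := fun c => by rw [trigPoly, Complex.re_sum]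
  have him : ∀ c : (Fin 2 → ℤ) → ℂ, (trigPoly (freq n) c x).im
      = ∑ l ∈ freq n, (c l * mFourier l x).im := fun c => by rw [trigPoly, Complex.im_sum]
  fin_cases i
  · change (wave v n ω x).re = _
    rw [wave_eq_trigPoly, hre]
    refine Finset.sum_congr rfl fun l _ => ?_
    congr 1
    simp only [fieldWeight, fieldMult, waveCoeff, Fin.zero_eta, Matrix.cons_val_zero]
    ring
  · change (wave v n ω x).im = _
    rw [wave_eq_trigPoly, him]
    refine Finset.sum_congr rfl fun l _ => ?_
    have : fieldWeight n x 1 l * v l ω = -Complex.I * (waveCoeff v n ω l * mFourier l x) := by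
      change -Complex.I * _ * _ = _
      simp only [waveCoeff]
      ring
    change _ = (fieldWeight n x 1 l * v l ω).re
    rw [this]
    simp
  · change normDeriv n 0 (waveRe v n ω) x = _
    rw [normDeriv_waveRe, hre, Finset.mul_sum]
    refine Finset.sum_congr rfl fun l _ => ?_
    rw [← Complex.re_ofReal_mul]
    congr 1
    change _ = Real.sqrt (2 / energy n) * (2 * Real.pi * Complex.I * l 0) * _ * _
    simp only [waveCoeff, derivCoeff]
    ring
  · change normDeriv n 1 (waveRe v n ω) x = _
    rw [normDeriv_waveRe, hre, Finset.mul_sum]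
    refine Finset.sum_congr rfl fun l _ => ?_
    rw [← Complex.re_ofReal_mul]
    congr 1
    change _ = Real.sqrt (2 / energy n) * (2 * Real.pi * Complex.I * l 1) * _ * _
    simp only [waveCoeff, derivCoeff]
    ring
  · change normDeriv n 0 (waveIm v n ω) x = _
    rw [normDeriv_waveIm, him, Finset.mul_sum]
    refine Finset.sum_congr rfl fun l _ => ?_
    rw [← Complex.im_ofReal_mul]
    have : (Real.sqrt (2 / energy n) : ℂ) * (derivCoeff 0 (waveCoeff v n ω) l * mFourier l x)
        = Complex.I * (fieldWeight n x 4 l * v l ω) := by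
      change _ = Complex.I * (Real.sqrt (2 / energy n) * (2 * Real.pi * l 0) * _ * _)
      simp only [waveCoeff, derivCoeff]
      ring
    rw [this]
    simp
  · change normDeriv n 1 (waveIm v n ω) x = _
    rw [normDeriv_waveIm, him, Finset.mul_sum]
    refine Finset.sum_congr rfl fun l _ => ?_
    rw [← Complex.im_ofReal_mul]
    have : (Real.sqrt (2 / energy n) : ℂ) * (derivCoeff 1 (waveCoeff v n ω) l * mFourier l x)
        = Complex.I * (fieldWeight n x 5 l * v l ω) := by
      change _ = Complex.I * (Real.sqrt (2 / energy n) * (2 * Real.pi * l 1) * _ * _)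
      simp only [waveCoeff, derivCoeff]
      ring
    rw [this]
    simp

theorem chaosIntegral_eq (v : (Fin 2 → ℤ) → Ω → ℂ) (n : ℕ) (k : Fin 6 → ℕ) (ω : Ω) :
    chaosIntegral v n k ω = ∫ x, ∏ i, herm (k i) (field v n x ω i) ∂torusMeasure := by
  simp only [chaosIntegral, Fin.prod_univ_six]
  rfl

/-- The integrand of the smoothed count of zeros, as a function of the values of `field`. -/
def approxKernel (ε : ℝ) (z : Fin 6 → ℝ) : ℝ :=
  (4 * ε ^ 2)⁻¹ * {z : Fin 6 → ℝ | |z 0| ≤ ε ∧ |z 1| ≤ ε}.indicator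
    (fun z => |z 2 * z 5 - z 3 * z 4|) z

theorem energy_pos {n : ℕ} (hn : 0 < n) : 0 < energy n := by
  have : (0 : ℝ) < n := by exact_mod_cast hn
  have := Real.pi_pos
  unfold energy
  positivity

/-- The smoothed count is the integral over the torus of a function of the field; the factor
`energy n / 2` comes from the normalisation of the derivatives. -/
theorem approxCount_waveCoeff (v : (Fin 2 → ℤ) → Ω → ℂ) {n : ℕ} (hn : 0 < n) (ω : Ω) (ε : ℝ) :
    approxCount (freq n) (waveCoeff v n ω) ε
      = ∫ x, energy n / 2 * approxKernel ε (field v n x ω) ∂torusMeasure := by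
  have hE := energy_pos hn
  refine integral_congr_ae (Filter.Eventually.of_forall fun x => ?_)
  have hmem : x ∈ trigPoly (freq n) (waveCoeff v n ω) ⁻¹' square ε ↔
      field v n x ω ∈ {z : Fin 6 → ℝ | |z 0| ≤ ε ∧ |z 1| ≤ ε} := by
    rw [← wave_eq_trigPoly]
    rfl
  have hjac : |jac (trigPoly (freq n) (derivCoeff 0 (waveCoeff v n ω)) x)
      (trigPoly (freq n) (derivCoeff 1 (waveCoeff v n ω)) x)| = energy n / 2 *
      |field v n x ω 2 * field v n x ω 5 - field v n x ω 3 * field v n x ω 4| := by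
    have h2 : field v n x ω 2 = normDeriv n 0 (waveRe v n ω) x := rfl
    have h3 : field v n x ω 3 = normDeriv n 1 (waveRe v n ω) x := rfl
    have h4 : field v n x ω 4 = normDeriv n 0 (waveIm v n ω) x := rfl
    have h5 : field v n x ω 5 = normDeriv n 1 (waveIm v n ω) x := rfl
    have hs : Real.sqrt (2 / energy n) * Real.sqrt (2 / energy n) = 2 / energy n :=
      Real.mul_self_sqrt (by positivity)
    rw [h2, h3, h4, h5, normDeriv_waveRe, normDeriv_waveRe, normDeriv_waveIm, normDeriv_waveIm,
      ← abs_of_pos (show 0 < energy n / 2 by positivity), ← abs_mul, jac]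
    congr 1
    calc _ = energy n / 2 * (2 / energy n) *
          ((trigPoly (freq n) (derivCoeff 0 (waveCoeff v n ω)) x).re
          * (trigPoly (freq n) (derivCoeff 1 (waveCoeff v n ω)) x).im
          - (trigPoly (freq n) (derivCoeff 1 (waveCoeff v n ω)) x).re
          * (trigPoly (freq n) (derivCoeff 0 (waveCoeff v n ω)) x).im) := by
          field_simp
      _ = _ := by
          linear_combination (-(energy n / 2) *
            ((trigPoly (freq n) (derivCoeff 0 (waveCoeff v n ω)) x).re
            * (trigPoly (freq n) (derivCoeff 1 (waveCoeff v n ω)) x).im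
            - (trigPoly (freq n) (derivCoeff 1 (waveCoeff v n ω)) x).re
            * (trigPoly (freq n) (derivCoeff 0 (waveCoeff v n ω)) x).im)) * hs
  simp only [approxKernel]
  by_cases hx : x ∈ trigPoly (freq n) (waveCoeff v n ω) ⁻¹' square ε
  · rw [Set.indicator_of_mem hx, Set.indicator_of_mem (hmem.1 hx), hjac]
    ring
  · rw [Set.indicator_of_notMem hx, Set.indicator_of_notMem (fun h => hx (hmem.2 h))]
    ring

/-! ### The components of the field are orthonormal -/

theorem freq_nonempty {n : ℕ} (hn : n ∈ sumsOfTwoSquares) : (freq n).Nonempty := by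
  obtain ⟨a, b, h⟩ := hn
  exact ⟨![a, b], (mem_freq n _).2 (by simpa using h)⟩

/-- This and the next two sums follow from the invariance of `freq n` under `l ↦ -l`, under a change
of sign of one coordinate and under exchange of the coordinates. -/
theorem sum_freq_coord (n : ℕ) (j : Fin 2) : ∑ l ∈ freq n, (l j : ℝ) = 0 := by
  have h : ∑ l ∈ freq n, (l j : ℝ) = ∑ l ∈ freq n, -(l j : ℝ) := by
    refine Finset.sum_nbij' (fun l => -l) (fun l => -l) ?_ ?_ ?_ ?_ ?_
    · intro l hl
      rw [mem_freq] at hl ⊢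
      simpa using hl
    · intro l hl
      rw [mem_freq] at hl ⊢
      simpa using hl
    · simp
    · simp
    · simp
  rw [Finset.sum_neg_distrib] at h
  linarith

theorem sum_freq_mul (n : ℕ) : ∑ l ∈ freq n, (l 0 : ℝ) * l 1 = 0 := by
  have h : ∑ l ∈ freq n, (l 0 : ℝ) * l 1 = ∑ l ∈ freq n, -((l 0 : ℝ) * l 1) := by
    refine Finset.sum_nbij' (fun l => ![-l 0, l 1]) (fun l => ![-l 0, l 1]) ?_ ?_ ?_ ?_ ?_
    · intro l hl
      rw [mem_freq] at hl ⊢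
      simpa using hl
    · intro l hl
      rw [mem_freq] at hl ⊢
      simpa using hl
    · intro l _
      funext j
      fin_cases j <;> simp
    · intro l _
      funext j
      fin_cases j <;> simp
    · simp
  rw [Finset.sum_neg_distrib] at h
  linarith

theorem sum_freq_sq (n : ℕ) (j : Fin 2) :
    ∑ l ∈ freq n, (l j : ℝ) ^ 2 = n * (freq n).card / 2 := by
  have h : ∑ l ∈ freq n, (l 0 : ℝ) ^ 2 = ∑ l ∈ freq n, (l 1 : ℝ) ^ 2 := by
    refine Finset.sum_nbij' (fun l => ![l 1, l 0]) (fun l => ![l 1, l 0]) ?_ ?_ ?_ ?_ ?_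
    · intro l hl
      rw [mem_freq] at hl ⊢
      simpa [add_comm] using hl
    · intro l hl
      rw [mem_freq] at hl ⊢
      simpa [add_comm] using hl
    · intro l _
      funext j
      fin_cases j <;> simp
    · intro l _
      funext j
      fin_cases j <;> simp
    · simp
  have h2 : ∑ l ∈ freq n, (l 0 : ℝ) ^ 2 + ∑ l ∈ freq n, (l 1 : ℝ) ^ 2 = n * (freq n).card := by
    rw [← Finset.sum_add_distrib, Finset.sum_congr rfl (g := fun _ => (n : ℝ)), Finset.sum_const,
      nsmul_eq_mul, mul_comm]
    intro l hl
    exact_mod_cast (mem_freq n l).1 hl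
  fin_cases j
  · change ∑ l ∈ freq n, (l 0 : ℝ) ^ 2 = _
    linarith
  · change ∑ l ∈ freq n, (l 1 : ℝ) ^ 2 = _
    linarith

/-- The six components of the field at a point are orthonormal linear combinations of the real and
imaginary parts of the coefficients. -/
theorem sum_fieldWeight_mul_conj {n : ℕ} (hn : n ∈ sumsOfTwoSquares) (hn0 : 0 < n)
    (x : UnitAddTorus (Fin 2)) (i j : Fin 6) :
    ∑ l ∈ freq n, (fieldWeight n x i l * conj (fieldWeight n x j l)).re = if i = j then 1 else 0 := by
  have hN : (0 : ℝ) < (freq n).card := by exact_mod_cast (freq_nonempty hn).card_pos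
  have hn' : (0 : ℝ) < n := by exact_mod_cast hn0
  have hpi := Real.pi_pos
  have hE := energy_pos hn0
  have h1 : ∀ l, (fieldWeight n x i l * conj (fieldWeight n x j l)).re
      = (1 / (freq n).card : ℝ) * (fieldMult n i l * conj (fieldMult n j l)).re := by
    intro l
    have hnorm : mFourier l x * conj (mFourier l x) = 1 := by
      rw [← mFourier_neg, ← mFourier_add, add_neg_cancel, mFourier_zero]
      rfl
    have hs : (Real.sqrt (freq n).card : ℂ) * Real.sqrt (freq n).card = (freq n).card := by
      rw [← Complex.ofReal_mul, Real.mul_self_sqrt hN.le]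
      norm_cast
    have : fieldWeight n x i l * conj (fieldWeight n x j l)
        = ((1 / (freq n).card : ℝ) : ℂ) * (fieldMult n i l * conj (fieldMult n j l)) := by
      simp only [fieldWeight, map_mul, map_div₀, map_one, Complex.conj_ofReal]
      push_cast
      rw [← hs]
      linear_combination (fieldMult n i l * conj (fieldMult n j l) *
        (1 / (Real.sqrt (freq n).card : ℂ)) * (1 / (Real.sqrt (freq n).card : ℂ))) * hnorm
    rw [this, Complex.re_ofReal_mul]
  simp only [h1]
  rw [← Finset.mul_sum]
  have hsum : ∑ l ∈ freq n, (fieldMult n i l * conj (fieldMult n j l)).re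
      = if i = j then ((freq n).card : ℝ) else 0 := by
    set s := Real.sqrt (2 / energy n) * (2 * Real.pi) with hs_def
    have hs : s * s = 2 / n := by
      have : Real.sqrt (2 / energy n) * Real.sqrt (2 / energy n) = 2 / energy n :=
        Real.mul_self_sqrt (by positivity)
      rw [hs_def, mul_mul_mul_comm, this, energy]
      field_simp
      ring
    have hre : ∀ i l, (fieldMult n i l).re = ![1, 0, 0, 0, s * l 0, s * l 1] i := by
      intro i l
      fin_cases i <;> simp [fieldMult, hs_def, mul_assoc]
    have him : ∀ i l, (fieldMult n i l).im = ![0, -1, s * l 0, s * l 1, 0, 0] i := by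
      intro i l
      fin_cases i <;> simp [fieldMult, hs_def, mul_assoc]
    have hss : ∀ a b : ℝ, s * a * (s * b) = s * s * (a * b) := fun a b => by ring
    have c : ∀ j, ∑ l ∈ freq n, s * (l j : ℝ) = 0 := fun j => by
      rw [← Finset.mul_sum, sum_freq_coord, mul_zero]
    have m01 : ∑ l ∈ freq n, s * (l 0 : ℝ) * (s * l 1) = 0 := by
      simp only [hss]
      rw [← Finset.mul_sum, sum_freq_mul, mul_zero]
    have m10 : ∑ l ∈ freq n, s * (l 1 : ℝ) * (s * l 0) = 0 := by
      rw [← m01]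
      exact Finset.sum_congr rfl fun l _ => mul_comm _ _
    have m : ∀ j, ∑ l ∈ freq n, s * (l j : ℝ) * (s * l j) = (freq n).card := fun j => by
      simp only [hss]
      simp only [← pow_two]
      rw [← Finset.mul_sum, sum_freq_sq, pow_two, hs]
      field_simp
    simp only [Complex.mul_re, Complex.conj_re, Complex.conj_im, hre, him, mul_neg, sub_neg_eq_add]
    fin_cases i <;> fin_cases j <;> simp [c, m01, m10, m]
  rw [hsum]
  split_ifs
  · field_simp
  · simp

end Wave

/-! ### Functions with finite moments of all orders -/

section Moments

/-- The function `f` has finite moments of all orders. Unlike square integrability, this property is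
stable under products. -/
def HasMoments {α : Type*} [MeasurableSpace α] (f : α → ℝ) (μ : Measure α) : Prop :=
  ∀ p : ℝ≥0∞, p ≠ ∞ → MemLp f p μ

variable {α : Type*} [MeasurableSpace α] {μ : Measure α}

namespace HasMoments

theorem const [IsFiniteMeasure μ] (c : ℝ) : HasMoments (fun _ : α => c) μ :=
  fun _ _ => memLp_const c

theorem add {f g : α → ℝ} (hf : HasMoments f μ) (hg : HasMoments g μ) :
    HasMoments (fun x => f x + g x) μ := fun p hp => (hf p hp).add (hg p hp)

theorem sub {f g : α → ℝ} (hf : HasMoments f μ) (hg : HasMoments g μ) :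
    HasMoments (fun x => f x - g x) μ := fun p hp => (hf p hp).sub (hg p hp)

theorem mul {f g : α → ℝ} (hf : HasMoments f μ) (hg : HasMoments g μ) :
    HasMoments (fun x => f x * g x) μ := by
  intro p hp
  have h2 : (2 : ℝ≥0∞) * p ≠ ∞ := by finiteness
  have : ENNReal.HolderTriple (2 * p) (2 * p) p := ⟨by
    rw [ENNReal.mul_inv (Or.inl two_ne_zero) (Or.inl ENNReal.ofNat_ne_top), ← add_mul,
      ENNReal.inv_two_add_inv_two, one_mul]⟩
  exact MemLp.mul (hg _ h2) (hf _ h2)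

theorem abs {f : α → ℝ} (hf : HasMoments f μ) : HasMoments (fun x => |f x|) μ :=
  fun p hp => (hf p hp).abs

theorem prod [IsFiniteMeasure μ] {ι : Type*} (s : Finset ι) {f : ι → α → ℝ}
    (hf : ∀ i, HasMoments (f i) μ) : HasMoments (fun x => ∏ i ∈ s, f i x) μ := by
  classical
  induction s using Finset.induction_on with
  | empty => simpa using const (μ := μ) 1
  | insert i s hi ih =>
    simp only [Finset.prod_insert hi]
    exact (hf i).mul ih

theorem integrable {f : α → ℝ} (hf : HasMoments f μ) : Integrable f μ :=
  memLp_one_iff_integrable.1 (hf 1 (by simp))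

theorem memLp_two {f : α → ℝ} (hf : HasMoments f μ) : MemLp f 2 μ := hf 2 (by simp)

theorem comp {β : Type*} [MeasurableSpace β] {ν : Measure β} {f : β → ℝ} (hf : HasMoments f ν)
    {g : α → β} (hg : MeasurePreserving g μ ν) : HasMoments (fun x => f (g x)) μ :=
  fun p hp => (hf p hp).comp_measurePreserving hg

end HasMoments

end Moments

/-! ### Hermite polynomials and the Gaussian law on the line -/

section Hermite

theorem herm_zero (t : ℝ) : herm 0 t = 1 := by
  simp [herm]

theorem derivative_hermite_succ (k : ℕ) :
    Polynomial.derivative (Polynomial.hermite (k + 1))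
      = (k + 1 : Polynomial ℤ) * Polynomial.hermite k := by
  induction k with
  | zero => simp
  | succ k ih =>
    rw [Polynomial.hermite_succ (k + 1), Polynomial.derivative_sub, ih, Polynomial.derivative_mul,
      Polynomial.derivative_X, ih, Polynomial.derivative_mul]
    have h : Polynomial.derivative ((k : Polynomial ℤ) + 1) = 0 := by simp
    rw [h]
    have := Polynomial.hermite_succ k
    push_cast
    linear_combination -(k + 1 : Polynomial ℤ) * this

/-- The three-term recursion, in the form of multiplication by the variable. -/
theorem mul_herm (k : ℕ) (t : ℝ) : t * herm k t = herm (k + 1) t + k * herm (k - 1) t := by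
  cases k with
  | zero => simp [herm]
  | succ k =>
    have h := Polynomial.hermite_succ (k + 1)
    rw [derivative_hermite_succ] at h
    simp only [herm, h, Nat.add_sub_cancel, map_sub, map_mul, Polynomial.aeval_X, map_add, map_one,
      map_natCast, Nat.cast_add, Nat.cast_one]
    ring

theorem herm_one (t : ℝ) : herm 1 t = t := by
  simp [herm]

theorem herm_two (t : ℝ) : herm 2 t = t ^ 2 - 1 := by
  have := mul_herm 1 t
  simp [herm_one, herm_zero] at this
  linarith

theorem herm_odd_zero {k : ℕ} (hk : Odd k) : herm k 0 = 0 := by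
  rw [herm, ← Polynomial.coeff_zero_eq_aeval_zero', Polynomial.coeff_hermite_of_odd_add (by simpa)]
  simp

theorem herm_neg (k : ℕ) (t : ℝ) : herm k (-t) = (-1) ^ k * herm k t := by
  induction k using Nat.twoStepInduction with
  | zero => simp [herm_zero]
  | one => simp [herm_one]
  | more k ih0 ih1 =>
    have h1 := mul_herm (k + 1) t
    have h2 := mul_herm (k + 1) (-t)
    simp only [Nat.add_sub_cancel, ih0, ih1] at h1 h2
    have : herm (k + 1 + 1) (-t) = (-1) ^ (k + 1 + 1) * herm (k + 1 + 1) t := by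
      have e1 : herm (k + 1 + 1) t = t * herm (k + 1) t - ((k + 1 : ℕ) : ℝ) * herm k t := by
        linarith
      have e2 : herm (k + 1 + 1) (-t) = -t * ((-1) ^ (k + 1) * herm (k + 1) t)
          - ((k + 1 : ℕ) : ℝ) * ((-1) ^ k * herm k t) := by linarith
      rw [e1, e2]
      ring
    exact this

/-- The Hermite polynomial over the reals. -/
def hermPoly (k : ℕ) : Polynomial ℝ := (Polynomial.hermite k).map (Int.castRingHom ℝ)

theorem eval_hermPoly (k : ℕ) (t : ℝ) : (hermPoly k).eval t = herm k t := by
  rw [hermPoly, Polynomial.eval_map, herm, Polynomial.aeval_def]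
  rfl

theorem continuous_herm (k : ℕ) : Continuous (herm k) := by
  have : herm k = fun t => (hermPoly k).eval t := funext fun t => (eval_hermPoly k t).symm
  rw [this]
  exact (hermPoly k).continuous

theorem derivative_hermPoly_succ (k : ℕ) :
    Polynomial.derivative (hermPoly (k + 1)) = (k + 1 : Polynomial ℝ) * hermPoly k := by
  rw [hermPoly, Polynomial.derivative_map, derivative_hermite_succ]
  simp [hermPoly]

theorem hasMoments_id_gaussian : HasMoments (fun x : ℝ => x) (gaussianReal 0 1) :=
  fun p hp => memLp_id_gaussianReal' p hp

theorem hasMoments_eval_gaussian (p : Polynomial ℝ) :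
    HasMoments (fun x => p.eval x) (gaussianReal 0 1) := by
  induction p using Polynomial.induction_on' with
  | add p q hp hq => simpa only [Polynomial.eval_add] using hp.add hq
  | monomial k a =>
    have h := (HasMoments.const (μ := gaussianReal 0 1) a).mul
      (HasMoments.prod (Finset.range k) fun _ : ℕ => hasMoments_id_gaussian)
    simpa using h

theorem hasMoments_herm (k : ℕ) : HasMoments (herm k) (gaussianReal 0 1) := by
  simpa only [eval_hermPoly] using hasMoments_eval_gaussian (hermPoly k)

theorem integrable_gaussian_iff {f : ℝ → ℝ} : Integrable f (gaussianReal 0 1) ↔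
    Integrable (fun x => f x * gaussianPDFReal 0 1 x) := by
  rw [gaussianReal_of_var_ne_zero 0 one_ne_zero, integrable_withDensity_iff
    (measurable_gaussianPDF 0 1) (Filter.Eventually.of_forall fun _ => gaussianPDF_lt_top)]
  simp only [toReal_gaussianPDF]

/-- Gaussian integration by parts for polynomials. -/
theorem integral_mul_eval_gaussian (p : Polynomial ℝ) :
    ∫ x, x * p.eval x ∂(gaussianReal 0 1) = ∫ x, p.derivative.eval x ∂(gaussianReal 0 1) := by
  have hpdf : ∀ x : ℝ, HasDerivAt (gaussianPDFReal 0 1) (-x * gaussianPDFReal 0 1 x) x := by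
    intro x
    simp only [gaussianPDFReal_def, NNReal.coe_one, mul_one, sub_zero]
    have h1 : HasDerivAt (fun x : ℝ => -x ^ 2 / 2) (-x) x := by
      have := ((hasDerivAt_pow 2 x).neg).div_const 2
      convert! this using 1
      simp
      ring
    convert! (h1.exp.const_mul (Real.sqrt (2 * Real.pi))⁻¹) using 1
    ring
  have hd : ∀ x, HasDerivAt (fun x => p.eval x * gaussianPDFReal 0 1 x)
      ((p.derivative.eval x - x * p.eval x) * gaussianPDFReal 0 1 x) x := by
    intro x
    convert! (p.hasDerivAt x).mul (hpdf x) using 1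
    ring
  have hX : ∀ x, x * p.eval x = (Polynomial.X * p).eval x := fun x => by simp
  have i1 := (hasMoments_eval_gaussian p).integrable
  have i2 := (hasMoments_eval_gaussian p.derivative).integrable
  have i3 : Integrable (fun x => x * p.eval x) (gaussianReal 0 1) := by
    simp only [hX]
    exact (hasMoments_eval_gaussian _).integrable
  have h0 := integral_eq_zero_of_hasDerivAt_of_integrable hd
    (integrable_gaussian_iff.1 (i2.sub i3)) (integrable_gaussian_iff.1 i1)
  have h1 : ∫ x, (p.derivative.eval x - x * p.eval x) ∂(gaussianReal 0 1) = 0 := by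
    rw [integral_gaussianReal_eq_integral_smul one_ne_zero]
    simpa only [smul_eq_mul, mul_comm] using h0
  rw [integral_sub i2 i3] at h1
  linarith

theorem integral_herm_succ_mul_eval (a : ℕ) (q : Polynomial ℝ) :
    ∫ x, herm (a + 1) x * q.eval x ∂(gaussianReal 0 1)
      = ∫ x, herm a x * q.derivative.eval x ∂(gaussianReal 0 1) := by
  have h := integral_mul_eval_gaussian (hermPoly a * q)
  have hH : ∀ x, herm (a + 1) x = x * herm a x - (Polynomial.derivative (hermPoly a)).eval x := by
    intro x
    rw [← eval_hermPoly, ← eval_hermPoly, hermPoly, hermPoly, Polynomial.hermite_succ]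
    simp
  have i1 : Integrable (fun x => x * (hermPoly a * q).eval x) (gaussianReal 0 1) :=
    (hasMoments_id_gaussian.mul (hasMoments_eval_gaussian _)).integrable
  have i2 : Integrable (fun x => (Polynomial.derivative (hermPoly a)).eval x * q.eval x)
      (gaussianReal 0 1) :=
    ((hasMoments_eval_gaussian _).mul (hasMoments_eval_gaussian _)).integrable
  have i3 : Integrable (fun x => herm a x * q.derivative.eval x) (gaussianReal 0 1) :=
    ((hasMoments_herm a).mul (hasMoments_eval_gaussian _)).integrable
  have e1 : ∀ x, herm (a + 1) x * q.eval x = x * (hermPoly a * q).eval x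
      - (Polynomial.derivative (hermPoly a)).eval x * q.eval x := by
    intro x
    rw [hH, Polynomial.eval_mul, eval_hermPoly]
    ring
  have e2 : ∀ x, (Polynomial.derivative (hermPoly a * q)).eval x
      = (Polynomial.derivative (hermPoly a)).eval x * q.eval x + herm a x * q.derivative.eval x := by
    intro x
    simp [Polynomial.derivative_mul, eval_hermPoly]
  simp only [e1]
  rw [integral_sub i1 i2, h]
  simp only [e2]
  rw [integral_add i2 i3]
  ring

theorem integral_herm_mul_herm (a b : ℕ) :
    ∫ x, herm a x * herm b x ∂(gaussianReal 0 1) = if a = b then (a ! : ℝ) else 0 := by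
  induction a generalizing b with
  | zero =>
    cases b with
    | zero => simp [herm_zero]
    | succ b =>
      have := integral_herm_succ_mul_eval b 1
      simp only [Polynomial.eval_one, Polynomial.derivative_one, Polynomial.eval_zero, mul_one,
        mul_zero, integral_zero] at this
      simp [herm_zero, this]
  | succ a ih =>
    cases b with
    | zero =>
      have := integral_herm_succ_mul_eval a 1
      simp only [Polynomial.eval_one, Polynomial.derivative_one, Polynomial.eval_zero, mul_one,
        mul_zero, integral_zero] at this
      simp [herm_zero, this]
    | succ b =>
      have h := integral_herm_succ_mul_eval a (hermPoly (b + 1))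
      rw [derivative_hermPoly_succ] at h
      have e : ∀ x, herm a x * ((b + 1 : Polynomial ℝ) * hermPoly b).eval x
          = (b + 1 : ℝ) * (herm a x * herm b x) := by
        intro x
        simp [eval_hermPoly]
        ring
      simp only [e, eval_hermPoly] at h
      rw [h, integral_const_mul, ih]
      by_cases hab : a = b
      · subst hab
        simp [Nat.factorial_succ]
      · simp [hab]

/-- Mehler's formula on the line: averaging over an independent Gaussian contracts `H_k`. -/
theorem integral_herm_add {r s : ℝ} (hrs : r ^ 2 + s ^ 2 = 1) (k : ℕ) (x : ℝ) :
    ∫ g, herm k (r * x + s * g) ∂(gaussianReal 0 1) = r ^ k * herm k x := by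
  have hp : ∀ k g, herm k (r * x + s * g)
      = ((hermPoly k).comp (Polynomial.C (r * x) + Polynomial.C s * Polynomial.X)).eval g := by
    intro k g
    simp [Polynomial.eval_comp, eval_hermPoly]
  have hi : ∀ k, HasMoments (fun g => herm k (r * x + s * g)) (gaussianReal 0 1) := by
    intro k
    simp only [hp]
    exact hasMoments_eval_gaussian _
  induction k using Nat.twoStepInduction with
  | zero => simp [herm_zero]
  | one =>
    have hid := (hasMoments_id_gaussian).integrable
    simp only [herm_one]
    rw [integral_add (integrable_const _) (hid.const_mul s), integral_const_mul s, integral_id_gaussianReal]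
    simp
  | more k ih0 ih1 =>
    have h1 : ∀ g, herm (k + 2) (r * x + s * g) = (r * x) * herm (k + 1) (r * x + s * g)
        + s * (g * herm (k + 1) (r * x + s * g)) - (k + 1) * herm k (r * x + s * g) := by
      intro g
      have := mul_herm (k + 1) (r * x + s * g)
      simp only [Nat.add_sub_cancel, Nat.cast_add, Nat.cast_one] at this
      linear_combination -this
    have h2 : ∫ g, g * herm (k + 1) (r * x + s * g) ∂(gaussianReal 0 1)
        = s * ((k + 1) * ∫ g, herm k (r * x + s * g) ∂(gaussianReal 0 1)) := by
      simp only [hp (k + 1)]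
      rw [integral_mul_eval_gaussian, ← integral_const_mul, ← integral_const_mul]
      refine integral_congr_ae (Filter.Eventually.of_forall fun g => ?_)
      simp only [hp k, Polynomial.derivative_comp, derivative_hermPoly_succ]
      simp [Polynomial.eval_comp]
    have i1 : Integrable (fun g => (r * x) * herm (k + 1) (r * x + s * g)) (gaussianReal 0 1) :=
      ((HasMoments.const _).mul (hi _)).integrable
    have i2 : Integrable (fun g => s * (g * herm (k + 1) (r * x + s * g))) (gaussianReal 0 1) :=
      ((HasMoments.const _).mul (hasMoments_id_gaussian.mul (hi _))).integrable
    have i3 : Integrable (fun g => (k + 1) * herm k (r * x + s * g)) (gaussianReal 0 1) :=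
      ((HasMoments.const _).mul (hi _)).integrable
    have i12 : Integrable (fun g => (r * x) * herm (k + 1) (r * x + s * g)
        + s * (g * herm (k + 1) (r * x + s * g))) (gaussianReal 0 1) := i1.add i2
    simp only [h1]
    rw [integral_sub i12 i3, integral_add i1 i2, integral_const_mul, integral_const_mul,
      integral_const_mul, h2, ih0, ih1]
    have h3 := mul_herm (k + 1) x
    simp only [Nat.add_sub_cancel, Nat.cast_add, Nat.cast_one] at h3
    have hs : s ^ 2 = 1 - r ^ 2 := by linarith
    linear_combination r ^ (k + 2) * h3 + ((k + 1) * r ^ k * herm k x) * hs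

end Hermite

/-! ### Products of Hermite polynomials in several variables -/

section HermiteProducts

variable {ι : Type*} [Fintype ι]

/-- The standard Gaussian law on `ℝ^ι`. -/
abbrev gaussPi (ι : Type*) [Fintype ι] : Measure (ι → ℝ) := Measure.pi fun _ => gaussianReal 0 1

/-- The product `∏ᵢ H_{kᵢ}(zᵢ)` of Hermite polynomials. -/
def hermProd (k : ι → ℕ) (z : ι → ℝ) : ℝ := ∏ i, herm (k i) (z i)

theorem continuous_hermProd (k : ι → ℕ) : Continuous (hermProd k) :=
  continuous_finsetProd _ fun i _ => (continuous_herm (k i)).comp (continuous_apply i)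

theorem hasMoments_coord {f : ℝ → ℝ} (hf : HasMoments f (gaussianReal 0 1)) (i : ι) :
    HasMoments (fun z : ι → ℝ => f (z i)) (gaussPi ι) :=
  hf.comp (measurePreserving_eval (fun _ => gaussianReal 0 1) i)

theorem hasMoments_hermProd (k : ι → ℕ) : HasMoments (hermProd k) (gaussPi ι) :=
  HasMoments.prod _ fun i => hasMoments_coord (hasMoments_herm (k i)) i

theorem integral_hermProd_mul_hermProd [DecidableEq ι] (k m : ι → ℕ) :
    ∫ z, hermProd k z * hermProd m z ∂(gaussPi ι) = if k = m then ∏ i, ((k i)! : ℝ) else 0 := by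
  simp only [hermProd, ← Finset.prod_mul_distrib]
  rw [integral_fintype_prod_eq_prod (fun i t => herm (k i) t * herm (m i) t)]
  simp only [integral_herm_mul_herm]
  split_ifs with h
  · subst h
    simp
  · obtain ⟨i, hi⟩ := Function.ne_iff.1 h
    exact Finset.prod_eq_zero (Finset.mem_univ i) (by simp [hi])

/-- Mehler's formula in several variables. -/
theorem integral_hermProd_add {r s : ℝ} (hrs : r ^ 2 + s ^ 2 = 1) (k : ι → ℕ) (z : ι → ℝ) :
    ∫ g, hermProd k (fun i => r * z i + s * g i) ∂(gaussPi ι) = r ^ (∑ i, k i) * hermProd k z := by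
  simp only [hermProd]
  rw [integral_fintype_prod_eq_prod (fun i t => herm (k i) (r * z i + s * t))]
  simp only [integral_herm_add hrs, Finset.prod_mul_distrib, Finset.prod_pow_eq_pow_sum]

theorem coord_mul_hermProd [DecidableEq ι] (k : ι → ℕ) (i : ι) (z : ι → ℝ) :
    z i * hermProd k z = hermProd (Function.update k i (k i + 1)) z
      + k i * hermProd (Function.update k i (k i - 1)) z := by
  have h : ∀ m, hermProd (Function.update k i m) z
      = herm m (z i) * ∏ j ∈ Finset.univ.erase i, herm (k j) (z j) := by
    intro m
    rw [hermProd, ← Finset.mul_prod_erase Finset.univ _ (Finset.mem_univ i), Function.update_self]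
    congr 1
    refine Finset.prod_congr rfl fun j hj => ?_
    rw [Function.update_of_ne (Finset.ne_of_mem_erase hj)]
  have h0 := h (k i)
  rw [Function.update_eq_self] at h0
  rw [h, h, h0, ← mul_assoc, mul_herm]
  ring

/-- The span of the products of Hermite polynomials is stable under multiplication by linear
forms. -/
theorem linear_mul_mem_span_hermProd (a : ι → ℝ) {f : (ι → ℝ) → ℝ}
    (hf : f ∈ Submodule.span ℝ (Set.range (hermProd (ι := ι)))) :
    (fun z => (∑ i, a i * z i) * f z) ∈ Submodule.span ℝ (Set.range (hermProd (ι := ι))) := by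
  classical
  induction hf using Submodule.span_induction with
  | mem f hf =>
    obtain ⟨k, rfl⟩ := hf
    have : (fun z => (∑ i, a i * z i) * hermProd k z) = ∑ i, a i •
        (hermProd (Function.update k i (k i + 1)) +
          (k i : ℝ) • hermProd (Function.update k i (k i - 1))) := by
      funext z
      simp only [Finset.sum_mul, Finset.sum_apply, Pi.smul_apply, Pi.add_apply, smul_eq_mul]
      exact Finset.sum_congr rfl fun i _ => by rw [mul_assoc, coord_mul_hermProd]
    rw [this]
    exact Submodule.sum_mem _ fun i _ => Submodule.smul_mem _ _ (Submodule.add_mem _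
      (Submodule.subset_span ⟨_, rfl⟩)
      (Submodule.smul_mem _ _ (Submodule.subset_span ⟨_, rfl⟩)))
  | zero => simp only [Pi.zero_apply, mul_zero]; exact Submodule.zero_mem _
  | add f g _ _ hf hg =>
    simp only [Pi.add_apply, mul_add]
    exact Submodule.add_mem _ hf hg
  | smul c f _ hf =>
    have : (fun z : ι → ℝ => (∑ i, a i * z i) * (c • f) z)
        = c • fun z => (∑ i, a i * z i) * f z := by
      funext z
      simp only [Pi.smul_apply, smul_eq_mul]
      ring
    rw [this]
    exact Submodule.smul_mem _ _ hf

theorem linear_pow_mem_span_hermProd (a : ι → ℝ) (m : ℕ) :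
    (fun z => (∑ i, a i * z i) ^ m) ∈ Submodule.span ℝ (Set.range (hermProd (ι := ι))) := by
  induction m with
  | zero =>
    refine Submodule.subset_span ⟨0, ?_⟩
    funext z
    simp [hermProd, herm_zero]
  | succ m ih =>
    simp only [pow_succ']
    exact linear_mul_mem_span_hermProd a ih

theorem integral_mul_eq_zero_of_mem_span {f : (ι → ℝ) → ℝ} (hf : MemLp f 2 (gaussPi ι))
    (hf0 : ∀ k, ∫ z, f z * hermProd k z ∂(gaussPi ι) = 0) {g : (ι → ℝ) → ℝ}
    (hg : g ∈ Submodule.span ℝ (Set.range (hermProd (ι := ι)))) :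
    Integrable (fun z => f z * g z) (gaussPi ι) ∧ ∫ z, f z * g z ∂(gaussPi ι) = 0 := by
  induction hg using Submodule.span_induction with
  | mem g hg =>
    obtain ⟨k, rfl⟩ := hg
    exact ⟨hf.integrable_mul (hasMoments_hermProd k).memLp_two, hf0 k⟩
  | zero => simp
  | add g h _ _ hg hh =>
    simp only [Pi.add_apply, mul_add]
    exact ⟨hg.1.add hh.1, by rw [integral_add hg.1 hh.1, hg.2, hh.2, add_zero]⟩
  | smul c g _ hg =>
    have e : (fun z => f z * (c • g) z) = fun z => c * (f z * g z) := by
      funext z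
      simp only [Pi.smul_apply, smul_eq_mul]
      ring
    rw [e]
    exact ⟨hg.1.const_mul c, by rw [integral_const_mul, hg.2, mul_zero]⟩

/-- This function dominates the partial sums of the exponential series of the linear function. -/
theorem memLp_exp_abs_linear (a : ι → ℝ) :
    MemLp (fun z => Real.exp |∑ i, a i * z i|) 2 (gaussPi ι) := by
  have hcont : Continuous fun z : ι → ℝ => Real.exp |∑ i, a i * z i| := by fun_prop
  rw [memLp_two_iff_integrable_sq hcont.aestronglyMeasurable]
  have key : ∀ t : ℝ, Integrable (fun z : ι → ℝ => Real.exp (t * ∑ i, a i * z i)) (gaussPi ι) := by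
    intro t
    have h := Integrable.fintype_prod (μ := fun _ : ι => gaussianReal 0 1)
      (f := fun i x => Real.exp (t * a i * x))
      fun i => integrable_exp_mul_gaussianReal (t * a i)
    refine h.congr (Filter.Eventually.of_forall fun z => ?_)
    simp only [← Real.exp_sum, Finset.mul_sum, mul_assoc]
  refine ((key 2).add (key (-2))).mono' (hcont.pow 2).aestronglyMeasurable
    (Filter.Eventually.of_forall fun z => ?_)
  rw [Real.norm_of_nonneg (by positivity), ← Real.exp_nat_mul, Pi.add_apply]
  rcases abs_cases (∑ i, a i * z i) with ⟨h, -⟩ | ⟨h, -⟩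
  · rw [h]
    exact le_add_of_le_of_nonneg (by simp) (by positivity)
  · rw [h]
    exact le_add_of_nonneg_of_le (by positivity) (by simp)

/-- A square integrable function orthogonal to all products of Hermite polynomials has vanishing
Fourier transform, by expansion of the exponential. -/
theorem integral_mul_cexp_eq_zero {f : (ι → ℝ) → ℝ} (hf : MemLp f 2 (gaussPi ι))
    (hf0 : ∀ k, ∫ z, f z * hermProd k z ∂(gaussPi ι) = 0) (a : ι → ℝ) :
    ∫ z, (f z : ℂ) * Complex.exp ((∑ i, a i * z i : ℝ) * Complex.I) ∂(gaussPi ι) = 0 := by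
  set L : (ι → ℝ) → ℝ := fun z => ∑ i, a i * z i with hL
  have hLc : Continuous L := by fun_prop
  have hterm : ∀ m : ℕ, ∫ z, (f z : ℂ) * ((L z * Complex.I) ^ m / m !) ∂(gaussPi ι) = 0 := by
    intro m
    have h := (integral_mul_eq_zero_of_mem_span hf hf0 (linear_pow_mem_span_hermProd a m)).2
    have e : ∀ z, (f z : ℂ) * ((L z * Complex.I) ^ m / m !)
        = (Complex.I ^ m / m !) * ((f z * L z ^ m : ℝ) : ℂ) := by
      intro z
      push_cast
      ring
    simp only [e]
    rw [integral_const_mul, integral_complex_ofReal, h]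
    simp
  have hsum := hasSum_integral_of_dominated_convergence (μ := gaussPi ι)
    (F := fun (m : ℕ) z => (f z : ℂ) * ((L z * Complex.I) ^ m / m !))
    (f := fun z => (f z : ℂ) * Complex.exp (L z * Complex.I))
    (fun m z => |f z| * (|L z| ^ m / m !))
    (fun m => (Complex.continuous_ofReal.comp_aestronglyMeasurable hf.1).mul
      (by fun_prop : Continuous fun z => (L z * Complex.I) ^ m / (m ! : ℂ)).aestronglyMeasurable)
    (fun m => Filter.Eventually.of_forall fun z => by
      simp [norm_pow])
    (Filter.Eventually.of_forall fun z => (Real.summable_pow_div_factorial |L z|).mul_left _)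
    (by
      have : ∀ z, ∑' m : ℕ, |f z| * (|L z| ^ m / m !) = |f z| * Real.exp |L z| := by
        intro z
        rw [tsum_mul_left, Real.exp_eq_exp_ℝ, NormedSpace.exp_eq_tsum_div]
      simp only [this]
      exact hf.abs.integrable_mul (memLp_exp_abs_linear a))
    (Filter.Eventually.of_forall fun z => by
      have := NormedSpace.expSeries_div_hasSum_exp (L z * Complex.I)
      rw [← Complex.exp_eq_exp_ℂ] at this
      exact this.mul_left _)
  simp only [hterm] at hsum
  exact hsum.unique hasSum_zero

/-- **Completeness of the products of Hermite polynomials** in `L²` of the Gaussian law. -/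
theorem ae_eq_zero_of_forall_integral_hermProd {f : (ι → ℝ) → ℝ} (hf : MemLp f 2 (gaussPi ι))
    (hf0 : ∀ k, ∫ z, f z * hermProd k z ∂(gaussPi ι) = 0) : f =ᵐ[gaussPi ι] 0 := by
  classical
  -- it suffices to treat a measurable representative
  obtain ⟨g, hgm, hfg⟩ := hf.1
  have hgm' := hgm.measurable
  have hgn : Measurable fun z => -g z := hgm'.neg
  have hg : MemLp g 2 (gaussPi ι) := (memLp_congr_ae hfg).1 hf
  have hg0 : ∀ k, ∫ z, g z * hermProd k z ∂(gaussPi ι) = 0 := fun k => by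
    rw [← hf0 k]
    exact integral_congr_ae (hfg.symm.mul (Filter.EventuallyEq.refl _ _))
  refine hfg.trans ?_
  have hgi : Integrable g (gaussPi ι) := hg.integrable (by norm_num)
  have hfin : ∀ {h : (ι → ℝ) → ℝ}, Integrable h (gaussPi ι) →
      ∫⁻ z, ENNReal.ofReal (h z) ∂(gaussPi ι) ≠ ∞ := fun hh => hh.lintegral_lt_top.ne
  set μ₁ := (gaussPi ι).withDensity fun z => ENNReal.ofReal (g z) with hμ₁
  set μ₂ := (gaussPi ι).withDensity fun z => ENNReal.ofReal (-g z) with hμ₂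
  have f1 : IsFiniteMeasure μ₁ := isFiniteMeasure_withDensity (hfin hgi)
  have f2 : IsFiniteMeasure μ₂ := isFiniteMeasure_withDensity (hfin hgi.neg)
  have hchar : charFunDual μ₁ = charFunDual μ₂ := by
    funext L
    have hL : ∀ z : ι → ℝ, L z = ∑ i, L (Pi.single i 1) * z i := by
      intro z
      conv_lhs => rw [pi_eq_sum_univ' z]
      rw [map_sum]
      refine Finset.sum_congr rfl fun i _ => ?_
      rw [map_smul, smul_eq_mul, mul_comm]
    rw [charFunDual_apply, charFunDual_apply,
      integral_withDensity_eq_integral_toReal_smul hgm'.ennreal_ofReal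
        (Filter.Eventually.of_forall fun _ => ENNReal.ofReal_lt_top),
      integral_withDensity_eq_integral_toReal_smul hgn.ennreal_ofReal
        (Filter.Eventually.of_forall fun _ => ENNReal.ofReal_lt_top), ← sub_eq_zero]
    have hexp : ∀ z, ‖Complex.exp ((L z : ℂ) * Complex.I)‖ = 1 := fun z =>
      Complex.norm_exp_ofReal_mul_I _
    have hint : ∀ h : (ι → ℝ) → ℝ, Measurable h → Integrable h (gaussPi ι) → Integrable
        (fun z => (ENNReal.ofReal (h z)).toReal • Complex.exp ((L z : ℂ) * Complex.I))
        (gaussPi ι) := by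
      intro h hm hh
      refine hh.mono ?_ (Filter.Eventually.of_forall fun z => ?_)
      · exact (hm.ennreal_ofReal.ennreal_toReal.smul (by fun_prop)).aestronglyMeasurable
      · rw [norm_smul, hexp, mul_one, ENNReal.toReal_ofReal', Real.norm_eq_abs, Real.norm_eq_abs]
        rcases le_total 0 (h z) with h0 | h0
        · rw [max_eq_left h0]
        · rw [max_eq_right h0, abs_zero]
          exact abs_nonneg _
    have hneg : Integrable (fun z => -g z) (gaussPi ι) := hgi.neg
    rw [← integral_sub (hint g hgm' hgi) (hint (fun z => -g z) hgn hneg)]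
    rw [← integral_mul_cexp_eq_zero hg hg0 fun i => L (Pi.single i 1)]
    refine integral_congr_ae (Filter.Eventually.of_forall fun z => ?_)
    simp only
    rw [← sub_smul, ENNReal.toReal_ofReal', ENNReal.toReal_ofReal', hL z, Complex.real_smul]
    congr 2
    rcases le_total 0 (g z) with h0 | h0
    · rw [max_eq_left h0, max_eq_right (by linarith), sub_zero]
    · rw [max_eq_right h0, max_eq_left (by linarith), zero_sub, neg_neg]
  have hμ := Measure.ext_of_charFunDual hchar
  rw [hμ₁, hμ₂, withDensity_eq_iff hgm'.ennreal_ofReal.aemeasurable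
    hgn.ennreal_ofReal.aemeasurable (hfin hgi)] at hμ
  filter_upwards [hμ] with z hz
  rw [Pi.zero_apply]
  rcases le_total 0 (g z) with h0 | h0
  · rw [ENNReal.ofReal_of_nonpos (show -g z ≤ 0 by linarith), ENNReal.ofReal_eq_zero] at hz
    linarith
  · rw [ENNReal.ofReal_of_nonpos h0, eq_comm, ENNReal.ofReal_eq_zero] at hz
    linarith

/-- The factor that normalises `hermProd k` in `L²`. -/
def hermNorm (k : ι → ℕ) : ℝ := Real.sqrt (∏ i, ((k i)! : ℝ))

theorem hermNorm_sq (k : ι → ℕ) : hermNorm k * hermNorm k = ∏ i, ((k i)! : ℝ) :=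
  Real.mul_self_sqrt (by positivity)

theorem hermNorm_pos (k : ι → ℕ) : 0 < hermNorm k :=
  Real.sqrt_pos.2 (Finset.prod_pos fun i _ => by positivity)

/-- The product of Hermite polynomials as an element of `L²`. -/
def hermLp (k : ι → ℕ) : Lp ℝ 2 (gaussPi ι) := (hasMoments_hermProd k).memLp_two.toLp (hermProd k)

theorem inner_hermLp_left {f : (ι → ℝ) → ℝ} (hf : MemLp f 2 (gaussPi ι)) (k : ι → ℕ) :
    inner ℝ (hermLp k) (hf.toLp f) = ∫ z, f z * hermProd k z ∂(gaussPi ι) := by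
  rw [L2.inner_def]
  refine integral_congr_ae ?_
  filter_upwards [hf.coeFn_toLp, (hasMoments_hermProd k).memLp_two.coeFn_toLp] with z h1 h2
  rw [h1, hermLp, h2]
  rfl

theorem orthonormal_hermLp :
    Orthonormal ℝ fun k : ι → ℕ => (hermNorm k)⁻¹ • hermLp k := by
  classical
  rw [orthonormal_iff_ite]
  intro k m
  rw [inner_smul_left, inner_smul_right]
  have : inner ℝ (hermLp k) (hermLp m) = if k = m then ∏ i, ((k i)! : ℝ) else 0 := by
    rw [hermLp, hermLp, ← hermLp, inner_hermLp_left, ← integral_hermProd_mul_hermProd]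
    simp only [mul_comm]
  rw [this]
  split_ifs with h
  · subst h
    have := (hermNorm_pos k).ne'
    rw [← hermNorm_sq]
    simp
    field_simp
  · simp

/-- The Hilbert basis of normalised products of Hermite polynomials. -/
def hermBasis (ι : Type*) [Fintype ι] : HilbertBasis (ι → ℕ) ℝ (Lp ℝ 2 (gaussPi ι)) :=
  HilbertBasis.mkOfOrthogonalEqBot orthonormal_hermLp (by
    rw [Submodule.eq_bot_iff]
    intro f hf
    rw [Submodule.mem_orthogonal] at hf
    have h0 : ∀ k, ∫ z, f z * hermProd k z ∂(gaussPi ι) = 0 := by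
      intro k
      have h1 := hf _ (Submodule.subset_span ⟨k, rfl⟩)
      rw [inner_smul_left] at h1
      have h2 : inner ℝ (hermLp k) f = 0 :=
        (mul_eq_zero.1 h1).resolve_left (by simpa using (hermNorm_pos k).ne')
      rw [← inner_hermLp_left (Lp.memLp f), Lp.toLp_coeFn, h2]
    exact (Lp.eq_zero_iff_ae_eq_zero).2 (ae_eq_zero_of_forall_integral_hermProd (Lp.memLp f) h0))

/-- The Hermite expansion of a square integrable function. -/
theorem hasSum_hermLp {f : (ι → ℝ) → ℝ} (hf : MemLp f 2 (gaussPi ι)) :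
    HasSum (fun k : ι → ℕ => ((∫ z, f z * hermProd k z ∂(gaussPi ι)) / ∏ i, ((k i)! : ℝ)) • hermLp k)
      (hf.toLp f) := by
  have h := (hermBasis ι).hasSum_repr (hf.toLp f)
  convert! h using 2 with k
  rw [HilbertBasis.repr_apply_apply]
  have : hermBasis ι k = (hermNorm k)⁻¹ • hermLp k := by
    rw [hermBasis, HilbertBasis.coe_mkOfOrthogonalEqBot]
  rw [this, inner_smul_left, smul_smul, inner_hermLp_left, ← hermNorm_sq]
  congr 1
  have := (hermNorm_pos k).ne'
  simp
  field_simp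

end HermiteProducts

/-! ### The Gaussian space -/

section GaussianSpace

variable {Ω : Type*} [MeasurableSpace Ω] {P : Measure Ω}

/-- The assumptions on the Fourier coefficients: they are measurable (not only almost everywhere, as
the laws of their real and imaginary parts would imply) and independent, and their
real and imaginary parts are independent standard Gaussian variables. -/
structure GaussianCoeffs (v : (Fin 2 → ℤ) → Ω → ℂ) (P : Measure Ω) : Prop where
  meas : ∀ l, Measurable (v l)
  law_re : ∀ l, HasLaw (fun ω => (v l ω).re) (gaussianReal 0 1) P
  law_im : ∀ l, HasLaw (fun ω => (v l ω).im) (gaussianReal 0 1) P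
  indep_re_im : ∀ l, IndepFun (fun ω => (v l ω).re) (fun ω => (v l ω).im) P
  indep : iIndepFun v P

/-- The real linear combination `∑_{l ∈ S} Re (w_l v_l)` of the coefficients. -/
def linComb (v : (Fin 2 → ℤ) → Ω → ℂ) (S : Finset (Fin 2 → ℤ)) (w : (Fin 2 → ℤ) → ℂ) (ω : Ω) : ℝ :=
  ∑ l ∈ S, (w l * v l ω).re

theorem exists_linComb_add {Ω : Type*} (v : (Fin 2 → ℤ) → Ω → ℂ) (S S' : Finset (Fin 2 → ℤ))
    (w w' : (Fin 2 → ℤ) → ℂ) :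
    ∃ T u, ∀ ω, linComb v S w ω + linComb v S' w' ω = linComb v T u ω := by
  classical
  refine ⟨S ∪ S', fun l => (if l ∈ S then w l else 0) + if l ∈ S' then w' l else 0, fun ω => ?_⟩
  simp only [linComb, add_mul, Complex.add_re, Finset.sum_add_distrib, ite_mul, zero_mul,
    apply_ite Complex.re, Complex.zero_re, Finset.sum_ite_mem]
  rw [Finset.union_inter_cancel_left, Finset.union_inter_cancel_right]

variable {v : (Fin 2 → ℤ) → Ω → ℂ}

theorem GaussianCoeffs.measurable_linComb (hv : GaussianCoeffs v P) (S : Finset (Fin 2 → ℤ))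
    (w : (Fin 2 → ℤ) → ℂ) : Measurable (linComb v S w) :=
  Finset.measurable_sum _ fun l _ =>
    Complex.measurable_re.comp ((measurable_const.mul (hv.meas l)))

theorem GaussianCoeffs.map_re_mul (hv : GaussianCoeffs v P) (l : Fin 2 → ℤ) (w : ℂ) :
    P.map (fun ω => (w * v l ω).re) = gaussianReal 0 (‖w‖₊ ^ 2) := by
  have h1 : (fun ω => (w * v l ω).re)
      = (fun ω => w.re * (v l ω).re) + fun ω => -w.im * (v l ω).im := by
    funext ω
    simp [Complex.mul_re]
    ring
  have hr := gaussianReal_const_mul (hv.law_re l) w.re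
  have hi := gaussianReal_const_mul (hv.law_im l) (-w.im)
  have hind : IndepFun (fun ω => w.re * (v l ω).re) (fun ω => -w.im * (v l ω).im) P :=
    (hv.indep_re_im l).comp (measurable_const_mul w.re) (measurable_const_mul (-w.im))
  rw [h1, gaussianReal_add_gaussianReal_of_indepFun hind hr.map_eq hi.map_eq]
  congr 1
  · simp
  · ext
    push_cast
    rw [← Complex.normSq_eq_norm_sq, Complex.normSq_apply]
    simp
    ring

/-- A real linear combination of the coefficients is a centred Gaussian variable. -/
theorem GaussianCoeffs.map_linComb [IsProbabilityMeasure P] (hv : GaussianCoeffs v P)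
    (S : Finset (Fin 2 → ℤ)) (w : (Fin 2 → ℤ) → ℂ) :
    P.map (linComb v S w) = gaussianReal 0 (∑ l ∈ S, ‖w l‖₊ ^ 2) := by
  classical
  induction S using Finset.induction_on with
  | empty =>
    have : linComb v ∅ w = fun _ => (0 : ℝ) := by
      funext ω
      simp [linComb]
    rw [this]
    simp
  | insert l S hl ih =>
    have hind : iIndepFun (fun l ω => (w l * v l ω).re) P :=
      hv.indep.comp (fun l z => (w l * z).re)
        fun l => Complex.measurable_re.comp (measurable_const_mul (w l))
    have hm : ∀ l, Measurable fun ω => (w l * v l ω).re := fun l =>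
      Complex.measurable_re.comp ((measurable_const.mul (hv.meas l)))
    have h2 := hind.indepFun_finsetSum_of_notMem hm hl
    have h3 : ∑ j ∈ S, (fun ω => (w j * v j ω).re) = linComb v S w := by
      funext ω
      simp [linComb]
    rw [h3] at h2
    have h4 : linComb v (insert l S) w = linComb v S w + fun ω => (w l * v l ω).re := by
      funext ω
      simp only [linComb, Finset.sum_insert hl, Pi.add_apply]
      ring
    rw [h4, gaussianReal_add_gaussianReal_of_indepFun h2 ih (hv.map_re_mul l (w l)),
      Finset.sum_insert hl, add_zero, add_comm]

theorem integral_cexp_of_map_eq {X : Ω → ℝ} (hX : AEMeasurable X P) {s : NNReal}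
    (h : P.map X = gaussianReal 0 s) :
    ∫ ω, Complex.exp ((X ω : ℂ) * Complex.I) ∂P = Complex.exp (-(s : ℂ) / 2) := by
  have h1 := charFun_gaussianReal (μ := 0) (v := s) 1
  rw [← h, charFun_apply_real, integral_map hX (by fun_prop)] at h1
  simpa [neg_div] using h1

theorem GaussianCoeffs.integral_cexp_linComb [IsProbabilityMeasure P] (hv : GaussianCoeffs v P)
    (S : Finset (Fin 2 → ℤ)) (w : (Fin 2 → ℤ) → ℂ) :
    ∫ ω, Complex.exp ((linComb v S w ω : ℂ) * Complex.I) ∂P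
      = Complex.exp (-((∑ l ∈ S, ‖w l‖ ^ 2 : ℝ) : ℂ) / 2) := by
  rw [integral_cexp_of_map_eq (hv.measurable_linComb S w).aemeasurable (hv.map_linComb S w)]
  push_cast
  rfl

theorem GaussianCoeffs.memLp_linComb [IsProbabilityMeasure P] (hv : GaussianCoeffs v P)
    (S : Finset (Fin 2 → ℤ)) (w : (Fin 2 → ℤ) → ℂ) : MemLp (linComb v S w) 2 P := by
  have h := memLp_id_gaussianReal' (μ := 0) (v := ∑ l ∈ S, ‖w l‖₊ ^ 2) 2 (by simp)
  rw [← hv.map_linComb S w] at h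
  exact h.comp_of_map (hv.measurable_linComb S w).aemeasurable

theorem norm_sq_eq_integral_sq (f : Lp ℝ 2 P) : ‖f‖ ^ 2 = ∫ ω, f ω ^ 2 ∂P := by
  rw [← real_inner_self_eq_norm_sq, L2.inner_def]
  refine integral_congr_ae (Filter.Eventually.of_forall fun ω => ?_)
  simp [pow_two]

theorem GaussianCoeffs.norm_sq_eq [IsProbabilityMeasure P] (hv : GaussianCoeffs v P)
    {S : Finset (Fin 2 → ℤ)} {w : (Fin 2 → ℤ) → ℂ} {f : Lp ℝ 2 P} (hf : f =ᵐ[P] linComb v S w) :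
    ‖f‖ ^ 2 = ∑ l ∈ S, ‖w l‖ ^ 2 := by
  have hm := (hv.measurable_linComb S w).aemeasurable (μ := P)
  have h0 : ∫ ω, linComb v S w ω ∂P = 0 := by
    have := integral_map (f := fun x : ℝ => x) hm (by fun_prop)
    rw [← this, hv.map_linComb S w, integral_id_gaussianReal]
  have h1 : Var[linComb v S w; P] = ∑ l ∈ S, ‖w l‖ ^ 2 := by
    have := variance_id_map hm
    rw [← this, hv.map_linComb S w, variance_id_gaussianReal]
    push_cast
    rfl
  rw [norm_sq_eq_integral_sq, ← h1, variance_of_integral_eq_zero hm h0]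
  refine integral_congr_ae ?_
  filter_upwards [hf] with ω hω
  rw [hω]

theorem generator_ae_eq_linComb (l m : Fin 2 → ℤ) (z u : ℂ) (c₁ c₂ : ℝ) {f : Lp ℝ 2 P} (hf : ∀ᵐ ω ∂P, ((f ω : ℝ) : ℂ) =
      c₁ * (z * coeffRe v l ω + conj z * coeffRe v (-l) ω) +
      c₂ * (u * coeffIm v m ω + conj u * coeffIm v (-m) ω)) :
    f =ᵐ[P] fun ω => linComb v {l} (fun _ => c₁ * z) ω + linComb v {-l} (fun _ => c₁ * conj z) ω
      + linComb v {m} (fun _ => -Complex.I * c₂ * u) ω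
      + linComb v {-m} (fun _ => -Complex.I * c₂ * conj u) ω := by
  filter_upwards [hf] with ω hω
  have h1 := congrArg Complex.re hω
  rw [Complex.ofReal_re] at h1
  rw [h1]
  simp only [coeffRe, coeffIm, linComb, Finset.sum_singleton, neg_neg]
  have hI : ∀ a : ℂ, a / (2 * Complex.I) = a * (-Complex.I / 2) := by
    intro a
    field_simp
    simp
  simp only [hI]
  simp [Complex.mul_re, Complex.mul_im]
  ring

theorem exists_linComb_of_mem_span {f : Lp ℝ 2 P}
    (hf : f ∈ Submodule.span ℝ {f : Lp ℝ 2 P | ∃ (l m : Fin 2 → ℤ) (z u : ℂ) (c₁ c₂ : ℝ),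
      ∀ᵐ ω ∂P, ((f ω : ℝ) : ℂ) =
        c₁ * (z * coeffRe v l ω + conj z * coeffRe v (-l) ω) +
        c₂ * (u * coeffIm v m ω + conj u * coeffIm v (-m) ω)}) :
    ∃ S w, f =ᵐ[P] linComb v S w := by
  induction hf using Submodule.span_induction with
  | mem f hf =>
    obtain ⟨l, m, z, u, c₁, c₂, h⟩ := hf
    have h1 := generator_ae_eq_linComb l m z u c₁ c₂ h
    obtain ⟨T, a, hT⟩ := exists_linComb_add v {l} {-l} (fun _ => c₁ * z)
      (fun _ => c₁ * conj z)
    obtain ⟨T', a', hT'⟩ := exists_linComb_add v T {m} a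
      (fun _ => -Complex.I * c₂ * u)
    obtain ⟨T'', a'', hT''⟩ := exists_linComb_add v T' {-m} a'
      (fun _ => -Complex.I * c₂ * conj u)
    refine ⟨T'', a'', h1.trans (Filter.Eventually.of_forall fun ω => ?_)⟩
    simp only [hT, hT', hT'']
  | zero =>
    refine ⟨∅, 0, (Lp.coeFn_zero ℝ 2 P).trans (Filter.Eventually.of_forall fun ω => ?_)⟩
    simp [linComb]
  | add f g _ _ hf hg =>
    obtain ⟨S, w, hf⟩ := hf
    obtain ⟨S', w', hg⟩ := hg
    obtain ⟨T, a, hT⟩ := exists_linComb_add v S S' w w'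
    refine ⟨T, a, ?_⟩
    filter_upwards [Lp.coeFn_add f g, hf, hg] with ω h1 h2 h3
    rw [h1, Pi.add_apply, h2, h3, hT]
  | smul c f _ hf =>
    obtain ⟨S, w, hf⟩ := hf
    refine ⟨S, fun l => c * w l, ?_⟩
    filter_upwards [Lp.coeFn_smul c f, hf] with ω h1 h2
    rw [h1, Pi.smul_apply, h2, linComb, linComb, smul_eq_mul, Finset.mul_sum]
    exact Finset.sum_congr rfl fun l _ => by rw [mul_assoc, Complex.re_ofReal_mul]

theorem norm_cexp_sub_cexp_le (a b : ℝ) :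
    ‖Complex.exp ((a : ℂ) * Complex.I) - Complex.exp ((b : ℂ) * Complex.I)‖ ≤ |a - b| := by
  have h : Complex.exp ((a : ℂ) * Complex.I) - Complex.exp ((b : ℂ) * Complex.I)
      = Complex.exp ((b : ℂ) * Complex.I) * (Complex.exp (Complex.I * ((a - b : ℝ) : ℂ)) - 1) := by
    rw [mul_sub, mul_one, ← Complex.exp_add]
    congr 2
    push_cast
    ring
  rw [h, norm_mul, Complex.norm_exp_ofReal_mul_I, one_mul]
  exact Real.norm_exp_I_mul_ofReal_sub_one_le

theorem continuous_integral_cexp [IsProbabilityMeasure P] :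
    Continuous fun f : Lp ℝ 2 P => ∫ ω, Complex.exp ((f ω : ℂ) * Complex.I) ∂P := by
  have hint : ∀ f : Lp ℝ 2 P, Integrable (fun ω => Complex.exp ((f ω : ℂ) * Complex.I)) P := by
    intro f
    refine Integrable.of_bound (C := 1) ?_ (Filter.Eventually.of_forall fun ω => ?_)
    · have : Continuous fun t : ℝ => Complex.exp ((t : ℂ) * Complex.I) := by fun_prop
      exact this.comp_aestronglyMeasurable (Lp.aestronglyMeasurable f)
    · rw [Complex.norm_exp_ofReal_mul_I]
  refine LipschitzWith.continuous (K := 1) (LipschitzWith.of_dist_le_mul fun f g => ?_)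
  rw [dist_eq_norm, dist_eq_norm, NNReal.coe_one, one_mul, ← integral_sub (hint f) (hint g)]
  have hfg : MemLp (fun ω => f ω - g ω) 2 P := (Lp.memLp f).sub (Lp.memLp g)
  have hnorm : ‖f - g‖ = (eLpNorm (fun ω => f ω - g ω) 2 P).toReal := by
    rw [Lp.norm_def]
    exact congrArg _ (eLpNorm_congr_ae (Lp.coeFn_sub f g))
  calc ‖∫ ω, (Complex.exp ((f ω : ℂ) * Complex.I) - Complex.exp ((g ω : ℂ) * Complex.I)) ∂P‖
      ≤ ∫ ω, |f ω - g ω| ∂P := by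
        refine norm_integral_le_of_norm_le (hfg.integrable (by norm_num)).abs
          (Filter.Eventually.of_forall fun ω => norm_cexp_sub_cexp_le _ _)
    _ = (eLpNorm (fun ω => f ω - g ω) 1 P).toReal := by
        rw [eLpNorm_one_eq_lintegral_enorm, integral_eq_lintegral_of_nonneg_ae
          (Filter.Eventually.of_forall fun _ => abs_nonneg _) hfg.abs.1]
        congr 1
        refine lintegral_congr fun ω => ?_
        rw [Real.enorm_eq_ofReal_abs]
    _ ≤ ‖f - g‖ := by
        rw [hnorm]
        exact ENNReal.toReal_mono hfg.2.ne
          (eLpNorm_le_eLpNorm_of_exponent_le (by norm_num) hfg.1)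

/-- Every element of the Gaussian space has the characteristic function of a centred Gaussian
variable, since this property passes to limits in `L²`. -/
theorem GaussianCoeffs.integral_cexp_of_mem [IsProbabilityMeasure P] (hv : GaussianCoeffs v P)
    {f : Lp ℝ 2 P} (hf : f ∈ gaussianSpace v P) :
    ∫ ω, Complex.exp ((f ω : ℂ) * Complex.I) ∂P = Complex.exp (-(‖f‖ ^ 2 : ℝ) / 2) := by
  have hcl : IsClosed {f : Lp ℝ 2 P | ∫ ω, Complex.exp ((f ω : ℂ) * Complex.I) ∂P
      = Complex.exp (-(‖f‖ ^ 2 : ℝ) / 2)} :=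
    isClosed_eq continuous_integral_cexp (by fun_prop)
  rw [gaussianSpace, ← SetLike.mem_coe, Submodule.topologicalClosure_coe] at hf
  refine closure_minimal ?_ hcl hf
  intro g hg
  obtain ⟨S, w, h⟩ := exists_linComb_of_mem_span hg
  change _ = _
  rw [hv.norm_sq_eq h, ← hv.integral_cexp_linComb]
  refine integral_congr_ae ?_
  filter_upwards [h] with ω hω
  rw [hω]

theorem re_mul_mem_gaussianSpace (l : Fin 2 → ℤ) (w : ℂ)
    {f : Lp ℝ 2 P} (hf : f =ᵐ[P] fun ω => (w * v l ω).re) : f ∈ gaussianSpace v P := by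
  -- `v_l = a_l + i â_l`, and `w a_l + w̄ a_{-l} = 2 Re (w a_l)` since `a_{-l}` is conjugate to `a_l`.
  refine Submodule.le_topologicalClosure _ (Submodule.subset_span
    ⟨l, l, w / 2, Complex.I * w / 2, 1, 1, ?_⟩)
  filter_upwards [hf] with ω hω
  rw [hω]
  simp only [coeffRe, coeffIm, neg_neg, Complex.re_eq_add_conj, map_mul, map_div₀, Complex.conj_I,
    map_ofNat]
  field_simp
  push_cast
  ring

theorem GaussianCoeffs.linComb_mem_gaussianSpace [IsProbabilityMeasure P] (hv : GaussianCoeffs v P)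
    (S : Finset (Fin 2 → ℤ)) (w : (Fin 2 → ℤ) → ℂ) {f : Lp ℝ 2 P}
    (hf : f =ᵐ[P] linComb v S w) : f ∈ gaussianSpace v P := by
  have hm : ∀ l, MemLp (fun ω => (w l * v l ω).re) 2 P := by
    intro l
    have e : linComb v {l} w = fun ω => (w l * v l ω).re := by
      funext ω
      simp only [linComb, Finset.sum_singleton]
    exact e ▸ hv.memLp_linComb {l} w
  have : f = ∑ l ∈ S, (hm l).toLp _ := by
    apply Lp.ext
    have h1 : ∀ᵐ ω ∂P, ∀ l ∈ S, (hm l).toLp _ ω = (w l * v l ω).re :=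
      (Finset.eventually_all S).2 fun l _ => (hm l).coeFn_toLp
    filter_upwards [hf, h1, Lp.coeFn_finsetSum S fun l => (hm l).toLp _] with ω h2 h3 h4
    rw [h2, h4, linComb, Finset.sum_apply]
    exact Finset.sum_congr rfl fun l hl => (h3 l hl).symm
  rw [this]
  exact Submodule.sum_mem _ fun l _ =>
    re_mul_mem_gaussianSpace l (w l) (hm l).coeFn_toLp

end GaussianSpace

/-! ### Gaussian vectors and orthogonality of the chaoses -/

section GaussianVectors

variable {ι κ : Type*} [Fintype ι] [Fintype κ]

theorem dual_pi_apply [DecidableEq ι] (L : StrongDual ℝ (ι → ℝ)) (z : ι → ℝ) :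
    L z = ∑ i, L (Pi.single i 1) * z i := by
  conv_lhs => rw [pi_eq_sum_univ' z, map_sum]
  refine Finset.sum_congr rfl fun i _ => ?_
  rw [map_smul, smul_eq_mul, mul_comm]

/-- A random vector is standard Gaussian once its characteristic function is. -/
theorem map_eq_gaussPi_of_integral_cexp {Ω : Type*} [MeasurableSpace Ω] {P : Measure Ω}
    [IsProbabilityMeasure P] {Z : Ω → ι → ℝ} (hZ : AEMeasurable Z P)
    (h : ∀ a : ι → ℝ, ∫ ω, Complex.exp (((∑ i, a i * Z ω i : ℝ) : ℂ) * Complex.I) ∂P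
      = Complex.exp (-((∑ i, a i ^ 2 : ℝ) : ℂ) / 2)) :
    P.map Z = gaussPi ι := by
  classical
  have : IsProbabilityMeasure (P.map Z) := Measure.isProbabilityMeasure_map hZ
  refine charFunDual_eq_pi_iff.1 fun L => ?_
  rw [charFunDual_apply, integral_map hZ (by fun_prop)]
  have h0 := h fun i => L (Pi.single i 1)
  simp only [← dual_pi_apply L] at h0
  rw [h0]
  have h1 : ∀ i, charFunDual (gaussianReal 0 1) (L ∘SL ContinuousLinearMap.single ℝ (fun _ => ℝ) i)
      = Complex.exp (-((L (Pi.single i 1) ^ 2 : ℝ) : ℂ) / 2) := by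
    intro i
    have h2 := charFun_gaussianReal (μ := 0) (v := 1) (L (Pi.single i 1))
    rw [charFun_apply_real] at h2
    rw [charFunDual_apply]
    have h3 : ∀ t : ℝ, (L ∘SL ContinuousLinearMap.single ℝ (fun _ => ℝ) i) t
        = L (Pi.single i 1) * t := by
      intro t
      have : (Pi.single i t : ι → ℝ) = t • Pi.single i 1 := by
        rw [← Pi.single_smul, smul_eq_mul, mul_one]
      simp only [ContinuousLinearMap.comp_apply, ContinuousLinearMap.single_apply]
      rw [this, map_smul, smul_eq_mul, mul_comm]
    simp only [h3, Complex.ofReal_mul]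
    rw [h2]
    congr 1
    push_cast
    ring
  simp only [h1]
  rw [← Complex.exp_sum]
  congr 1
  push_cast
  rw [← Finset.sum_div, ← Finset.sum_neg_distrib]

/-- The Mehler formula, integrated against a function of the other coordinates of a vector one
block of which is standard Gaussian. -/
theorem integral_prod_mul_hermProd {μ : Measure (κ → ℝ)} [IsProbabilityMeasure μ] (e : ι → κ)
    (he : μ.map (fun z i => z (e i)) = gaussPi ι) {r s : ℝ} (hrs : r ^ 2 + s ^ 2 = 1)
    (p : ι → ℕ) {F : (κ → ℝ) → ℝ}
    (hF : Integrable (fun z : (κ → ℝ) × (κ → ℝ) =>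
      F z.1 * hermProd p (fun i => r * z.1 (e i) + s * z.2 (e i))) (μ.prod μ)) :
    ∫ z, F z.1 * hermProd p (fun i => r * z.1 (e i) + s * z.2 (e i)) ∂(μ.prod μ)
      = r ^ (∑ i, p i) * ∫ a, F a * hermProd p (fun i => a (e i)) ∂μ := by
  rw [integral_prod _ hF, ← integral_const_mul]
  refine integral_congr_ae (Filter.Eventually.of_forall fun a => ?_)
  simp only
  rw [integral_const_mul]
  have h1 := integral_hermProd_add hrs p fun i => a (e i)
  have hc : Continuous fun g : ι → ℝ => hermProd p fun i => r * a (e i) + s * g i :=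
    (continuous_hermProd p).comp (by fun_prop)
  rw [← he, integral_map (Measurable.aemeasurable (by fun_prop)) hc.aestronglyMeasurable] at h1
  rw [h1]
  ring

/-- Hermite products of different total degrees in two blocks of a centred Gaussian vector are
orthogonal. Both `c ^ q` and `c ^ q'` times the integral equal the integral of `f (a) h (c a + s b)`
for an independent copy `b` of the vector `a`: the first by the Mehler formula, the second by
invariance of the law of `(a, b)` under rotations. -/
theorem integral_hermProd_mul_hermProd_of_rotation {ι' : Type*} [Fintype ι']
    {μ : Measure (κ → ℝ)} [IsProbabilityMeasure μ]
    (hrot : ∀ θ : ℝ, (μ.prod μ).map (ContinuousLinearMap.rotation θ) = μ.prod μ)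
    (e : ι → κ) (he : μ.map (fun z i => z (e i)) = gaussPi ι)
    (e' : ι' → κ) (he' : μ.map (fun z i => z (e' i)) = gaussPi ι')
    (p : ι → ℕ) (p' : ι' → ℕ) (hne : ∑ i, p i ≠ ∑ i, p' i) :
    ∫ z, hermProd p (fun i => z (e i)) * hermProd p' (fun i => z (e' i)) ∂μ = 0 := by
  set f : (κ → ℝ) → ℝ := fun z => hermProd p (fun i => z (e i)) with hf
  set h : (κ → ℝ) → ℝ := fun z => hermProd p' (fun i => z (e' i)) with hh
  have hmp : MeasurePreserving (fun z : κ → ℝ => fun i => z (e i)) μ (gaussPi ι) :=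
    ⟨by fun_prop, he⟩
  have hmp' : MeasurePreserving (fun z : κ → ℝ => fun i => z (e' i)) μ (gaussPi ι') :=
    ⟨by fun_prop, he'⟩
  have hf2 : MemLp f 2 μ := (hasMoments_hermProd p).memLp_two.comp_measurePreserving hmp
  have hh2 : MemLp h 2 μ := (hasMoments_hermProd p').memLp_two.comp_measurePreserving hmp'
  have hR : ∀ θ : ℝ, MeasurePreserving (ContinuousLinearMap.rotation (E := κ → ℝ) θ)
      (μ.prod μ) (μ.prod μ) := fun θ => ⟨(ContinuousLinearMap.continuous _).measurable, hrot θ⟩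
  have hfst : MeasurePreserving (Prod.fst : (κ → ℝ) × (κ → ℝ) → κ → ℝ) (μ.prod μ) μ :=
    measurePreserving_fst
  have key : ∀ {g g' : (κ → ℝ) → ℝ}, MemLp g 2 μ → MemLp g' 2 μ → ∀ θ,
      Integrable (fun z : (κ → ℝ) × (κ → ℝ) =>
        g z.1 * g' (ContinuousLinearMap.rotation θ z).1) (μ.prod μ) := by
    intro g g' hg hg' θ
    exact (hg.comp_measurePreserving hfst).integrable_mul
      ((hg'.comp_measurePreserving hfst).comp_measurePreserving (hR θ))
  have hcs : ∀ θ : ℝ, Real.cos θ ^ 2 + Real.sin θ ^ 2 = 1 := Real.cos_sq_add_sin_sq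
  -- Any angle with `cos θ` different from `0` and `±1` would do.
  set θ : ℝ := Real.pi / 3
  have h1 := integral_prod_mul_hermProd e' he' (hcs θ) p' (F := f) (by
    have := key hf2 hh2 θ
    simpa only [ContinuousLinearMap.rotation_apply, hh, Pi.add_apply, Pi.smul_apply,
      smul_eq_mul] using this)
  have h2 := integral_prod_mul_hermProd e he (hcs (-θ)) p (F := h) (by
    have := key hh2 hf2 (-θ)
    simpa only [ContinuousLinearMap.rotation_apply, hf, Pi.add_apply, Pi.smul_apply,
      smul_eq_mul] using this)
  have h3 : ∫ z : (κ → ℝ) × (κ → ℝ),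
        f z.1 * hermProd p' (fun i => Real.cos θ * z.1 (e' i) + Real.sin θ * z.2 (e' i))
          ∂(μ.prod μ)
      = ∫ z : (κ → ℝ) × (κ → ℝ),
        h z.1 * hermProd p (fun i => Real.cos (-θ) * z.1 (e i) + Real.sin (-θ) * z.2 (e i))
          ∂(μ.prod μ) := by
    conv_rhs => rw [← hrot θ, integral_map (hR θ).aemeasurable (by
      have := (key hh2 hf2 (-θ)).aestronglyMeasurable
      rw [hrot θ]
      simpa only [ContinuousLinearMap.rotation_apply, hf, Pi.add_apply, Pi.smul_apply,
        smul_eq_mul] using this)]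
    refine integral_congr_ae (Filter.Eventually.of_forall fun z => ?_)
    simp only [ContinuousLinearMap.rotation_apply, hf, hh, Pi.add_apply, Pi.smul_apply,
        smul_eq_mul, Real.cos_neg, Real.sin_neg]
    rw [mul_comm]
    congr 2
    funext i
    linear_combination (-z.1 (e i)) * Real.cos_sq_add_sin_sq θ
  rw [h1, h2, Real.cos_neg] at h3
  have h4 : ∫ a, h a * hermProd p (fun i => a (e i)) ∂μ
      = ∫ a, f a * hermProd p' (fun i => a (e' i)) ∂μ :=
    integral_congr_ae (Filter.Eventually.of_forall fun a => mul_comm _ _)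
  rw [h4] at h3
  have h5 : Real.cos θ = 1 / 2 := Real.cos_pi_div_three
  have h6 : Real.cos θ ^ (∑ i, p' i) ≠ Real.cos θ ^ (∑ i, p i) := by
    rw [h5]
    intro h7
    exact hne (pow_right_injective₀ (by norm_num) (by norm_num) h7).symm
  have h8 : (Real.cos θ ^ (∑ i, p' i) - Real.cos θ ^ (∑ i, p i))
      * ∫ a, f a * hermProd p' (fun i => a (e' i)) ∂μ = 0 := by
    rw [sub_mul, h3, sub_self]
  exact (mul_eq_zero.1 h8).resolve_left (sub_ne_zero.2 h6)

variable {Ω : Type*} [MeasurableSpace Ω] {P : Measure Ω} {v : (Fin 2 → ℤ) → Ω → ℂ}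

theorem aemeasurable_pi_Lp (ξ : κ → Lp ℝ 2 P) : AEMeasurable (fun ω j => ξ j ω) P :=
  aemeasurable_pi_lambda _ fun j => (Lp.aestronglyMeasurable (ξ j)).aemeasurable

theorem GaussianCoeffs.map_eq_gaussianReal_of_mem [IsProbabilityMeasure P]
    (hv : GaussianCoeffs v P) {f : Lp ℝ 2 P} (hf : f ∈ gaussianSpace v P) :
    P.map f = gaussianReal 0 (‖f‖₊ ^ 2) := by
  have hm : AEMeasurable f P := (Lp.aestronglyMeasurable f).aemeasurable
  have : IsProbabilityMeasure (P.map f) := Measure.isProbabilityMeasure_map hm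
  refine Measure.ext_of_charFun (funext fun t => ?_)
  rw [charFun_gaussianReal, charFun_apply_real, integral_map hm (by fun_prop)]
  have h1 := hv.integral_cexp_of_mem (Submodule.smul_mem _ t hf)
  have h2 : ∫ ω, Complex.exp ((((t • f : Lp ℝ 2 P) ω : ℝ) : ℂ) * Complex.I) ∂P
      = ∫ ω, Complex.exp ((t : ℂ) * (f ω : ℝ) * Complex.I) ∂P := by
    refine integral_congr_ae ?_
    filter_upwards [Lp.coeFn_smul t f] with ω hω
    rw [hω, Pi.smul_apply, smul_eq_mul]
    push_cast
    rfl
  rw [← h2, h1, norm_smul, mul_pow, Real.norm_eq_abs, sq_abs]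
  congr 1
  push_cast
  ring

/-- The joint law of finitely many elements of the Gaussian space is a centred Gaussian measure,
so that two independent copies have a rotation invariant law. -/
theorem GaussianCoeffs.map_rotation [IsProbabilityMeasure P] (hv : GaussianCoeffs v P)
    (ξ : κ → Lp ℝ 2 P) (hξ : ∀ j, ξ j ∈ gaussianSpace v P) (θ : ℝ) :
    ((P.map fun ω j => ξ j ω).prod (P.map fun ω j => ξ j ω)).map (ContinuousLinearMap.rotation θ)
      = (P.map fun ω j => ξ j ω).prod (P.map fun ω j => ξ j ω) := by
  classical
  have hm := aemeasurable_pi_Lp ξ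
  have hmap : ∀ L : StrongDual ℝ (κ → ℝ), ∃ s,
      (P.map fun ω j => ξ j ω).map L = gaussianReal 0 s := by
    intro L
    have hmem : ∑ j, L (Pi.single j 1) • ξ j ∈ gaussianSpace v P :=
      Submodule.sum_mem _ fun j _ => Submodule.smul_mem _ _ (hξ j)
    refine ⟨_, Eq.trans ?_ (hv.map_eq_gaussianReal_of_mem hmem)⟩
    rw [AEMeasurable.map_map_of_aemeasurable L.continuous.measurable.aemeasurable hm]
    refine Measure.map_congr ?_
    have h1 : ∀ᵐ ω ∂P, ∀ j ∈ Finset.univ, (L (Pi.single j 1) • ξ j : Lp ℝ 2 P) ω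
        = L (Pi.single j 1) * ξ j ω :=
      (Finset.eventually_all _).2 fun j _ => Lp.coeFn_smul _ (ξ j)
    filter_upwards [h1, Lp.coeFn_finsetSum Finset.univ fun j => L (Pi.single j 1) • ξ j]
      with ω h2 h3
    rw [h3, Function.comp_apply, dual_pi_apply L, Finset.sum_apply]
    exact Finset.sum_congr rfl fun j hj => (h2 j hj).symm
  have : IsProbabilityMeasure (P.map fun ω j => ξ j ω) := Measure.isProbabilityMeasure_map hm
  have : IsGaussian (P.map fun ω j => ξ j ω) :=
    isGaussian_of_map_eq_gaussianReal fun L => ⟨0, hmap L⟩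
  refine IsGaussian.map_rotation_eq_self_of_forall_strongDual_eq_zero (fun L => ?_) θ
  obtain ⟨s, hs⟩ := hmap L
  have := integral_map (μ := P.map fun ω j => ξ j ω) (f := fun x : ℝ => x)
    L.continuous.measurable.aemeasurable (by fun_prop)
  rw [← this, hs, integral_id_gaussianReal]

theorem GaussianCoeffs.inner_generator_eq_zero [IsProbabilityMeasure P] (hv : GaussianCoeffs v P)
    {p : ι → ℕ} {ξ : ι → Lp ℝ 2 P} (hξ : ∀ j, ξ j ∈ gaussianSpace v P)
    (hlaw : HasLaw (fun ω j => ξ j ω) (gaussPi ι) P) {f : Lp ℝ 2 P}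
    (hf : ∀ᵐ ω ∂P, f ω = ∏ j, herm (p j) (ξ j ω))
    {p' : κ → ℕ} {ξ' : κ → Lp ℝ 2 P} (hξ' : ∀ j, ξ' j ∈ gaussianSpace v P)
    (hlaw' : HasLaw (fun ω j => ξ' j ω) (gaussPi κ) P) {f' : Lp ℝ 2 P}
    (hf' : ∀ᵐ ω ∂P, f' ω = ∏ j, herm (p' j) (ξ' j ω)) (hne : ∑ j, p j ≠ ∑ j, p' j) :
    inner ℝ f f' = 0 := by
  set ζ : ι ⊕ κ → Lp ℝ 2 P := Sum.elim ξ ξ' with hζ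
  have hm := aemeasurable_pi_Lp ζ
  have hmem : ∀ j, ζ j ∈ gaussianSpace v P := by
    rintro (j | j)
    · exact hξ j
    · exact hξ' j
  have : IsProbabilityMeasure (P.map fun ω j => ζ j ω) := Measure.isProbabilityMeasure_map hm
  have h := integral_hermProd_mul_hermProd_of_rotation (fun θ => hv.map_rotation ζ hmem θ)
    (Sum.inl : ι → ι ⊕ κ) (by
      rw [AEMeasurable.map_map_of_aemeasurable
        (Measurable.aemeasurable (by fun_prop)) hm]
      exact hlaw.map_eq)
    (Sum.inr : κ → ι ⊕ κ) (by
      rw [AEMeasurable.map_map_of_aemeasurable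
        (Measurable.aemeasurable (by fun_prop)) hm]
      exact hlaw'.map_eq) p p' hne
  have hc : Continuous fun z : ι ⊕ κ → ℝ =>
      hermProd p (fun i => z (Sum.inl i)) * hermProd p' fun i => z (Sum.inr i) :=
    ((continuous_hermProd p).comp (by fun_prop)).mul ((continuous_hermProd p').comp (by fun_prop))
  rw [integral_map hm hc.aestronglyMeasurable] at h
  rw [L2.inner_def, ← h]
  refine integral_congr_ae ?_
  filter_upwards [hf, hf'] with ω h1 h2
  rw [h1, h2]
  simp only [RCLike.inner_apply, conj_trivial, hζ, Sum.elim_inl, Sum.elim_inr, hermProd]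
  rw [mul_comm]

/-- Wiener chaoses of different orders are orthogonal. -/
theorem GaussianCoeffs.chaos_isOrtho [IsProbabilityMeasure P] (hv : GaussianCoeffs v P)
    {q q' : ℕ} (hne : q ≠ q') : chaos v P q ⟂ chaos v P q' := by
  rw [Submodule.isOrtho_iff_le]
  refine Submodule.topologicalClosure_minimal _ ?_ (Submodule.isClosed_orthogonal _)
  rw [Submodule.span_le]
  rintro f ⟨k, p, ξ, -, hp, hξ, hlaw, hf⟩
  rw [SetLike.mem_coe, Submodule.mem_orthogonal']
  intro g hg
  have : chaos v P q' ≤ (ℝ ∙ f)ᗮ := by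
    refine Submodule.topologicalClosure_minimal _ ?_ (Submodule.isClosed_orthogonal _)
    rw [Submodule.span_le]
    rintro f' ⟨k', p', ξ', -, hp', hξ', hlaw', hf'⟩
    rw [SetLike.mem_coe, Submodule.mem_orthogonal_singleton_iff_inner_right]
    exact hv.inner_generator_eq_zero hξ hlaw hf hξ' hlaw' hf' (by rw [hp, hp']; exact hne)
  exact Submodule.mem_orthogonal_singleton_iff_inner_right.1 (this hg)

end GaussianVectors

/-! ### Chaos expansion of integrals over the torus -/

section TorusIntegrals

variable {Ω : Type*} [MeasurableSpace Ω] {P : Measure Ω} {v : (Fin 2 → ℤ) → Ω → ℂ}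

theorem GaussianCoeffs.measurable_field (hv : GaussianCoeffs v P) (n : ℕ) :
    Measurable fun z : UnitAddTorus (Fin 2) × Ω => field v n z.1 z.2 := by
  refine measurable_pi_lambda _ fun i => ?_
  simp only [field_eq_sum]
  refine Finset.measurable_sum _ fun l _ => Complex.measurable_re.comp (Measurable.mul ?_ ?_)
  · have : Continuous fun x => fieldWeight n x i l := by
      unfold fieldWeight
      fun_prop
    exact this.measurable.comp measurable_fst
  · exact (hv.meas l).comp measurable_snd

theorem sum_mul_field {Ω : Type*} (v : (Fin 2 → ℤ) → Ω → ℂ) (n : ℕ) (x : UnitAddTorus (Fin 2))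
    (a : Fin 6 → ℝ) (ω : Ω) : ∑ i, a i * field v n x ω i
      = linComb v (freq n) (fun l => ∑ i, (a i : ℂ) * fieldWeight n x i l) ω := by
  simp only [field_eq_sum, linComb, Finset.mul_sum, Finset.sum_mul, Complex.re_sum]
  rw [Finset.sum_comm]
  refine Finset.sum_congr rfl fun l _ => Finset.sum_congr rfl fun i _ => ?_
  rw [mul_assoc, Complex.re_ofReal_mul]

theorem sum_norm_sq_fieldWeight {n : ℕ} (hn : n ∈ sumsOfTwoSquares) (hn0 : 0 < n)
    (x : UnitAddTorus (Fin 2)) (a : Fin 6 → ℝ) :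
    ∑ l ∈ freq n, ‖∑ i, (a i : ℂ) * fieldWeight n x i l‖ ^ 2 = ∑ i, a i ^ 2 := by
  have h1 : ∀ l, ‖∑ i, (a i : ℂ) * fieldWeight n x i l‖ ^ 2
      = ∑ i, ∑ j, a i * a j * (fieldWeight n x i l * conj (fieldWeight n x j l)).re := by
    intro l
    have h2 : ∀ z : ℂ, ‖z‖ ^ 2 = (z * conj z).re := by
      intro z
      rw [Complex.mul_conj, Complex.ofReal_re, Complex.normSq_eq_norm_sq]
    rw [h2, map_sum, Finset.sum_mul_sum, Complex.re_sum]
    refine Finset.sum_congr rfl fun i _ => ?_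
    rw [Complex.re_sum]
    refine Finset.sum_congr rfl fun j _ => ?_
    rw [map_mul, Complex.conj_ofReal, ← Complex.re_ofReal_mul]
    congr 1
    push_cast
    ring
  simp only [h1]
  rw [Finset.sum_comm]
  refine Finset.sum_congr rfl fun i _ => ?_
  rw [Finset.sum_comm]
  simp only [← Finset.mul_sum, sum_fieldWeight_mul_conj hn hn0, mul_ite, mul_one, mul_zero,
    Finset.sum_ite_eq, Finset.mem_univ, if_true, pow_two]

/-- At every point of the torus, the wave and its normalised derivatives form a standard Gaussian
vector. -/
theorem GaussianCoeffs.measurePreserving_field_apply [IsProbabilityMeasure P]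
    (hv : GaussianCoeffs v P) {n : ℕ} (hn : n ∈ sumsOfTwoSquares) (hn0 : 0 < n)
    (x : UnitAddTorus (Fin 2)) : MeasurePreserving (field v n x) P (gaussPi (Fin 6)) := by
  have hm : Measurable (field v n x) := (hv.measurable_field n).of_uncurry_left (f := field v n)
  refine ⟨hm, map_eq_gaussPi_of_integral_cexp hm.aemeasurable fun a => ?_⟩
  simp only [sum_mul_field]
  rw [hv.integral_cexp_linComb, sum_norm_sq_fieldWeight hn hn0]

theorem GaussianCoeffs.measurePreserving_field [IsProbabilityMeasure P]
    (hv : GaussianCoeffs v P) {n : ℕ} (hn : n ∈ sumsOfTwoSquares) (hn0 : 0 < n) :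
    MeasurePreserving (fun z : UnitAddTorus (Fin 2) × Ω => field v n z.1 z.2)
      (torusMeasure.prod P) (gaussPi (Fin 6)) := by
  refine ⟨hv.measurable_field n, Measure.ext fun A hA => ?_⟩
  rw [Measure.map_apply (hv.measurable_field n) hA,
    Measure.prod_apply (hv.measurable_field n hA)]
  have h1 : ∀ x, P (Prod.mk x ⁻¹' ((fun z : UnitAddTorus (Fin 2) × Ω => field v n z.1 z.2) ⁻¹' A))
      = gaussPi (Fin 6) A := fun x =>
    (hv.measurePreserving_field_apply hn hn0 x).measure_preimage hA.nullMeasurableSet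
  simp only [h1, lintegral_const, measure_univ, mul_one]

section SquareIntegrable

variable {X : Type*} [MeasurableSpace X] {μ : Measure X} [IsProbabilityMeasure μ]
  [IsProbabilityMeasure P]

theorem sq_integral_le {f : X → ℝ} (hf : MemLp f 2 μ) : (∫ x, f x ∂μ) ^ 2 ≤ ∫ x, f x ^ 2 ∂μ := by
  have h1 := variance_nonneg f μ
  rw [variance_eq_sub hf] at h1
  simpa using h1

theorem memLp_two_integral {g : X × Ω → ℝ} (hg : MemLp g 2 (μ.prod P)) :
    MemLp (fun ω => ∫ x, g (x, ω) ∂μ) 2 P := by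
  have hsq : Integrable (fun z => g z ^ 2) (μ.prod P) := hg.integrable_sq
  have hm : AEStronglyMeasurable (fun ω => ∫ x, g (x, ω) ∂μ) P :=
    hg.1.prod_swap.integral_prod_right'
  rw [memLp_two_iff_integrable_sq hm]
  refine hsq.integral_prod_right.mono' (hm.pow 2) ?_
  filter_upwards [hsq.prod_left_ae, hg.1.prod_swap.prodMk_left] with ω h1 h2
  rw [Real.norm_of_nonneg (sq_nonneg _)]
  exact sq_integral_le ((memLp_two_iff_integrable_sq h2).2 h1)

/-- A closed subspace of `L²` that contains all sections of a square integrable function contains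
their integral: by Fubini's theorem the latter is orthogonal to the orthogonal complement. -/
theorem integral_mem_of_forall_mem {g : X × Ω → ℝ} (hg : MemLp g 2 (μ.prod P))
    {K : Submodule ℝ (Lp ℝ 2 P)} (hK : IsClosed (K : Set (Lp ℝ 2 P)))
    (h : ∀ x, ∃ f ∈ K, f =ᵐ[P] fun ω => g (x, ω)) :
    (memLp_two_integral hg).toLp _ ∈ K := by
  have hKK : Kᗮᗮ = K := by
    rw [Submodule.orthogonal_orthogonal_eq_closure, hK.submodule_topologicalClosure_eq]
  rw [← hKK, Submodule.mem_orthogonal]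
  intro Y hY
  have hYp : MemLp (fun z : X × Ω => Y z.2) 2 (μ.prod P) :=
    (Lp.memLp Y).comp_measurePreserving measurePreserving_snd
  have hint : Integrable (fun z : X × Ω => g z * Y z.2) (μ.prod P) := hg.integrable_mul hYp
  have h1 : inner ℝ Y ((memLp_two_integral hg).toLp _) = ∫ ω, ∫ x, g (x, ω) * Y ω ∂μ ∂P := by
    rw [L2.inner_def]
    refine integral_congr_ae ?_
    filter_upwards [(memLp_two_integral hg).coeFn_toLp] with ω hω
    rw [hω, integral_mul_const]
    rfl
  rw [h1, integral_integral_swap (f := fun ω x => g (x, ω) * Y ω) hint.swap]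
  refine (integral_congr_ae (Filter.Eventually.of_forall fun x => ?_)).trans (integral_zero _ _)
  obtain ⟨f, hf, hfx⟩ := h x
  have h2 := (Submodule.mem_orthogonal' K Y).1 hY f hf
  rw [L2.inner_def] at h2
  rw [← h2]
  refine integral_congr_ae ?_
  filter_upwards [hfx] with ω hω
  rw [hω]
  rfl

end SquareIntegrable

theorem isClosed_chaos (q : ℕ) : IsClosed (chaos v P q : Set (Lp ℝ 2 P)) :=
  Submodule.isClosed_topologicalClosure _

theorem chaosProj_eq_of_mem {q : ℕ} {F S : Lp ℝ 2 P} (hS : S ∈ chaos v P q)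
    (hFS : F - S ∈ (chaos v P q)ᗮ) : chaosProj v P q F = S :=
  haveI : CompleteSpace (chaos v P q) := (isClosed_chaos q).completeSpace_coe
  Submodule.eq_starProjection_of_mem_orthogonal hS hFS

variable [IsProbabilityMeasure P] {n : ℕ}

theorem GaussianCoeffs.memLp_integral_field (hv : GaussianCoeffs v P)
    (hn : n ∈ sumsOfTwoSquares) (hn0 : 0 < n) {G : (Fin 6 → ℝ) → ℝ}
    (hG : MemLp G 2 (gaussPi (Fin 6))) :
    MemLp (fun ω => ∫ x, G (field v n x ω) ∂torusMeasure) 2 P :=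
  memLp_two_integral (hG.comp_measurePreserving (hv.measurePreserving_field hn hn0))

/-- Composition of square integrable functions on `ℝ⁶` with the field at a point. -/
def GaussianCoeffs.fieldComp (hv : GaussianCoeffs v P) (hn : n ∈ sumsOfTwoSquares) (hn0 : 0 < n)
    (x : UnitAddTorus (Fin 2)) : Lp ℝ 2 (gaussPi (Fin 6)) →ₗᵢ[ℝ] Lp ℝ 2 P :=
  Lp.compMeasurePreservingₗᵢ ℝ (field v n x) (hv.measurePreserving_field_apply hn hn0 x)

theorem GaussianCoeffs.coeFn_fieldComp (hv : GaussianCoeffs v P) (hn : n ∈ sumsOfTwoSquares)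
    (hn0 : 0 < n) (x : UnitAddTorus (Fin 2)) {G : (Fin 6 → ℝ) → ℝ}
    (hG : MemLp G 2 (gaussPi (Fin 6))) :
    hv.fieldComp hn hn0 x (hG.toLp G) =ᵐ[P] fun ω => G (field v n x ω) := by
  have hmp := hv.measurePreserving_field_apply hn hn0 x
  exact (Lp.coeFn_compMeasurePreserving _ hmp).trans
    (hmp.quasiMeasurePreserving.ae_eq_comp hG.coeFn_toLp)

theorem GaussianCoeffs.fieldComp_hermLp_mem_chaos (hv : GaussianCoeffs v P)
    (hn : n ∈ sumsOfTwoSquares) (hn0 : 0 < n) (x : UnitAddTorus (Fin 2)) (k : Fin 6 → ℕ) :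
    hv.fieldComp hn hn0 x (hermLp k) ∈ chaos v P (∑ i, k i) := by
  have hlin : ∀ i, linComb v (freq n) (fieldWeight n x i) = fun ω => field v n x ω i := by
    intro i
    funext ω
    rw [field_eq_sum]
    rfl
  have hm : ∀ i, MemLp (fun ω => field v n x ω i) 2 P := by
    intro i
    rw [← hlin i]
    exact hv.memLp_linComb _ _
  have hae : ∀ᵐ ω ∂P, ∀ i, (hm i).toLp _ ω = field v n x ω i :=
    ae_all_iff.2 fun i => (hm i).coeFn_toLp
  refine Submodule.le_topologicalClosure _ (Submodule.subset_span
    ⟨6, k, fun i => (hm i).toLp _, by norm_num, rfl, fun i => ?_, ?_, ?_⟩)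
  · refine hv.linComb_mem_gaussianSpace (freq n) (fieldWeight n x i) ?_
    rw [hlin i]
    exact (hm i).coeFn_toLp
  · have hmp := hv.measurePreserving_field_apply hn hn0 x
    refine HasLaw.congr (X := field v n x) ⟨hmp.1.aemeasurable, hmp.2⟩ ?_
    filter_upwards [hae] with ω hω
    funext i
    exact hω i
  · filter_upwards [hae, hv.coeFn_fieldComp hn hn0 x (hasMoments_hermProd k).memLp_two]
      with ω h1 h2
    simp only [h1]
    exact h2

/-- The coefficient of `hermProd k` in the Hermite expansion of `G`. -/
def hermCoeff {ι : Type*} [Fintype ι] (G : (ι → ℝ) → ℝ) (k : ι → ℕ) : ℝ :=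
  (∫ z, G z * hermProd k z ∂(gaussPi ι)) / ∏ i, ((k i)! : ℝ)

theorem GaussianCoeffs.hasSum_fieldComp (hv : GaussianCoeffs v P)
    (hn : n ∈ sumsOfTwoSquares) (hn0 : 0 < n) (x : UnitAddTorus (Fin 2)) {G : (Fin 6 → ℝ) → ℝ}
    (hG : MemLp G 2 (gaussPi (Fin 6))) :
    HasSum (fun k => hermCoeff G k • hv.fieldComp hn hn0 x (hermLp k))
      (hv.fieldComp hn hn0 x (hG.toLp G)) := by
  have h := (hasSum_hermLp hG).mapL (hv.fieldComp hn hn0 x).toContinuousLinearMap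
  simpa only [LinearIsometry.coe_toContinuousLinearMap, map_smul] using! h

theorem GaussianCoeffs.fieldComp_sub_mem_orthogonal (hv : GaussianCoeffs v P)
    (hn : n ∈ sumsOfTwoSquares) (hn0 : 0 < n) (x : UnitAddTorus (Fin 2)) {G : (Fin 6 → ℝ) → ℝ}
    (hG : MemLp G 2 (gaussPi (Fin 6))) (q : ℕ) :
    hv.fieldComp hn hn0 x (hG.toLp G)
      - ∑ k ∈ indices q, hermCoeff G k • hv.fieldComp hn hn0 x (hermLp k) ∈ (chaos v P q)ᗮ := by
  rw [Submodule.mem_orthogonal]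
  intro Y hY
  have h1 := (hv.hasSum_fieldComp hn hn0 x hG).mapL (innerSL ℝ Y)
  have h2 : HasSum (fun k => innerSL ℝ Y (hermCoeff G k • hv.fieldComp hn hn0 x (hermLp k)))
      (∑ k ∈ indices q, innerSL ℝ Y (hermCoeff G k • hv.fieldComp hn hn0 x (hermLp k))) := by
    refine hasSum_sum_of_ne_finset_zero fun k hk => ?_
    have hne : q ≠ ∑ i, k i := by
      rintro rfl
      exact hk (by simp [indices])
    rw [innerSL_apply_apply, inner_smul_right,
      Submodule.isOrtho_iff_inner_eq.1 (hv.chaos_isOrtho hne) Y hY _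
        (hv.fieldComp_hermLp_mem_chaos hn hn0 x k), mul_zero]
  have h3 := h1.unique h2
  rw [innerSL_apply_apply] at h3
  rw [inner_sub_right, h3, inner_sum, sub_eq_zero]
  rfl

theorem chaosIntegral_eq_hermProd {Ω : Type*} (v : (Fin 2 → ℤ) → Ω → ℂ) (n : ℕ)
    (k : Fin 6 → ℕ) :
    chaosIntegral v n k = fun ω => ∫ x, hermProd k (field v n x ω) ∂torusMeasure :=
  funext fun ω => chaosIntegral_eq v n k ω

theorem GaussianCoeffs.memLp_chaosIntegral (hv : GaussianCoeffs v P)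
    (hn : n ∈ sumsOfTwoSquares) (hn0 : 0 < n) (k : Fin 6 → ℕ) : MemLp (chaosIntegral v n k) 2 P := by
  rw [chaosIntegral_eq_hermProd]
  exact hv.memLp_integral_field hn hn0 (hasMoments_hermProd k).memLp_two

theorem GaussianCoeffs.toLp_chaosIntegral_mem_chaos (hv : GaussianCoeffs v P)
    (hn : n ∈ sumsOfTwoSquares) (hn0 : 0 < n) (k : Fin 6 → ℕ) :
    (hv.memLp_chaosIntegral hn hn0 k).toLp _ ∈ chaos v P (∑ i, k i) := by
  have h := integral_mem_of_forall_mem ((hasMoments_hermProd k).memLp_two.comp_measurePreserving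
    (hv.measurePreserving_field hn hn0)) (isClosed_chaos (v := v) (∑ i, k i))
    fun x => ⟨_, hv.fieldComp_hermLp_mem_chaos hn hn0 x k, hv.coeFn_fieldComp hn hn0 x _⟩
  simpa only [chaosIntegral_eq_hermProd] using! h

/-- The projections to the chaoses of the integral over the torus of a function of the field are
obtained from the Hermite expansion of the function. -/
theorem GaussianCoeffs.chaosProj_integral_field (hv : GaussianCoeffs v P)
    (hn : n ∈ sumsOfTwoSquares) (hn0 : 0 < n) {G : (Fin 6 → ℝ) → ℝ}
    (hG : MemLp G 2 (gaussPi (Fin 6))) (q : ℕ) :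
    chaosProj v P q ((hv.memLp_integral_field hn hn0 hG).toLp _)
      = ∑ k ∈ indices q, hermCoeff G k • (hv.memLp_chaosIntegral hn hn0 k).toLp _ := by
  refine chaosProj_eq_of_mem ?_ ?_
  · refine Submodule.sum_mem _ fun k hk => Submodule.smul_mem _ _ ?_
    have hq : ∑ i, k i = q := by simpa [indices] using hk
    exact hq ▸ hv.toLp_chaosIntegral_mem_chaos hn hn0 k
  · have hR : MemLp (fun z => G z - ∑ k ∈ indices q, hermCoeff G k * hermProd k z) 2
        (gaussPi (Fin 6)) := hG.sub (memLp_finsetSum _ fun k _ =>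
          (hasMoments_hermProd k).memLp_two.const_mul _)
    have h := integral_mem_of_forall_mem (hR.comp_measurePreserving
      (hv.measurePreserving_field hn hn0)) (Submodule.isClosed_orthogonal (chaos v P q))
      fun x => ⟨_, hv.fieldComp_sub_mem_orthogonal hn hn0 x hG q, by
        have h1 : ∀ᵐ ω ∂P, ∀ k ∈ indices q, (hermCoeff G k • hv.fieldComp hn hn0 x (hermLp k) :
            Lp ℝ 2 P) ω = hermCoeff G k * hermProd k (field v n x ω) := by
          refine (Finset.eventually_all _).2 fun k _ => ?_
          filter_upwards [Lp.coeFn_smul (hermCoeff G k) (hv.fieldComp hn hn0 x (hermLp k)),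
            hv.coeFn_fieldComp hn hn0 x (hasMoments_hermProd k).memLp_two] with ω h2 h3
          rw [h2, Pi.smul_apply, smul_eq_mul]
          exact congrArg _ h3
        filter_upwards [h1, Lp.coeFn_sub (hv.fieldComp hn hn0 x (hG.toLp G))
          (∑ k ∈ indices q, hermCoeff G k • hv.fieldComp hn hn0 x (hermLp k)),
          Lp.coeFn_finsetSum (indices q) fun k => hermCoeff G k • hv.fieldComp hn hn0 x (hermLp k),
          hv.coeFn_fieldComp hn hn0 x hG] with ω h2 h3 h4 h5
        rw [h3, Pi.sub_apply, h4, h5, Finset.sum_apply, Finset.sum_congr rfl h2]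
        rfl⟩
    convert! h using 1
    apply Lp.ext
    have h1 : ∀ᵐ ω ∂P, ∀ k ∈ indices q, (hermCoeff G k • (hv.memLp_chaosIntegral hn hn0 k).toLp _ :
        Lp ℝ 2 P) ω = hermCoeff G k * chaosIntegral v n k ω := by
      refine (Finset.eventually_all _).2 fun k _ => ?_
      filter_upwards [Lp.coeFn_smul (hermCoeff G k) ((hv.memLp_chaosIntegral hn hn0 k).toLp _),
        (hv.memLp_chaosIntegral hn hn0 k).coeFn_toLp] with ω h2 h3
      rw [h2, Pi.smul_apply, smul_eq_mul, h3]
    have hint : ∀ {G' : (Fin 6 → ℝ) → ℝ}, MemLp G' 2 (gaussPi (Fin 6)) →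
        ∀ᵐ ω ∂P, Integrable (fun x => G' (field v n x ω)) torusMeasure := fun hG' =>
      ((hG'.comp_measurePreserving (hv.measurePreserving_field hn hn0)).integrable
        (by norm_num)).prod_left_ae
    have hint' : ∀ᵐ ω ∂P, ∀ k ∈ indices q,
        Integrable (fun x => hermProd k (field v n x ω)) torusMeasure :=
      (Finset.eventually_all _).2 fun k _ => hint (hasMoments_hermProd k).memLp_two
    filter_upwards [h1, Lp.coeFn_sub ((hv.memLp_integral_field hn hn0 hG).toLp _)
      (∑ k ∈ indices q, hermCoeff G k • (hv.memLp_chaosIntegral hn hn0 k).toLp _),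
      Lp.coeFn_finsetSum (indices q) fun k =>
        hermCoeff G k • (hv.memLp_chaosIntegral hn hn0 k).toLp _,
      (hv.memLp_integral_field hn hn0 hG).coeFn_toLp, hint hG, hint',
      (memLp_two_integral (hR.comp_measurePreserving
        (hv.measurePreserving_field hn hn0))).coeFn_toLp] with ω h2 h3 h4 h5 h6 h7 h8
    rw [h8, h3, Pi.sub_apply, h4, h5, Finset.sum_apply, Finset.sum_congr rfl h2]
    simp only [Function.comp_apply]
    rw [integral_sub h6 (integrable_finsetSum _ fun k hk => (h7 k hk).const_mul _),
      integral_finsetSum _ fun k hk => (h7 k hk).const_mul _]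
    congr 1
    refine Finset.sum_congr rfl fun k _ => ?_
    rw [integral_const_mul, chaosIntegral_eq_hermProd]

theorem GaussianCoeffs.integral_field_mem_closure_iSup (hv : GaussianCoeffs v P)
    (hn : n ∈ sumsOfTwoSquares) (hn0 : 0 < n) {G : (Fin 6 → ℝ) → ℝ}
    (hG : MemLp G 2 (gaussPi (Fin 6))) :
    (hv.memLp_integral_field hn hn0 hG).toLp _ ∈ (⨆ q, chaos v P q).topologicalClosure := by
  refine integral_mem_of_forall_mem (hG.comp_measurePreserving (hv.measurePreserving_field hn hn0))
    (Submodule.isClosed_topologicalClosure _) fun x => ⟨_, ?_, hv.coeFn_fieldComp hn hn0 x hG⟩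
  refine (Submodule.isClosed_topologicalClosure _).mem_of_tendsto
    (hv.hasSum_fieldComp hn hn0 x hG) (Filter.Eventually.of_forall fun s => ?_)
  refine Submodule.le_topologicalClosure _ (Submodule.sum_mem _ fun k _ =>
    Submodule.smul_mem _ _ ?_)
  exact Submodule.mem_iSup_of_mem (∑ i, k i) (hv.fieldComp_hermLp_mem_chaos hn hn0 x k)

end TorusIntegrals

/-! ### Hermite coefficients of the smoothed count -/

section KernelCoefficients

open Filter Topology

theorem hasMoments_abs_det {ι : Type*} [Fintype ι] (a b c d : ι) :
    HasMoments (fun z : ι → ℝ => |z a * z b - z c * z d|) (gaussPi ι) := by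
  have h : ∀ i : ι, HasMoments (fun z : ι → ℝ => z i) (gaussPi ι) := fun i =>
    hasMoments_coord (f := fun t => t) hasMoments_id_gaussian i
  exact (((h a).mul (h b)).sub ((h c).mul (h d))).abs

theorem measurableSet_cutoff (ε : ℝ) :
    MeasurableSet {z : Fin 6 → ℝ | |z 0| ≤ ε ∧ |z 1| ≤ ε} := by
  have h : ∀ i : Fin 6, MeasurableSet {z : Fin 6 → ℝ | |z i| ≤ ε} := fun i =>
    measurableSet_le (by fun_prop) measurable_const
  exact (h 0).inter (h 1)

theorem memLp_approxKernel (ε : ℝ) : MemLp (approxKernel ε) 2 (gaussPi (Fin 6)) :=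
  ((hasMoments_abs_det 2 5 3 4).memLp_two.indicator (measurableSet_cutoff ε)).const_mul _

theorem integral_gaussPi_succ {m : ℕ} (a : ℝ → ℝ) (g : (Fin m → ℝ) → ℝ) :
    ∫ z : Fin (m + 1) → ℝ, a (z 0) * g (fun i => z i.succ) ∂(gaussPi (Fin (m + 1)))
      = (∫ t, a t ∂(gaussianReal 0 1)) * ∫ y, g y ∂(gaussPi (Fin m)) := by
  rw [← integral_prod_mul]
  have h := measurePreserving_piFinSuccAbove (fun _ : Fin (m + 1) => gaussianReal 0 1) 0
  rw [← h.integral_comp' (g := fun p : ℝ × (Fin m → ℝ) => a p.1 * g p.2)]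
  rfl

/-- The average over `[-ε, ε]` of a continuous function tends to its value at `0`. -/
theorem tendsto_average_interval {f : ℝ → ℝ} (hf : Continuous f) :
    Tendsto (fun ε : ℝ => (2 * ε)⁻¹ * ∫ t in (-ε)..ε, f t) (𝓝[>] 0) (𝓝 (f 0)) := by
  have hc : Continuous fun ε : ℝ => ∫ s in (-1 : ℝ)..1, f (ε * s) :=
    intervalIntegral.continuous_parametric_intervalIntegral_of_continuous' (by fun_prop) _ _
  have h1 : Tendsto (fun ε : ℝ => 2⁻¹ * ∫ s in (-1 : ℝ)..1, f (ε * s)) (𝓝[>] 0) (𝓝 (f 0)) := by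
    have h2 := ((hc.tendsto 0).mono_left (nhdsWithin_le_nhds (s := Set.Ioi 0))).const_mul 2⁻¹
    convert! h2 using 2
    simp
    ring
  refine h1.congr' ?_
  filter_upwards [self_mem_nhdsWithin] with ε hε
  have hε : ε ≠ 0 := ne_of_gt hε
  rw [intervalIntegral.integral_comp_mul_left _ hε, smul_eq_mul, mul_inv, mul_neg, mul_one,
    mul_assoc]

theorem beta_eq (l : ℕ) : beta l = herm l 0 / Real.sqrt (2 * Real.pi) := by
  unfold beta
  split_ifs with h
  · rfl
  · rw [herm_odd_zero (Nat.not_even_iff_odd.1 h), zero_div]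

/-- The Hermite coefficients of the normalised indicator function of `[-ε, ε]`. -/
def cutoffCoeff (ε : ℝ) (l : ℕ) : ℝ :=
  ∫ t, (2 * ε)⁻¹ * {t : ℝ | |t| ≤ ε}.indicator (herm l) t ∂(gaussianReal 0 1)

theorem tendsto_cutoffCoeff (l : ℕ) :
    Tendsto (fun ε => cutoffCoeff ε l) (𝓝[>] 0) (𝓝 (beta l)) := by
  have hc : Continuous (gaussianPDFReal 0 1) := by
    unfold gaussianPDFReal
    fun_prop
  have h := tendsto_average_interval (f := fun t => gaussianPDFReal 0 1 t * herm l t)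
    (hc.mul (continuous_herm l))
  have h0 : gaussianPDFReal 0 1 0 * herm l 0 = beta l := by
    rw [beta_eq]
    simp [gaussianPDFReal]
    ring
  rw [h0] at h
  refine h.congr' ?_
  filter_upwards [self_mem_nhdsWithin] with ε hε
  have hε : 0 < ε := hε
  have hset : {t : ℝ | |t| ≤ ε} = Set.Icc (-ε) ε := by
    ext t
    simp [abs_le]
  rw [cutoffCoeff, integral_const_mul, hset, integral_gaussianReal_eq_integral_smul one_ne_zero,
    intervalIntegral.integral_of_le (by linarith), ← integral_Icc_eq_integral_Ioc,
    ← integral_indicator measurableSet_Icc]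
  congr 2
  funext t
  by_cases ht : t ∈ Set.Icc (-ε) ε
  · simp [ht]
  · simp [ht]

theorem hermCoeff_approxKernel (E ε : ℝ) (k : Fin 6 → ℕ) :
    hermCoeff (fun z => E * approxKernel ε z) k
      = E * (cutoffCoeff ε (k 0) * cutoffCoeff ε (k 1) / ((k 0)! * (k 1)!) *
        (alpha (k 2) (k 3) (k 4) (k 5) / ((k 2)! * (k 3)! * (k 4)! * (k 5)!))) := by
  set a : ℕ → ℝ → ℝ := fun l t => (2 * ε)⁻¹ * {t : ℝ | |t| ≤ ε}.indicator (herm l) t with ha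
  set g : (Fin 4 → ℝ) → ℝ := fun z => |z 0 * z 3 - z 1 * z 2| *
      (herm (k 2) (z 0) * herm (k 3) (z 1) * herm (k 4) (z 2) * herm (k 5) (z 3)) with hg
  have h1 : ∀ z : Fin 6 → ℝ, E * approxKernel ε z * hermProd k z
      = E * (a (k 0) (z 0) * (a (k 1) (z 1) * g fun i => z i.succ.succ)) := by
    intro z
    simp only [approxKernel, hermProd, Fin.prod_univ_six, ha, hg, Set.indicator_apply,
      Set.mem_ofPred_eq]
    by_cases h0 : |z 0| ≤ ε
    · by_cases h1 : |z 1| ≤ ε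
      · simp only [h0, h1, and_self, if_true]
        change _ = E * ((2 * ε)⁻¹ * herm (k 0) (z 0) * ((2 * ε)⁻¹ * herm (k 1) (z 1) *
          (|z 2 * z 5 - z 3 * z 4| *
            (herm (k 2) (z 2) * herm (k 3) (z 3) * herm (k 4) (z 4) * herm (k 5) (z 5)))))
        have h2 : (4 * ε ^ 2)⁻¹ = (2 * ε)⁻¹ * (2 * ε)⁻¹ := by
          rw [← mul_inv]
          ring_nf
        rw [h2]
        ring
      · simp [h0, h1]
    · simp [h0]
  have h2 : ∫ z, E * approxKernel ε z * hermProd k z ∂(gaussPi (Fin 6))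
      = E * (cutoffCoeff ε (k 0) * (cutoffCoeff ε (k 1) * alpha (k 2) (k 3) (k 4) (k 5))) := by
    simp only [h1]
    rw [integral_const_mul]
    congr 1
    have h3 := integral_gaussPi_succ (m := 5) (a (k 0)) fun y => a (k 1) (y 0) * g fun i => y i.succ
    rw [integral_gaussPi_succ (m := 4) (a (k 1)) g] at h3
    exact h3
  rw [hermCoeff, h2, Fin.prod_univ_six]
  have hfac : ∀ i, ((k i)! : ℝ) ≠ 0 := fun i => by positivity
  have := hfac 0
  have := hfac 1
  have := hfac 2
  have := hfac 3
  have := hfac 4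
  have := hfac 5
  field_simp

theorem tendsto_hermCoeff_approxKernel (E : ℝ) (k : Fin 6 → ℕ) :
    Tendsto (fun ε => hermCoeff (fun z => E * approxKernel ε z) k) (𝓝[>] 0)
      (𝓝 (E * chaosCoeff k)) := by
  simp only [hermCoeff_approxKernel]
  exact ((((tendsto_cutoffCoeff (k 0)).mul (tendsto_cutoffCoeff (k 1))).div_const _).mul_const
    _).const_mul E

end KernelCoefficients

/-! ### The number of zeros and its projections -/

section NumZeros

open Filter Topology

variable {Ω : Type*} [MeasurableSpace Ω] {P : Measure Ω} {v : (Fin 2 → ℤ) → Ω → ℂ} {n : ℕ}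

theorem numZeros_eq_ncard {Ω : Type*} (v : (Fin 2 → ℤ) → Ω → ℂ) (n : ℕ) (ω : Ω) :
    numZeros v n ω = (trigPoly (freq n) (waveCoeff v n ω) ⁻¹' {0}).ncard := by
  rw [numZeros, zeroSet]
  congr 2
  ext x
  rw [Set.mem_ofPred_eq, wave_eq_trigPoly]
  rfl

theorem trigPoly_const_mul (S : Finset (Fin 2 → ℤ)) (r : ℂ) (c : (Fin 2 → ℤ) → ℂ)
    (x : UnitAddTorus (Fin 2)) : trigPoly S (fun l => r * c l) x = r * trigPoly S c x := by
  simp only [trigPoly, Finset.mul_sum, mul_assoc]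

theorem GaussianCoeffs.ae_wave_nondegenerate [IsProbabilityMeasure P] (hv : GaussianCoeffs v P)
    (hn : n ∈ sumsOfTwoSquares) :
    ∀ᵐ ω ∂P, ∀ x, trigPoly (freq n) (waveCoeff v n ω) x = 0 →
      jac (trigPoly (freq n) (derivCoeff 0 (waveCoeff v n ω)) x)
        (trigPoly (freq n) (derivCoeff 1 (waveCoeff v n ω)) x) ≠ 0 := by
  obtain ⟨l₀, hl₀⟩ := freq_nonempty hn
  have hac := map_absolutelyContinuous_of_gaussian (hv.meas l₀) (hv.law_re l₀) (hv.law_im l₀)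
    (hv.indep_re_im l₀)
  set r : ℂ := 1 / (Real.sqrt (freq n).card : ℂ) with hr
  have hr0 : r ≠ 0 := by
    have : (0 : ℝ) < (freq n).card := by exact_mod_cast Finset.card_pos.2 ⟨l₀, hl₀⟩
    have := Real.sqrt_pos.2 this
    rw [hr]
    exact one_div_ne_zero (by exact_mod_cast this.ne')
  filter_upwards [ae_nondegenerate hv.meas hv.indep (freq n) hl₀ hac] with ω hω x hx
  have h1 : waveCoeff v n ω = fun l => r * v l ω := rfl
  have h2 : ∀ j, derivCoeff j (waveCoeff v n ω) = fun l => r * derivCoeff j (fun l => v l ω) l := by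
    intro j
    funext l
    rw [h1]
    simp only [derivCoeff]
    ring
  rw [h1, trigPoly_const_mul, mul_eq_zero] at hx
  rw [h2, h2, trigPoly_const_mul, trigPoly_const_mul, jac_mul]
  exact mul_ne_zero (pow_ne_zero 2 (norm_ne_zero_iff.2 hr0)) (hω x (hx.resolve_left hr0))

theorem GaussianCoeffs.ae_zeroSet_finite [IsProbabilityMeasure P] (hv : GaussianCoeffs v P)
    (hn : n ∈ sumsOfTwoSquares) : ∀ᵐ ω ∂P, (zeroSet v n ω).Finite := by
  filter_upwards [hv.ae_wave_nondegenerate hn] with ω hω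
  have h := (eventually_encard_trigPoly_fibre_eq _ _ hω).1
  convert! h using 1
  ext x
  rw [zeroSet, Set.mem_ofPred_eq, wave_eq_trigPoly]
  rfl

/-- The smoothed counts `approxCount` as random variables. -/
def smoothCount (v : (Fin 2 → ℤ) → Ω → ℂ) (n : ℕ) (ε : ℝ) (ω : Ω) : ℝ :=
  approxCount (freq n) (waveCoeff v n ω) ε

theorem GaussianCoeffs.ae_tendsto_smoothCount [IsProbabilityMeasure P] (hv : GaussianCoeffs v P)
    (hn : n ∈ sumsOfTwoSquares) :
    ∀ᵐ ω ∂P, Tendsto (fun ε => smoothCount v n ε ω) (𝓝[>] 0) (𝓝 (numZeros v n ω)) := by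
  filter_upwards [hv.ae_wave_nondegenerate hn] with ω hω
  obtain ⟨ε₀, hε₀, h⟩ := exists_approxCount_eq_ncard _ _ hω
  refine tendsto_const_nhds.congr' ?_
  filter_upwards [Ioo_mem_nhdsGT hε₀] with ε hε
  rw [smoothCount, h ε hε.1 hε.2, numZeros_eq_ncard]

theorem smoothCount_eq {Ω : Type*} (v : (Fin 2 → ℤ) → Ω → ℂ) (hn0 : 0 < n) (ε : ℝ) :
    smoothCount v n ε
      = fun ω => ∫ x, energy n / 2 * approxKernel ε (field v n x ω) ∂torusMeasure :=
  funext fun ω => approxCount_waveCoeff v hn0 ω ε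

theorem abs_smoothCount_le {Ω : Type*} (v : (Fin 2 → ℤ) → Ω → ℂ) (n : ℕ) {ε : ℝ} (hε : 0 < ε)
    (ω : Ω) : |smoothCount v n ε ω| ≤ ((4 * n + 3) ^ 4 : ℕ) := by
  rw [smoothCount, abs_of_nonneg (approxCount_nonneg _ _ _)]
  exact approxCount_le (freq_subset_box n) _ hε

theorem GaussianCoeffs.memLp_smoothCount [IsProbabilityMeasure P] (hv : GaussianCoeffs v P)
    (hn : n ∈ sumsOfTwoSquares) (hn0 : 0 < n) (ε : ℝ) : MemLp (smoothCount v n ε) 2 P := by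
  rw [smoothCount_eq v hn0]
  exact hv.memLp_integral_field hn hn0 ((memLp_approxKernel ε).const_mul (energy n / 2))

theorem GaussianCoeffs.memLp_numZeros [IsProbabilityMeasure P] (hv : GaussianCoeffs v P)
    (hn : n ∈ sumsOfTwoSquares) (hn0 : 0 < n) : MemLp (numZeros v n) 2 P := by
  have hm : AEStronglyMeasurable (numZeros v n) P :=
    aestronglyMeasurable_of_tendsto_ae (𝓝[>] (0 : ℝ))
      (fun ε => (hv.memLp_smoothCount hn hn0 ε).1) (hv.ae_tendsto_smoothCount hn)
  refine MemLp.of_bound hm ((4 * n + 3) ^ 4 : ℕ) ?_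
  filter_upwards [hv.ae_wave_nondegenerate hn] with ω hω
  rw [numZeros_eq_ncard, Real.norm_of_nonneg (Nat.cast_nonneg _)]
  exact ncard_zeros_le (freq_subset_box n) _ hω

/-- The smoothed counts converge to the number of zeros in `L²`, by bounded convergence. -/
theorem GaussianCoeffs.tendsto_toLp_smoothCount [IsProbabilityMeasure P]
    (hv : GaussianCoeffs v P) (hn : n ∈ sumsOfTwoSquares) (hn0 : 0 < n) :
    Tendsto (fun ε => (hv.memLp_smoothCount hn hn0 ε).toLp _) (𝓝[>] 0)
      (𝓝 ((hv.memLp_numZeros hn hn0).toLp _)) := by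
  rw [tendsto_iff_norm_sub_tendsto_zero]
  set C : ℝ := (((4 * n + 3) ^ 4 : ℕ) : ℝ) with hC
  have hI : ∀ᵐ ω ∂P, |numZeros v n ω| ≤ C := by
    filter_upwards [hv.ae_wave_nondegenerate hn] with ω hω
    rw [numZeros_eq_ncard, abs_of_nonneg (Nat.cast_nonneg _)]
    exact ncard_zeros_le (freq_subset_box n) _ hω
  have h1 : Tendsto (fun ε => ∫ ω, (smoothCount v n ε ω - numZeros v n ω) ^ 2 ∂P) (𝓝[>] 0)
      (𝓝 (∫ _, (0 : ℝ) ∂P)) := by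
    refine tendsto_integral_filter_of_dominated_convergence (fun _ => (C + C) ^ 2) ?_ ?_
      (integrable_const _) ?_
    · exact Eventually.of_forall fun ε =>
        ((hv.memLp_smoothCount hn hn0 ε).1.sub (hv.memLp_numZeros hn hn0).1).pow 2
    · filter_upwards [self_mem_nhdsWithin] with ε hε
      filter_upwards [hI] with ω hω
      rw [Real.norm_of_nonneg (sq_nonneg _), ← sq_abs]
      gcongr
      exact (abs_sub _ _).trans (add_le_add (abs_smoothCount_le v n hε ω) hω)
    · filter_upwards [hv.ae_tendsto_smoothCount hn] with ω hω
      have := (hω.sub_const (numZeros v n ω)).pow 2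
      simpa using this
  rw [integral_zero] at h1
  have h2 := h1.sqrt
  rw [Real.sqrt_zero] at h2
  refine h2.congr fun ε => ?_
  rw [← Real.sqrt_sq (norm_nonneg (_ - _)), norm_sq_eq_integral_sq, ← MemLp.toLp_sub]
  congr 1
  refine integral_congr_ae ?_
  filter_upwards [((hv.memLp_smoothCount hn hn0 ε).sub (hv.memLp_numZeros hn hn0)).coeFn_toLp]
    with ω hω
  rw [hω]
  rfl

/-- The projections of the number of zeros to the chaoses are the limits of those of the smoothed
counts. -/
theorem GaussianCoeffs.chaosProj_numZeros [IsProbabilityMeasure P] (hv : GaussianCoeffs v P)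
    (hn : n ∈ sumsOfTwoSquares) (hn0 : 0 < n) (q : ℕ) :
    chaosProj v P q ((hv.memLp_numZeros hn hn0).toLp _)
      = ∑ k ∈ indices q, (energy n / 2 * chaosCoeff k) •
        (hv.memLp_chaosIntegral hn hn0 k).toLp _ := by
  have h1 := ((chaosProj v P q).continuous.tendsto _).comp (hv.tendsto_toLp_smoothCount hn hn0)
  refine tendsto_nhds_unique h1 ?_
  have h2 : ∀ ε, chaosProj v P q ((hv.memLp_smoothCount hn hn0 ε).toLp _)
      = ∑ k ∈ indices q, hermCoeff (fun z => energy n / 2 * approxKernel ε z) k •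
        (hv.memLp_chaosIntegral hn hn0 k).toLp _ := by
    intro ε
    rw [← hv.chaosProj_integral_field hn hn0 ((memLp_approxKernel ε).const_mul (energy n / 2)) q]
    congr 2
    exact smoothCount_eq v hn0 ε
  simp only [Function.comp_def, h2]
  exact tendsto_finsetSum _ fun k _ => (tendsto_hermCoeff_approxKernel _ k).smul_const _

theorem GaussianCoeffs.numZeros_mem_closure_iSup [IsProbabilityMeasure P]
    (hv : GaussianCoeffs v P) (hn : n ∈ sumsOfTwoSquares) (hn0 : 0 < n) :
    (hv.memLp_numZeros hn hn0).toLp _ ∈ (⨆ q, chaos v P q).topologicalClosure := by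
  refine (Submodule.isClosed_topologicalClosure _).mem_of_tendsto
    (hv.tendsto_toLp_smoothCount hn hn0) (Eventually.of_forall fun ε => ?_)
  have h := hv.integral_field_mem_closure_iSup hn hn0
    ((memLp_approxKernel ε).const_mul (energy n / 2))
  convert! h using 2
  exact smoothCount_eq v hn0 ε

theorem GaussianCoeffs.memLp_chaosSum [IsProbabilityMeasure P] (hv : GaussianCoeffs v P)
    (hn : n ∈ sumsOfTwoSquares) (hn0 : 0 < n) (K : Finset (Fin 6 → ℕ)) :
    MemLp (chaosSum v n K) 2 P :=
  (memLp_finsetSum _ fun k _ => (hv.memLp_chaosIntegral hn hn0 k).const_mul _).const_mul _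

theorem GaussianCoeffs.chaosProj_numZeros_eq_toLp [IsProbabilityMeasure P]
    (hv : GaussianCoeffs v P) (hn : n ∈ sumsOfTwoSquares) (hn0 : 0 < n) (q : ℕ) :
    chaosProj v P q ((hv.memLp_numZeros hn hn0).toLp _)
      = (hv.memLp_chaosSum hn hn0 (indices q)).toLp _ := by
  rw [hv.chaosProj_numZeros hn hn0]
  apply Lp.ext
  have h1 : ∀ᵐ ω ∂P, ∀ k ∈ indices q, ((energy n / 2 * chaosCoeff k) •
      (hv.memLp_chaosIntegral hn hn0 k).toLp _ : Lp ℝ 2 P) ω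
        = energy n / 2 * chaosCoeff k * chaosIntegral v n k ω := by
    refine (Finset.eventually_all _).2 fun k _ => ?_
    filter_upwards [Lp.coeFn_smul (energy n / 2 * chaosCoeff k)
      ((hv.memLp_chaosIntegral hn hn0 k).toLp _),
      (hv.memLp_chaosIntegral hn hn0 k).coeFn_toLp] with ω h2 h3
    rw [h2, Pi.smul_apply, smul_eq_mul, h3]
  filter_upwards [h1, Lp.coeFn_finsetSum (indices q) fun k => (energy n / 2 * chaosCoeff k) •
    (hv.memLp_chaosIntegral hn hn0 k).toLp _, (hv.memLp_chaosSum hn hn0 (indices q)).coeFn_toLp]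
    with ω h2 h3 h4
  rw [h3, h4, Finset.sum_apply, Finset.sum_congr rfl h2, chaosSum, Finset.mul_sum]
  exact Finset.sum_congr rfl fun k _ => by ring

/-- An element of the closed span of the chaoses is the sum of its projections. -/
theorem GaussianCoeffs.hasSum_chaosProj [IsProbabilityMeasure P] (hv : GaussianCoeffs v P)
    {F : Lp ℝ 2 P} (hF : F ∈ (⨆ q, chaos v P q).topologicalClosure) :
    HasSum (fun q => chaosProj v P q F) F := by
  have hcomp : ∀ q, CompleteSpace (chaos v P q) := fun q => (isClosed_chaos q).completeSpace_coe
  have hV : OrthogonalFamily ℝ (fun q => chaos v P q) fun q => (chaos v P q).subtypeₗᵢ := by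
    intro q q' hne f g
    exact Submodule.isOrtho_iff_inner_eq.1 (hv.chaos_isOrtho hne) f f.2 g g.2
  have hr : F ∈ LinearMap.range hV.linearIsometry.toLinearMap := by
    rw [hV.range_linearIsometry]
    simpa using hF
  obtain ⟨f, hf⟩ := hr
  have hs := hV.hasSum_linearIsometry f
  have hf' : hV.linearIsometry f = F := hf
  rw [hf'] at hs
  have hp : ∀ q, chaosProj v P q F = (f q : Lp ℝ 2 P) := by
    intro q
    refine chaosProj_eq_of_mem (f q).2 ?_
    rw [Submodule.mem_orthogonal]
    intro Y hY
    have h1 := hs.mapL (innerSL ℝ Y)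
    have h2 := hasSum_single (f := fun i => innerSL ℝ Y ((chaos v P i).subtypeₗᵢ (f i))) q
      fun i hi => Submodule.isOrtho_iff_inner_eq.1 (hv.chaos_isOrtho hi.symm) Y hY _ (f i).2
    have h3 := h1.unique h2
    rw [inner_sub_right, sub_eq_zero]
    exact h3
  simp only [hp]
  exact hs

end NumZeros

/-! ### Parity of the coefficients -/

section Parity

theorem measurePreserving_sign_gaussPi {ι : Type*} [Fintype ι] {s : ι → ℝ} (hs : ∀ i, s i ^ 2 = 1) :
    MeasurePreserving (fun (z : ι → ℝ) i => s i * z i) (gaussPi ι) (gaussPi ι) := by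
  refine measurePreserving_pi (fun _ => gaussianReal 0 1) (fun _ => gaussianReal 0 1)
    (f := fun i t => s i * t) fun i => ⟨measurable_const_mul _, ?_⟩
  rw [gaussianReal_map_const_mul, mul_zero]
  congr 1
  ext
  simp [hs i]

theorem continuous_alpha_integrand (a b c d : ℕ) : Continuous fun z : Fin 4 → ℝ =>
    |z 0 * z 3 - z 1 * z 2| * (herm a (z 0) * herm b (z 1) * herm c (z 2) * herm d (z 3)) := by
  have h : ∀ (k : ℕ) (i : Fin 4), Continuous fun z : Fin 4 → ℝ => herm k (z i) := fun k i =>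
    (continuous_herm k).comp (continuous_apply i)
  have h1 := h a 0
  have h2 := h b 1
  have h3 := h c 2
  have h4 := h d 3
  fun_prop

theorem alpha_eq_integral_comp (a b c d : ℕ) {T : (Fin 4 → ℝ) → Fin 4 → ℝ}
    (hT : MeasurePreserving T (gaussPi (Fin 4)) (gaussPi (Fin 4))) :
    alpha a b c d = ∫ z, |T z 0 * T z 3 - T z 1 * T z 2| *
      (herm a (T z 0) * herm b (T z 1) * herm c (T z 2) * herm d (T z 3)) ∂(gaussPi (Fin 4)) := by
  have h := integral_map (μ := gaussPi (Fin 4)) hT.1.aemeasurable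
    (continuous_alpha_integrand a b c d).aestronglyMeasurable
  rw [hT.map_eq] at h
  exact h

theorem herm_sign_mul {s : ℝ} (hs : s = 1 ∨ s = -1) (k : ℕ) (t : ℝ) :
    herm k (s * t) = s ^ k * herm k t := by
  rcases hs with rfl | rfl
  · simp
  · rw [neg_one_mul, herm_neg]

/-- A change of signs that leaves `|XW - YV|` unchanged multiplies the coefficients by a sign. -/
theorem alpha_eq_sign_mul (a b c d : ℕ) {s : Fin 4 → ℝ} (hs : ∀ i, s i = 1 ∨ s i = -1)
    (hdet : s 0 * s 3 = s 1 * s 2) :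
    alpha a b c d = s 0 ^ a * s 1 ^ b * s 2 ^ c * s 3 ^ d * alpha a b c d := by
  have hs2 : ∀ i, s i ^ 2 = 1 := fun i => by rcases hs i with h | h <;> rw [h] <;> norm_num
  have habs : |s 1 * s 2| = 1 := by
    rw [abs_mul]
    rcases hs 1 with h | h <;> rcases hs 2 with h' | h' <;> rw [h, h'] <;> norm_num
  have hmp := measurePreserving_sign_gaussPi hs2
  conv_lhs => rw [alpha_eq_integral_comp a b c d hmp]
  rw [alpha, ← integral_const_mul]
  refine integral_congr_ae (Filter.Eventually.of_forall fun z => ?_)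
  have h1 : s 0 * z 0 * (s 3 * z 3) - s 1 * z 1 * (s 2 * z 2)
      = (s 1 * s 2) * (z 0 * z 3 - z 1 * z 2) := by
    linear_combination (z 0 * z 3) * hdet
  simp only [h1, abs_mul (s 1 * s 2), habs, herm_sign_mul (hs _)]
  ring

theorem alpha_eq_zero_of_odd (a b c d : ℕ) {s : Fin 4 → ℝ} (hs : ∀ i, s i = 1 ∨ s i = -1)
    (hdet : s 0 * s 3 = s 1 * s 2) (hneg : s 0 ^ a * s 1 ^ b * s 2 ^ c * s 3 ^ d = -1) :
    alpha a b c d = 0 := by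
  have h := alpha_eq_sign_mul a b c d hs hdet
  rw [hneg] at h
  linarith

/-- The coefficient `α_{a,b,c,d}` vanishes unless the indices have the same parity. -/
theorem alpha_eq_zero (a b c d : ℕ) (h : ¬(a % 2 = b % 2 ∧ b % 2 = c % 2 ∧ c % 2 = d % 2)) :
    alpha a b c d = 0 := by
  have hcases : Odd (a + b) ∨ Odd (a + c) ∨ Odd (c + d) := by
    simp only [Nat.odd_iff]
    omega
  have hsign : ∀ s : Fin 4 → ℝ, (∀ i, s i = 1 ∨ s i = -1) ↔
      (s 0 = 1 ∨ s 0 = -1) ∧ (s 1 = 1 ∨ s 1 = -1) ∧ (s 2 = 1 ∨ s 2 = -1) ∧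
        (s 3 = 1 ∨ s 3 = -1) := by
    intro s
    simp [Fin.forall_fin_succ]
  rcases hcases with h | h | h
  · refine alpha_eq_zero_of_odd a b c d (s := ![-1, -1, 1, 1]) ((hsign _).2 (by simp)) (by simp) ?_
    simpa [← pow_add] using h.neg_one_pow
  · refine alpha_eq_zero_of_odd a b c d (s := ![-1, 1, -1, 1]) ((hsign _).2 (by simp)) (by simp) ?_
    simpa [← pow_add] using h.neg_one_pow
  · refine alpha_eq_zero_of_odd a b c d (s := ![1, 1, -1, -1]) ((hsign _).2 (by simp)) (by simp) ?_
    simpa [← pow_add] using h.neg_one_pow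

theorem chaosCoeff_eq_zero {m : ℕ} {k : Fin 6 → ℕ} (hk : k ∈ indices m)
    (hk' : k ∉ parityIndices m) : chaosCoeff k = 0 := by
  rw [parityIndices, Finset.mem_filter] at hk'
  by_cases h0 : Even (k 0)
  · by_cases h1 : Even (k 1)
    · have h : ¬(k 2 % 2 = k 3 % 2 ∧ k 3 % 2 = k 4 % 2 ∧ k 4 % 2 = k 5 % 2) := fun h =>
        hk' ⟨hk, h0, h1, h⟩
      rw [chaosCoeff, alpha_eq_zero _ _ _ _ h]
      simp
    · simp [chaosCoeff, beta, h1]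
  · simp [chaosCoeff, beta, h0]

variable {Ω : Type*}

theorem chaosSum_indices (v : (Fin 2 → ℤ) → Ω → ℂ) (n m : ℕ) :
    chaosSum v n (indices m) = chaosSum v n (parityIndices m) := by
  funext ω
  rw [chaosSum, chaosSum]
  congr 1
  refine (Finset.sum_subset (Finset.filter_subset _ _) fun k hk hk' => ?_).symm
  rw [chaosCoeff_eq_zero hk hk', zero_mul]

theorem sum_of_mem_indices {m : ℕ} {k : Fin 6 → ℕ} (hk : k ∈ indices m) :
    k 0 + k 1 + k 2 + k 3 + k 4 + k 5 = m := by
  have : ∑ i, k i = m := by simpa [indices] using hk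
  rwa [Fin.sum_univ_six] at this

theorem chaosSum_indices_odd (v : (Fin 2 → ℤ) → Ω → ℂ) (n q : ℕ) :
    chaosSum v n (indices (2 * q + 1)) = 0 := by
  have h : parityIndices (2 * q + 1) = ∅ := by
    rw [parityIndices, Finset.filter_eq_empty_iff]
    rintro k hk ⟨h0, h1, h2⟩
    have := sum_of_mem_indices hk
    rw [Nat.even_iff] at h0 h1
    omega
  rw [chaosSum_indices, h]
  funext ω
  simp [chaosSum]

end Parity

/-! ### The second chaos -/

section SecondChaos

theorem measurePreserving_comp_gaussPi {ι : Type*} [Fintype ι] (e : ι ≃ ι) :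
    MeasurePreserving (fun (z : ι → ℝ) i => z (e i)) (gaussPi ι) (gaussPi ι) :=
  measurePreserving_arrowCongr' (fun _ => gaussianReal 0 1) (fun _ => gaussianReal 0 1) e.symm
    (MeasurableEquiv.refl ℝ) fun _ => MeasurePreserving.id _

theorem alpha_swap (a b c d : ℕ) : alpha a b c d = alpha b a d c := by
  have hmp := measurePreserving_comp_gaussPi
    ((Equiv.swap (0 : Fin 4) 1).trans (Equiv.swap (2 : Fin 4) 3))
  rw [alpha_eq_integral_comp a b c d hmp, alpha]
  refine integral_congr_ae (Filter.Eventually.of_forall fun z => ?_)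
  change |z 1 * z 2 - z 0 * z 3| * (herm a (z 1) * herm b (z 0) * herm c (z 3) * herm d (z 2)) = _
  rw [abs_sub_comm]
  ring

theorem alpha_transpose (a b c d : ℕ) : alpha a b c d = alpha c d a b := by
  have hmp := measurePreserving_comp_gaussPi
    ((Equiv.swap (0 : Fin 4) 2).trans (Equiv.swap (1 : Fin 4) 3))
  rw [alpha_eq_integral_comp a b c d hmp, alpha]
  refine integral_congr_ae (Filter.Eventually.of_forall fun z => ?_)
  change |z 2 * z 1 - z 3 * z 0| * (herm a (z 2) * herm b (z 3) * herm c (z 0) * herm d (z 1)) = _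
  rw [abs_sub_comm, mul_comm (z 3), mul_comm (z 2)]
  ring

theorem integral_Ioi_pow_four :
    ∫ r in Set.Ioi (0 : ℝ), r ^ 4 * Real.exp (-(1 / 2) * r ^ 2)
      = 3 * ∫ r in Set.Ioi (0 : ℝ), r ^ 2 * Real.exp (-(1 / 2) * r ^ 2) := by
  have h4 := integral_rpow_mul_exp_neg_mul_rpow (p := 2) (q := 4) (b := 1 / 2) (by norm_num)
    (by norm_num) (by norm_num)
  have h2 := integral_rpow_mul_exp_neg_mul_rpow (p := 2) (q := 2) (b := 1 / 2) (by norm_num)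
    (by norm_num) (by norm_num)
  have e4 : ∀ r : ℝ, r ^ (4 : ℝ) = r ^ 4 := fun r => by exact_mod_cast Real.rpow_natCast r 4
  have e2 : ∀ r : ℝ, r ^ (2 : ℝ) = r ^ 2 := fun r => by exact_mod_cast Real.rpow_natCast r 2
  simp only [e4, e2] at h4 h2
  rw [h4, h2]
  have hg : Real.Gamma ((4 + 1) / 2) = 3 / 2 * Real.Gamma ((2 + 1) / 2) := by
    rw [← show ((2 : ℝ) + 1) / 2 = 3 / 2 by norm_num, ← Real.Gamma_add_one (by norm_num)]
    norm_num
  have hp : (1 / 2 : ℝ) ^ (-(4 + 1) / 2 : ℝ) = 2 * (1 / 2 : ℝ) ^ (-(2 + 1) / 2 : ℝ) := by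
    rw [show (-(4 + 1) / 2 : ℝ) = -(2 + 1) / 2 + (-1) by norm_num,
      Real.rpow_add (by norm_num), Real.rpow_neg_one]
    norm_num
    ring
  rw [hg, hp]
  ring

theorem integral_gaussian_prod (f : ℝ × ℝ → ℝ) :
    ∫ z, f z ∂((gaussianReal 0 1).prod (gaussianReal 0 1))
      = (2 * Real.pi)⁻¹ * ∫ z : ℝ × ℝ, Real.exp (-(1 / 2) * (z.1 ^ 2 + z.2 ^ 2)) * f z := by
  rw [gaussianReal_of_var_ne_zero 0 one_ne_zero, prod_withDensity (measurable_gaussianPDF 0 1)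
    (measurable_gaussianPDF 0 1), integral_withDensity_eq_integral_toReal_smul
    (show Measurable fun z : ℝ × ℝ => gaussianPDF 0 1 z.1 * gaussianPDF 0 1 z.2 from
      ((measurable_gaussianPDF 0 1).comp measurable_fst).mul
        ((measurable_gaussianPDF 0 1).comp measurable_snd))
    (Filter.Eventually.of_forall fun z => ENNReal.mul_lt_top gaussianPDF_lt_top
      gaussianPDF_lt_top), ← integral_const_mul, ← Measure.volume_eq_prod]
  refine integral_congr_ae (Filter.Eventually.of_forall fun z => ?_)
  simp only [ENNReal.toReal_mul, toReal_gaussianPDF, gaussianPDFReal, smul_eq_mul, sub_zero,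
    NNReal.coe_one, mul_one]
  have h1 : Real.exp (-(1 / 2) * (z.1 ^ 2 + z.2 ^ 2))
      = Real.exp (-z.1 ^ 2 / 2) * Real.exp (-z.2 ^ 2 / 2) := by
    rw [← Real.exp_add]
    congr 1
    ring
  have h2 : (2 * Real.pi)⁻¹ = (Real.sqrt (2 * Real.pi))⁻¹ * (Real.sqrt (2 * Real.pi))⁻¹ := by
    rw [← mul_inv, Real.mul_self_sqrt (by positivity)]
  rw [h1, h2]
  ring

/-- In polar coordinates, the Gaussian integral of a homogeneous function of degree one times a
power of the norm is the product of a radial and of an angular integral. -/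
theorem integral_gaussian_prod_homogeneous (w u : ℝ) (m : ℕ) :
    ∫ z : ℝ × ℝ, |z.1 * w - z.2 * u| * (z.1 ^ 2 + z.2 ^ 2) ^ m
        ∂((gaussianReal 0 1).prod (gaussianReal 0 1))
      = (2 * Real.pi)⁻¹ *
        ((∫ r in Set.Ioi (0 : ℝ), r ^ (2 * m + 2) * Real.exp (-(1 / 2) * r ^ 2)) *
          ∫ t in Set.Ioo (-Real.pi) Real.pi, |Real.cos t * w - Real.sin t * u|) := by
  rw [integral_gaussian_prod, ← integral_comp_polarCoord_symm, polarCoord_target,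
    Measure.volume_eq_prod, ← setIntegral_prod_mul]
  congr 1
  refine setIntegral_congr_fun (measurableSet_Ioi.prod measurableSet_Ioo) fun p hp => ?_
  have hr : 0 < p.1 := hp.1
  simp only [polarCoord_symm_apply, smul_eq_mul]
  have h1 : (p.1 * Real.cos p.2) ^ 2 + (p.1 * Real.sin p.2) ^ 2 = p.1 ^ 2 := by
    linear_combination p.1 ^ 2 * Real.cos_sq_add_sin_sq p.2
  have h2 : p.1 * Real.cos p.2 * w - p.1 * Real.sin p.2 * u
      = p.1 * (Real.cos p.2 * w - Real.sin p.2 * u) := by ring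
  rw [h1, h2, abs_mul, abs_of_pos hr, ← pow_mul]
  ring

/-- A four-dimensional standard Gaussian vector as a pair of two-dimensional ones. -/
theorem measurePreserving_gaussPi_four :
    MeasurePreserving (fun p : (ℝ × ℝ) × (ℝ × ℝ) => ![p.2.1, p.2.2, p.1.1, p.1.2])
      (((gaussianReal 0 1).prod (gaussianReal 0 1)).prod
        ((gaussianReal 0 1).prod (gaussianReal 0 1))) (gaussPi (Fin 4)) := by
  have hm : Measurable fun p : (ℝ × ℝ) × (ℝ × ℝ) => ![p.2.1, p.2.2, p.1.1, p.1.2] := by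
    refine measurable_pi_lambda _ fun i => ?_
    fin_cases i <;> simp <;> fun_prop
  refine ⟨hm, map_eq_gaussPi_of_integral_cexp hm.aemeasurable fun a => ?_⟩
  have h1 : ∀ t : ℝ, ∫ x, Complex.exp ((t : ℂ) * x * Complex.I) ∂(gaussianReal 0 1)
      = Complex.exp (-((t ^ 2 : ℝ) : ℂ) / 2) := by
    intro t
    rw [← charFun_apply_real, charFun_gaussianReal]
    congr 1
    push_cast
    ring
  have h2 : ∀ p : (ℝ × ℝ) × (ℝ × ℝ),
      Complex.exp (((∑ i, a i * ![p.2.1, p.2.2, p.1.1, p.1.2] i : ℝ) : ℂ) * Complex.I)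
      = (Complex.exp ((a 2 : ℂ) * p.1.1 * Complex.I) * Complex.exp ((a 3 : ℂ) * p.1.2 * Complex.I))
        * (Complex.exp ((a 0 : ℂ) * p.2.1 * Complex.I)
          * Complex.exp ((a 1 : ℂ) * p.2.2 * Complex.I)) := by
    intro p
    rw [← Complex.exp_add, ← Complex.exp_add, ← Complex.exp_add]
    congr 1
    simp [Fin.sum_univ_four]
    ring
  simp only [h2]
  rw [integral_prod_mul (fun p : ℝ × ℝ => Complex.exp ((a 2 : ℂ) * p.1 * Complex.I)
      * Complex.exp ((a 3 : ℂ) * p.2 * Complex.I))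
      (fun p : ℝ × ℝ => Complex.exp ((a 0 : ℂ) * p.1 * Complex.I)
      * Complex.exp ((a 1 : ℂ) * p.2 * Complex.I)),
    integral_prod_mul (fun x : ℝ => Complex.exp ((a 2 : ℂ) * x * Complex.I))
      (fun x : ℝ => Complex.exp ((a 3 : ℂ) * x * Complex.I)),
    integral_prod_mul (fun x : ℝ => Complex.exp ((a 0 : ℂ) * x * Complex.I))
      (fun x : ℝ => Complex.exp ((a 1 : ℂ) * x * Complex.I)),
    h1, h1, h1, h1, ← Complex.exp_add, ← Complex.exp_add, ← Complex.exp_add]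
  congr 1
  simp [Fin.sum_univ_four]
  ring

/-- Since `|XW - YV|` is homogeneous of degree one in `(X, Y)`, its second order coefficients are
half its expectation. -/
theorem alpha_two_zero : alpha 2 0 0 0 = alpha 0 0 0 0 / 2 := by
  have hmp := measurePreserving_gaussPi_four
  set γ := (gaussianReal 0 1).prod (gaussianReal 0 1) with hγ
  have hD := hasMoments_abs_det (ι := Fin 4) 0 3 1 2
  have hS : HasMoments (fun z : Fin 4 → ℝ => z 0 * z 0 + z 1 * z 1) (gaussPi (Fin 4)) := by
    have h : ∀ i : Fin 4, HasMoments (fun z : Fin 4 → ℝ => z i) (gaussPi (Fin 4)) := fun i =>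
      hasMoments_coord (f := fun t => t) hasMoments_id_gaussian i
    exact ((h 0).mul (h 0)).add ((h 1).mul (h 1))
  have key : ∫ z : Fin 4 → ℝ, |z 0 * z 3 - z 1 * z 2| * (z 0 * z 0 + z 1 * z 1) ∂(gaussPi (Fin 4))
      = 3 * ∫ z : Fin 4 → ℝ, |z 0 * z 3 - z 1 * z 2| ∂(gaussPi (Fin 4)) := by
    have hi1 := ((hD.mul hS).comp hmp).integrable
    have hi2 := (hD.comp hmp).integrable
    rw [← hmp.map_eq, integral_map hmp.1.aemeasurable
      (Continuous.aestronglyMeasurable (by fun_prop)), integral_map hmp.1.aemeasurable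
      (Continuous.aestronglyMeasurable (by fun_prop)), integral_prod _ hi1, integral_prod _ hi2,
      ← integral_const_mul]
    refine integral_congr_ae (Filter.Eventually.of_forall fun p => ?_)
    have h1 := integral_gaussian_prod_homogeneous p.2 p.1 1
    have h0 := integral_gaussian_prod_homogeneous p.2 p.1 0
    simp only [pow_one, pow_zero, mul_one, mul_zero, zero_add] at h0 h1
    rw [show 2 + 2 = 4 from rfl, integral_Ioi_pow_four] at h1
    change ∫ z : ℝ × ℝ, |z.1 * p.2 - z.2 * p.1| * (z.1 * z.1 + z.2 * z.2) ∂γ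
      = 3 * ∫ z : ℝ × ℝ, |z.1 * p.2 - z.2 * p.1| ∂γ
    simp only [← pow_two]
    rw [h1, h0]
    ring
  have e0 : alpha 0 0 0 0 = ∫ z : Fin 4 → ℝ, |z 0 * z 3 - z 1 * z 2| ∂(gaussPi (Fin 4)) := by
    simp only [alpha, herm_zero, mul_one]
  have hint : ∀ i : Fin 4, Integrable (fun z : Fin 4 → ℝ => |z 0 * z 3 - z 1 * z 2| * herm 2 (z i))
      (gaussPi (Fin 4)) := fun i => (hD.mul (hasMoments_coord (hasMoments_herm 2) i)).integrable
  have e1 : alpha 2 0 0 0 + alpha 0 2 0 0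
      = ∫ z : Fin 4 → ℝ, |z 0 * z 3 - z 1 * z 2| * (z 0 * z 0 + z 1 * z 1)
        - 2 * |z 0 * z 3 - z 1 * z 2| ∂(gaussPi (Fin 4)) := by
    simp only [alpha, herm_zero, mul_one, one_mul]
    rw [← integral_add (hint 0) (hint 1)]
    refine integral_congr_ae (Filter.Eventually.of_forall fun z => ?_)
    simp only [herm_two]
    ring
  rw [integral_sub (hD.mul hS).integrable (hD.integrable.const_mul 2), integral_const_mul, key,
    ← e0, alpha_swap 0 2 0 0] at e1
  linarith

theorem integral_mFourier (l : Fin 2 → ℤ) :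
    ∫ x, UnitAddTorus.mFourier l x ∂torusMeasure = if l = 0 then 1 else 0 := by
  have h1 : ∀ m : ℤ, ∫ t, fourier m t ∂(AddCircle.haarAddCircle : Measure UnitAddCircle)
      = if m = 0 then 1 else 0 := by
    intro m
    have h := orthonormal_iff_ite.1 (orthonormal_fourier (T := 1)) 0 m
    rw [ContinuousMap.inner_toLp] at h
    simp only [fourier_zero, map_one, mul_one] at h
    rw [h]
    simp only [eq_comm]
  have h2 := integral_fintype_prod_eq_prod (ι := Fin 2) (𝕜 := ℂ) (E := fun _ => UnitAddCircle)
    (μ := fun _ => AddCircle.haarAddCircle) (f := fun i t => fourier (l i) t)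
  change ∫ x : Fin 2 → UnitAddCircle, ∏ i, fourier (l i) (x i)
    ∂(Measure.pi fun _ => AddCircle.haarAddCircle) = _
  rw [h2]
  simp only [h1, Fin.prod_univ_two]
  have h3 : l = 0 ↔ l 0 = 0 ∧ l 1 = 0 := by
    rw [funext_iff, Fin.forall_fin_two]
    rfl
  by_cases ha : l 0 = 0 <;> by_cases hb : l 1 = 0 <;> simp [h3, ha, hb]

/-- Parseval's identity for trigonometric polynomials. -/
theorem integral_normSq_trigPoly (S : Finset (Fin 2 → ℤ)) (c : (Fin 2 → ℤ) → ℂ) :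
    ∫ x, Complex.normSq (trigPoly S c x) ∂torusMeasure = ∑ l ∈ S, Complex.normSq (c l) := by
  have hint : ∀ l, Integrable (fun x => UnitAddTorus.mFourier l x) torusMeasure := fun l =>
    Integrable.of_bound (UnitAddTorus.mFourier l).continuous.aestronglyMeasurable 1
      (Filter.Eventually.of_forall fun x =>
        ((UnitAddTorus.mFourier l).norm_coe_le_norm x).trans UnitAddTorus.mFourier_norm.le)
  have h1 : ∀ x, ((Complex.normSq (trigPoly S c x) : ℝ) : ℂ)
      = ∑ l ∈ S, ∑ m ∈ S, c l * conj (c m) * UnitAddTorus.mFourier (-m + l) x := by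
    intro x
    rw [← Complex.mul_conj, trigPoly, map_sum, Finset.sum_mul_sum]
    refine Finset.sum_congr rfl fun l _ => Finset.sum_congr rfl fun m _ => ?_
    rw [UnitAddTorus.mFourier_add, UnitAddTorus.mFourier_neg, map_mul]
    ring
  have h2 : ((∫ x, Complex.normSq (trigPoly S c x) ∂torusMeasure : ℝ) : ℂ)
      = ((∑ l ∈ S, Complex.normSq (c l) : ℝ) : ℂ) := by
    rw [← integral_complex_ofReal]
    simp only [h1]
    rw [integral_finsetSum _ fun l _ => integrable_finsetSum _ fun m _ => (hint _).const_mul _]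
    push_cast
    refine Finset.sum_congr rfl fun l hl => ?_
    rw [integral_finsetSum _ fun m _ => (hint _).const_mul _]
    simp only [integral_const_mul, integral_mFourier]
    rw [Finset.sum_eq_single l]
    · simp [Complex.mul_conj]
    · intro m _ hm
      rw [if_neg, mul_zero]
      intro h
      exact hm (neg_add_eq_zero.1 h)
    · exact fun h => absurd hl h
  exact_mod_cast h2

variable {Ω : Type*}

theorem normSq_wave (v : (Fin 2 → ℤ) → Ω → ℂ) (n : ℕ) (x : UnitAddTorus (Fin 2)) (ω : Ω) :
    field v n x ω 0 ^ 2 + field v n x ω 1 ^ 2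
      = Complex.normSq (trigPoly (freq n) (waveCoeff v n ω) x) := by
  rw [← wave_eq_trigPoly, Complex.normSq_apply]
  simp only [field, waveRe, waveIm, Matrix.cons_val_zero, Matrix.cons_val_one]
  ring

theorem normSq_deriv_wave (v : (Fin 2 → ℤ) → Ω → ℂ) {n : ℕ} (x : UnitAddTorus (Fin 2)) (ω : Ω) :
    field v n x ω 2 ^ 2 + field v n x ω 3 ^ 2 + field v n x ω 4 ^ 2 + field v n x ω 5 ^ 2
      = 2 / energy n * ∑ j, Complex.normSq
        (trigPoly (freq n) (derivCoeff j (waveCoeff v n ω)) x) := by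
  have h : ∀ i, field v n x ω i = ![waveRe v n ω x, waveIm v n ω x,
    normDeriv n 0 (waveRe v n ω) x, normDeriv n 1 (waveRe v n ω) x,
    normDeriv n 0 (waveIm v n ω) x, normDeriv n 1 (waveIm v n ω) x] i := fun _ => rfl
  have hE : Real.sqrt (2 / energy n) ^ 2 = 2 / energy n := Real.sq_sqrt (by
    unfold energy
    positivity)
  simp only [h, Matrix.cons_val, normDeriv_waveRe, normDeriv_waveIm, Fin.sum_univ_two,
    Complex.normSq_apply, mul_pow, hE]
  ring

/-- The gradient of the wave has twice the energy of the wave. -/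
theorem integral_sum_sq_deriv (v : (Fin 2 → ℤ) → Ω → ℂ) {n : ℕ} (hn0 : 0 < n) (ω : Ω) :
    ∫ x, (field v n x ω 2 ^ 2 + field v n x ω 3 ^ 2 + field v n x ω 4 ^ 2 + field v n x ω 5 ^ 2)
        ∂torusMeasure
      = 2 * ∫ x, (field v n x ω 0 ^ 2 + field v n x ω 1 ^ 2) ∂torusMeasure := by
  have hE := energy_pos hn0
  have hint : ∀ c, Integrable (fun x => Complex.normSq (trigPoly (freq n) c x)) torusMeasure := by
    intro c
    have : CompactSpace (UnitAddTorus (Fin 2)) := inferInstanceAs (CompactSpace (Fin 2 → _))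
    exact (Complex.continuous_normSq.comp (continuous_trigPoly _ c)).integrable_of_hasCompactSupport
      (HasCompactSupport.of_compactSpace _)
  simp only [normSq_wave, normSq_deriv_wave]
  rw [integral_const_mul, integral_finsetSum _ fun j _ => hint _, integral_normSq_trigPoly]
  simp only [integral_normSq_trigPoly]
  rw [Finset.sum_comm, Finset.mul_sum, Finset.mul_sum]
  refine Finset.sum_congr rfl fun l hl => ?_
  have hl' : (l 0 : ℝ) ^ 2 + (l 1 : ℝ) ^ 2 = n := by
    exact_mod_cast (mem_freq n l).1 hl
  have h1 : ∀ j, Complex.normSq (derivCoeff j (waveCoeff v n ω) l)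
      = 4 * Real.pi ^ 2 * (l j : ℝ) ^ 2 * Complex.normSq (waveCoeff v n ω l) := by
    intro j
    simp only [derivCoeff, map_mul, Complex.normSq_ofReal, Complex.normSq_I, Complex.normSq_intCast,
      Complex.normSq_ofNat]
    ring
  simp only [h1, Fin.sum_univ_two]
  rw [← add_mul, ← mul_add, hl', div_mul_eq_mul_div, div_eq_iff hE.ne', energy]
  ring

theorem hermProd_single_two {ι : Type*} [Fintype ι] [DecidableEq ι] (i : ι) (z : ι → ℝ) :
    hermProd (Pi.single i 2) z = z i ^ 2 - 1 := by
  rw [hermProd, Finset.prod_eq_single i]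
  · rw [Pi.single_eq_same, herm_two]
  · intro j _ hj
    rw [Pi.single_eq_of_ne hj, herm_zero]
  · simp

theorem chaosSum_two_eq_sum (v : (Fin 2 → ℤ) → Ω → ℂ) (n : ℕ) (ω : Ω) :
    chaosSum v n (indices 2) ω = energy n / 2 *
      ∑ i, chaosCoeff (Pi.single i 2) * chaosIntegral v n (Pi.single i 2) ω := by
  rw [chaosSum]
  congr 1
  have hinj : Set.InjOn (fun i : Fin 6 => (Pi.single i 2 : Fin 6 → ℕ)) (Finset.univ : Finset (Fin 6)) := by
    intro i _ j _ h
    by_contra hij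
    have := congrFun h i
    simp [Pi.single_eq_of_ne hij] at this
  rw [← Finset.sum_image (f := fun k => chaosCoeff k * chaosIntegral v n k ω) hinj]
  refine (Finset.sum_subset ?_ ?_).symm
  · intro k hk
    obtain ⟨i, -, rfl⟩ := Finset.mem_image.1 hk
    simp [indices]
  · intro k hk hk'
    rw [chaosCoeff_eq_zero hk, zero_mul]
    intro hp
    rw [parityIndices, Finset.mem_filter, Nat.even_iff, Nat.even_iff] at hp
    have hs := sum_of_mem_indices hk
    have hex : ∃ i, k i = 2 := by
      have : k 0 = 2 ∨ k 1 = 2 ∨ k 2 = 2 ∨ k 3 = 2 ∨ k 4 = 2 ∨ k 5 = 2 := by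
        rcases Nat.mod_two_eq_zero_or_one (k 5) with h5 | h5 <;> omega
      rcases this with h | h | h | h | h | h <;> exact ⟨_, h⟩
    obtain ⟨i, hi⟩ := hex
    refine hk' (Finset.mem_image.2 ⟨i, Finset.mem_univ _, ?_⟩)
    have he := Finset.add_sum_erase Finset.univ k (Finset.mem_univ i)
    have hsum : ∑ j, k j = 2 := by rw [Fin.sum_univ_six, hs]
    rw [hsum, hi, Nat.add_eq_left, Finset.sum_eq_zero_iff] at he
    funext j
    by_cases hj : j = i
    · rw [hj, hi, Pi.single_eq_same]
    · rw [Pi.single_eq_of_ne hj, he j (Finset.mem_erase.2 ⟨hj, Finset.mem_univ j⟩)]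

theorem chaosCoeff_single_two (i : Fin 6) : chaosCoeff (Pi.single i 2)
    = (if i = 0 ∨ i = 1 then -1 else 1 / 2) * (beta 0 ^ 2 * alpha 0 0 0 0 / 2) := by
  have hb : beta 2 = -beta 0 := by
    rw [beta_eq, beta_eq, herm_two, herm_zero]
    ring
  have h1 := alpha_two_zero
  have h2 : alpha 0 2 0 0 = alpha 0 0 0 0 / 2 := (alpha_swap 0 2 0 0).trans h1
  have h3 : alpha 0 0 2 0 = alpha 0 0 0 0 / 2 := (alpha_transpose 0 0 2 0).trans h1
  have h4 : alpha 0 0 0 2 = alpha 0 0 0 0 / 2 := (alpha_transpose 0 0 0 2).trans h2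
  fin_cases i <;>
    simp [chaosCoeff, hb, h1, h2, h3, h4] <;> ring

/-- The second chaos component vanishes identically: the contributions of the wave and of its
gradient cancel, by the Parseval identity. -/
theorem chaosSum_two_eq_zero (v : (Fin 2 → ℤ) → Ω → ℂ) {n : ℕ} (hn0 : 0 < n) (ω : Ω) :
    chaosSum v n (indices 2) ω = 0 := by
  have hcont : ∀ i, Continuous fun x => field v n x ω i := by
    intro i
    simp only [field_eq_sum]
    refine continuous_finsetSum _ fun l _ => Complex.continuous_re.comp ?_
    unfold fieldWeight
    fun_prop
  have hint : ∀ i, Integrable (fun x => field v n x ω i ^ 2) torusMeasure := by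
    intro i
    have : CompactSpace (UnitAddTorus (Fin 2)) := inferInstanceAs (CompactSpace (Fin 2 → _))
    exact ((hcont i).pow 2).integrable_of_hasCompactSupport (HasCompactSupport.of_compactSpace _)
  have h1 : ∀ i, chaosIntegral v n (Pi.single i 2) ω
      = ∫ x, field v n x ω i ^ 2 ∂torusMeasure - 1 := by
    intro i
    rw [chaosIntegral_eq_hermProd]
    simp only [hermProd_single_two]
    rw [integral_sub (hint i) (integrable_const _)]
    simp
  have h2 := integral_sum_sq_deriv v hn0 ω
  have h23 : Integrable (fun x => field v n x ω 2 ^ 2 + field v n x ω 3 ^ 2) torusMeasure :=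
    (hint 2).add (hint 3)
  have h234 : Integrable (fun x => field v n x ω 2 ^ 2 + field v n x ω 3 ^ 2
      + field v n x ω 4 ^ 2) torusMeasure := h23.add (hint 4)
  rw [integral_add h234 (hint 5), integral_add h23 (hint 4), integral_add (hint 2) (hint 3),
    integral_add (hint 0) (hint 1)] at h2
  rw [chaosSum_two_eq_sum]
  simp only [chaosCoeff_single_two, h1, Fin.sum_univ_six]
  simp
  right
  linear_combination (beta 0 ^ 2 * alpha 0 0 0 0 / 4) * h2

end SecondChaos

/-! ### Modifications on null sets and the chaotic expansion -/

section Modification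

theorem wave_congr {Ω : Type*} {v v' : (Fin 2 → ℤ) → Ω → ℂ} {ω : Ω} (h : ∀ l, v l ω = v' l ω)
    (n : ℕ) : wave v n ω = wave v' n ω := by
  funext x
  simp only [wave, h]

theorem numZeros_congr {Ω : Type*} {v v' : (Fin 2 → ℤ) → Ω → ℂ} {ω : Ω}
    (h : ∀ l, v l ω = v' l ω) (n : ℕ) : numZeros v n ω = numZeros v' n ω := by
  simp only [numZeros, zeroSet, wave_congr h]

theorem chaosSum_congr {Ω : Type*} {v v' : (Fin 2 → ℤ) → Ω → ℂ} {ω : Ω}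
    (h : ∀ l, v l ω = v' l ω) (n : ℕ) (K : Finset (Fin 6 → ℕ)) :
    chaosSum v n K ω = chaosSum v' n K ω := by
  have hre : waveRe v n ω = waveRe v' n ω := by
    funext x
    simp only [waveRe, wave_congr h]
  have him : waveIm v n ω = waveIm v' n ω := by
    funext x
    simp only [waveIm, wave_congr h]
  simp only [chaosSum, chaosIntegral, hre, him]

variable {Ω : Type*} [MeasurableSpace Ω] {P : Measure Ω} {v v' : (Fin 2 → ℤ) → Ω → ℂ}

theorem gaussianSpace_congr (h : ∀ᵐ ω ∂P, ∀ l, v l ω = v' l ω) :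
    gaussianSpace v P = gaussianSpace v' P := by
  unfold gaussianSpace
  congr 3
  ext f
  refine exists_congr fun l => exists_congr fun m => exists_congr fun z => exists_congr fun u =>
    exists_congr fun c₁ => exists_congr fun c₂ => Filter.eventually_congr ?_
  filter_upwards [h] with ω hω
  simp only [coeffRe, coeffIm, hω]

theorem chaosProj_congr (h : ∀ᵐ ω ∂P, ∀ l, v l ω = v' l ω) (q : ℕ) (F : Lp ℝ 2 P) :
    chaosProj v P q F = chaosProj v' P q F := by
  have hc : chaos v P q = chaos v' P q := by
    unfold chaos
    rw [gaussianSpace_congr h]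
  have hcomp : CompleteSpace (chaos v' P q) := (isClosed_chaos q).completeSpace_coe
  refine chaosProj_eq_of_mem ?_ ?_
  · rw [hc]
    exact Submodule.starProjection_apply_mem _ _
  · rw [hc]
    exact Submodule.sub_starProjection_mem_orthogonal _

/-- The coefficients can be modified on a null set to become measurable. -/
theorem exists_gaussianCoeffs [IsProbabilityMeasure P]
    (hre : ∀ l, HasLaw (fun ω => (v l ω).re) (gaussianReal 0 1) P)
    (him : ∀ l, HasLaw (fun ω => (v l ω).im) (gaussianReal 0 1) P)
    (hreim : ∀ l, IndepFun (fun ω => (v l ω).re) (fun ω => (v l ω).im) P)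
    (hv : iIndepFun v P) :
    ∃ v', GaussianCoeffs v' P ∧ ∀ᵐ ω ∂P, ∀ l, v l ω = v' l ω := by
  have hm : ∀ l, AEMeasurable (v l) P := by
    intro l
    have h1 := (Complex.measurable_ofReal.comp_aemeasurable (hre l).aemeasurable).add
      ((Complex.measurable_ofReal.comp_aemeasurable (him l).aemeasurable).mul_const Complex.I)
    refine h1.congr (Filter.Eventually.of_forall fun ω => ?_)
    exact Complex.re_add_im (v l ω)
  have hae : ∀ l, v l =ᵐ[P] (hm l).mk (v l) := fun l => (hm l).ae_eq_mk
  have hre' : ∀ l, (fun ω => (v l ω).re) =ᵐ[P] fun ω => ((hm l).mk (v l) ω).re := fun l =>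
    (hae l).fun_comp Complex.re
  have him' : ∀ l, (fun ω => (v l ω).im) =ᵐ[P] fun ω => ((hm l).mk (v l) ω).im := fun l =>
    (hae l).fun_comp Complex.im
  exact ⟨fun l => (hm l).mk (v l), ⟨fun l => (hm l).measurable_mk,
    fun l => (hre l).congr (hre' l).symm, fun l => (him l).congr (him' l).symm,
    fun l => (hreim l).congr (hre' l) (him' l), hv.congr hae⟩, ae_all_iff.2 hae⟩

theorem GaussianCoeffs.hasSum_chaosProj_numZeros [IsProbabilityMeasure P] {n : ℕ}
    (hv : GaussianCoeffs v P) (hn : n ∈ sumsOfTwoSquares) (hn0 : 0 < n) :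
    HasSum (fun q : ℕ => chaosProj v P (2 * (q + 2)) ((hv.memLp_numZeros hn hn0).toLp _))
      ((hv.memLp_numZeros hn hn0).toLp _
        - chaosProj v P 0 ((hv.memLp_numZeros hn hn0).toLp _)) := by
  set F := (hv.memLp_numZeros hn hn0).toLp (numZeros v n) with hF
  have hzero : ∀ m, chaosSum v n (indices m) = 0 → chaosProj v P m F = 0 := by
    intro m hm
    rw [hF, hv.chaosProj_numZeros_eq_toLp hn hn0]
    simp only [hm]
    exact MemLp.toLp_zero _
  have h1 := hv.hasSum_chaosProj (hv.numZeros_mem_closure_iSup hn hn0)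
  have hinj : Function.Injective fun q : ℕ => 2 * q := fun a b h => by
    simpa using h
  have h2 := (hinj.hasSum_iff (f := fun q => chaosProj v P q F) (a := F) (by
    intro m hm
    obtain ⟨q, rfl⟩ : Odd m := by
      rw [← Nat.not_even_iff_odd]
      rintro ⟨q, rfl⟩
      exact hm ⟨q, by simp only; ring⟩
    exact hzero _ (chaosSum_indices_odd v n q))).2 h1
  have h3 := (hasSum_nat_add_iff' (f := fun q => chaosProj v P (2 * q) F) 2).2 h2
  have h4 : chaosProj v P (2 * 1) F = 0 :=
    hzero _ (funext fun ω => chaosSum_two_eq_zero v hn0 ω)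
  rw [Finset.sum_range_succ, Finset.sum_range_one, h4, add_zero] at h3
  exact h3

end Modification

end

end ArithmeticWave

open ArithmeticWave
theorem lemma4p5 {Ω : Type*} [MeasurableSpace Ω] (P : Measure Ω) [IsProbabilityMeasure P]
    (v : (Fin 2 → ℤ) → Ω → ℂ)
    (hre : ∀ l, HasLaw (fun ω => (v l ω).re) (gaussianReal 0 1) P)
    (him : ∀ l, HasLaw (fun ω => (v l ω).im) (gaussianReal 0 1) P)
    (hreim : ∀ l, IndepFun (fun ω => (v l ω).re) (fun ω => (v l ω).im) P)
    (hv : iIndepFun v P)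
    (n : ℕ) (hn : n ∈ sumsOfTwoSquares) (hn0 : 0 < n) :
    (∀ᵐ ω ∂P, (zeroSet v n ω).Finite) ∧
    ∃ hI : MemLp (numZeros v n) 2 P,
      (∀ q : ℕ, chaosProj v P (2 * q + 1) (hI.toLp (numZeros v n)) = 0) ∧
      (∀ q : ℕ, chaosProj v P (2 * q) (hI.toLp (numZeros v n))
        =ᵐ[P] chaosSum v n (indices (2 * q))) ∧
      (∀ q : ℕ, chaosSum v n (indices (2 * q)) = chaosSum v n (parityIndices (2 * q))) ∧
      chaosProj v P 2 (hI.toLp (numZeros v n)) = 0 ∧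
      ∃ hJ : ∀ q : ℕ, MemLp (chaosSum v n (parityIndices (2 * q))) 2 P,
        HasSum (fun q : ℕ => (hJ (q + 2)).toLp (chaosSum v n (parityIndices (2 * (q + 2)))))
          (hI.toLp (numZeros v n) - chaosProj v P 0 (hI.toLp (numZeros v n))) := by
  obtain ⟨v', hv', hae⟩ := exists_gaussianCoeffs hre him hreim hv
  have hNZ : numZeros v' n =ᵐ[P] numZeros v n := by
    filter_upwards [hae] with ω hω
    exact (numZeros_congr hω n).symm
  have hCS : ∀ K, chaosSum v' n K =ᵐ[P] chaosSum v n K := by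
    intro K
    filter_upwards [hae] with ω hω
    exact (chaosSum_congr hω n K).symm
  have hI' := hv'.memLp_numZeros hn hn0
  have hI : MemLp (numZeros v n) 2 P := (memLp_congr_ae hNZ).1 hI'
  have hF : hI.toLp (numZeros v n) = hI'.toLp (numZeros v' n) :=
    (MemLp.toLp_congr hI' hI hNZ).symm
  have hJ : ∀ K, MemLp (chaosSum v n K) 2 P := fun K =>
    (memLp_congr_ae (hCS K)).1 (hv'.memLp_chaosSum hn hn0 K)
  have hproj : ∀ q, chaosProj v P q (hI.toLp (numZeros v n))
      = (hJ (indices q)).toLp (chaosSum v n (indices q)) := by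
    intro q
    rw [hF, chaosProj_congr hae, hv'.chaosProj_numZeros_eq_toLp hn hn0]
    exact MemLp.toLp_congr _ _ (hCS _)
  have hzero : ∀ q, chaosSum v n (indices q) = 0 →
      chaosProj v P q (hI.toLp (numZeros v n)) = 0 := by
    intro q hq
    rw [hproj]
    simp only [hq]
    exact MemLp.toLp_zero _
  refine ⟨?_, hI, fun q => hzero _ (chaosSum_indices_odd v n q), fun q => ?_,
    fun q => chaosSum_indices v n (2 * q), hzero 2 (funext fun ω => chaosSum_two_eq_zero v hn0 ω),
    fun q => hJ _, ?_⟩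
  · filter_upwards [hae, hv'.ae_zeroSet_finite hn] with ω h1 h2
    rw [zeroSet, wave_congr h1]
    exact h2
  · rw [hproj]
    exact (hJ _).coeFn_toLp
  · have h := hv'.hasSum_chaosProj_numZeros hn hn0
    rw [← chaosProj_congr hae, ← hF] at h
    refine h.congr_fun ?_
    intro q
    rw [← chaosProj_congr hae, hproj]
    simp only [chaosSum_indices]
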